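/- Let $M$ be a connected Hausdorff smooth ($C^\infty$) manifold of dimension $n+1\ge 2$, with a smooth Lorentz metric $g$ of signature $(-,+,\dots,+)$ and a time orientation given by a continuous timelike vector field. Write $I^\pm(p)$ and $J^\pm(p)$ for the chronological and causal future and past of $p$, defined by future-directed piecewise $C^1$ timelike and non-spacelike curves (with $p\in J^\pm(p)$), and $J^\pm(M)$ for the causal future and past of the set $M$. A (future-directed) *non-spacelike curve* is a continuous curve $\gamma$ on an interval of more than one point such that, for every parameter $t$ and every open $U\ni\gamma(t)$, one has $\gamma(s_1)\neq\gamma(s_2)$ and $\gamma(s_2)\in J^+(\gamma(s_1),U)$ for all $s_1<s_2$ in the interval that are close enough to $t$; it is *inextendible* if it has neither a future nor a past endpoint in $M$. *Strong causality* holds at $p$ if every neighbourhood of $p$ contains a neighbourhood of $p$ which no non-spacelike curve intersects more than once (that is, the curve meets it in a connected set of parameters). $(M,g)$ is *globally hyperbolic* if strong causality holds at every point and $J^+(p)\cap J^-(q)$ is compact for all $p,q\in M$. Let $C(p,q)$ be the set of non-spacelike curves from $p$ to $q$ up to reparametrization, with the topology whose basic open sets consist of all the curves with image contained in $W$, for $W\subseteq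 M$ open. A *Cauchy surface* is a closed acausal set (no two distinct points of it are joined by a non-spacelike curve) which is an embedded locally Lipschitz hypersurface and which each inextendible non-spacelike curve intersects exactly once. A *normalized volume measure* is a Borel measure $\mu$ with $\mu(M)=1$ which has, in each smooth chart, the same null sets as Lebesgue measure; put $f^\pm(p)=\mu(I^\pm(p))$ and $f=f^- /f^+$. **Theorem.** Let $(M,g)$ be globally hyperbolic. Then: 1. $J^+(p)$ and $J^-(p)$ are closed for all $p\in M$. 2. Strong causality holds on $M$, $M=J^-(M)\cap J^+(M)$, and the space $C(p,q)$ is compact for all $p,q\in M$. 3. There exist Cauchy surfaces. They are obtained as level sets of a volume-ratio time function: normalized volume measures exist, and for every such measure $\mu$ the functions $f^\pm$ are positive and continuous, $f$ is continuous and strictly increasing along every future-directed non-spacelike curve, and for every real $c>0$ the level set $\{p\in M: f(p)=c\}$ is a Cauchy surface. -/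

import Mathlib

open Set Topology MeasureTheory
open scoped Manifold ContDiff

noncomputable section

namespace Causality

/-- A space-time of dimension `n + 1` on the smooth manifold `M`: a smooth symmetric bilinear form
on the tangent spaces that has the diagonal form `(-,+,…,+)` at each point, and a time orientation,
given by a continuous timelike vector field. -/
structure Spacetime (n : ℕ) (M : Type*) [TopologicalSpace M]
    [ChartedSpace (EuclideanSpace ℝ (Fin (n + 1))) M] [IsManifold (𝓡 (n + 1)) ∞ M] where
  /-- The metric. -/
  metric (x : M) : TangentSpace (𝓡 (n + 1)) x →L[ℝ] TangentSpace (𝓡 (n + 1)) x →L[ℝ] ℝ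
  symm (x : M) (v w : TangentSpace (𝓡 (n + 1)) x) : metric x v w = metric x w v
  signature (x : M) : ∃ b : Module.Basis (Fin (n + 1)) ℝ (TangentSpace (𝓡 (n + 1)) x),
    ∀ i j, metric x (b i) (b j) = if i = j then (if i = 0 then -1 else 1) else 0
  contMDiff_metric : ContMDiff (𝓡 (n + 1))
    ((𝓡 (n + 1)).prod 𝓘(ℝ, EuclideanSpace ℝ (Fin (n + 1)) →L[ℝ]
      EuclideanSpace ℝ (Fin (n + 1)) →L[ℝ] ℝ)) ∞
    (fun x ↦ Bundle.TotalSpace.mk' (EuclideanSpace ℝ (Fin (n + 1)) →L[ℝ]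
      EuclideanSpace ℝ (Fin (n + 1)) →L[ℝ] ℝ) x (metric x))
  /-- The time orientation. -/
  orient (x : M) : TangentSpace (𝓡 (n + 1)) x
  continuous_orient :
    Continuous (fun x ↦ (⟨x, orient x⟩ : TangentBundle (𝓡 (n + 1)) M))
  timelike_orient (x : M) : metric x (orient x) (orient x) < 0

variable {n : ℕ} {M : Type*} [TopologicalSpace M]
  [ChartedSpace (EuclideanSpace ℝ (Fin (n + 1))) M] [IsManifold (𝓡 (n + 1)) ∞ M]

namespace Spacetime

variable (g : Spacetime n M)

/-- `v` is timelike and future-directed. -/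
def FutureTimelike (x : M) (v : TangentSpace (𝓡 (n + 1)) x) : Prop :=
  g.metric x v v < 0 ∧ g.metric x (g.orient x) v < 0

/-- `v` is timelike or null, and future-directed (in particular `v ≠ 0`). -/
def FutureCausal (x : M) (v : TangentSpace (𝓡 (n + 1)) x) : Prop :=
  g.metric x v v ≤ 0 ∧ g.metric x (g.orient x) v < 0

/-- There is a future-directed timelike curve of class `C¹` in `U` from `p` to `q`. -/
def TimelikeSegment (U : Set M) (p q : M) : Prop :=
  ∃ γ : ℝ → M, ContMDiffOn 𝓘(ℝ, ℝ) (𝓡 (n + 1)) 1 γ (Icc 0 1) ∧ γ 0 = p ∧ γ 1 = q ∧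
    ∀ t ∈ Icc (0 : ℝ) 1, γ t ∈ U ∧
      g.FutureTimelike (γ t) (mfderivWithin 𝓘(ℝ, ℝ) (𝓡 (n + 1)) γ (Icc 0 1) t (1 : ℝ))

/-- There is a future-directed non-spacelike curve of class `C¹` in `U` from `p` to `q`. -/
def CausalSegment (U : Set M) (p q : M) : Prop :=
  ∃ γ : ℝ → M, ContMDiffOn 𝓘(ℝ, ℝ) (𝓡 (n + 1)) 1 γ (Icc 0 1) ∧ γ 0 = p ∧ γ 1 = q ∧
    ∀ t ∈ Icc (0 : ℝ) 1, γ t ∈ U ∧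
      g.FutureCausal (γ t) (mfderivWithin 𝓘(ℝ, ℝ) (𝓡 (n + 1)) γ (Icc 0 1) t (1 : ℝ))

/-- The chronological future `I⁺(L, U)`: the points that are reached from `L` by a future-directed
timelike curve in `U`, the curves being piecewise `C¹` (finite chains of `C¹` segments). -/
def chronFuture (L U : Set M) : Set M :=
  {q | ∃ p ∈ L, Relation.TransGen (g.TimelikeSegment U) p q}

/-- The chronological past `I⁻(L, U)`. -/
def chronPast (L U : Set M) : Set M :=
  {q | ∃ p ∈ L, Relation.TransGen (g.TimelikeSegment U) q p}

/-- The causal future `J⁺(L, U)`: the union of `L ∩ U` with the set of the points that are reached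
from `L` by a future-directed non-spacelike (piecewise `C¹`) curve in `U`. -/
def causalFuture (L U : Set M) : Set M :=
  (L ∩ U) ∪ {q | ∃ p ∈ L, Relation.TransGen (g.CausalSegment U) p q}

/-- The causal past `J⁻(L, U)`. -/
def causalPast (L U : Set M) : Set M :=
  (L ∩ U) ∪ {q | ∃ p ∈ L, Relation.TransGen (g.CausalSegment U) q p}

/-- `γ`, restricted to the interval `F` (with more than one point), is a future-directed
non-spacelike curve. As usual in causality theory, non-spacelike curves are continuous curves: near
each parameter `t`, and inside any neighbourhood `U` of `γ t`, later points of the curve are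
different from earlier ones and lie in their causal future relative to `U`. Piecewise `C¹` curves
with future-directed non-spacelike tangents are of this kind. -/
def IsCausalCurve (F : Set ℝ) (γ : ℝ → M) : Prop :=
  F.OrdConnected ∧ F.Nontrivial ∧ ContinuousOn γ F ∧
    ∀ t ∈ F, ∀ U : Set M, IsOpen U → γ t ∈ U → ∃ G ∈ 𝓝 t, ∀ s₁ ∈ G ∩ F, ∀ s₂ ∈ G ∩ F, s₁ < s₂ →
      γ s₁ ≠ γ s₂ ∧ γ s₂ ∈ g.causalFuture {γ s₁} U

/-- Strong causality at `p`: every neighbourhood of `p` contains a neighbourhood of `p` which no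
non-spacelike curve intersects more than once, that is, which meets each such curve in a connected
set of parameters. -/
def StronglyCausalAt (p : M) : Prop :=
  ∀ U ∈ 𝓝 p, ∃ V ∈ 𝓝 p, V ⊆ U ∧
    ∀ (F : Set ℝ) (γ : ℝ → M), g.IsCausalCurve F γ → {t ∈ F | γ t ∈ V}.OrdConnected

/-- Global hyperbolicity. -/
def IsGloballyHyperbolic : Prop :=
  (∀ p, g.StronglyCausalAt p) ∧
    ∀ p q, IsCompact (g.causalFuture {p} univ ∩ g.causalPast {q} univ)

/-- The future-directed non-spacelike curves from `p` to `q`, parametrized by `[0, 1]`. -/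
def CausalPath (p q : M) : Type _ :=
  {γ : Path p q // g.IsCausalCurve (Icc 0 1) γ.extend}

/-- Two curves are equivalent if one is a reparametrization of the other (an order isomorphism
of `[0, 1]` is the same as an increasing homeomorphism). -/
def reparam (p q : M) : Setoid (g.CausalPath p q) where
  r γ l := ∃ f : unitInterval ≃o unitInterval, ∀ u, γ.1 (f u) = l.1 u
  iseqv :=
    { refl := fun _ ↦ ⟨OrderIso.refl _, fun _ ↦ rfl⟩
      symm := by
        rintro γ l ⟨f, hf⟩
        exact ⟨f.symm, fun u ↦ by rw [← hf, f.apply_symm_apply]⟩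
      trans := by
        rintro γ l m ⟨f, hf⟩ ⟨k, hk⟩
        exact ⟨k.trans f, fun u ↦ by rw [← hk, ← hf]; rfl⟩ }

/-- The space `C(p, q)` of the non-spacelike curves from `p` to `q`, up to reparametrization. -/
def CurveSpace (p q : M) : Type _ := Quotient (g.reparam p q)

/-- The set of the points of a curve in `C(p, q)`. -/
def CurveSpace.points {p q : M} (c : g.CurveSpace p q) : Set M :=
  Quotient.lift (s := g.reparam p q) (fun γ : g.CausalPath p q ↦ range γ.1) (by
    rintro γ l ⟨f, hf⟩
    have h : (l.1 : unitInterval → M) = γ.1 ∘ f := funext fun u ↦ (hf u).symm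
    change range (γ.1 : unitInterval → M) = range (l.1 : unitInterval → M)
    rw [h, f.surjective.range_comp]) c

/-- The topology of `C(p, q)`: the basic neighbourhoods of a curve consist of all the curves whose
points lie in a given open set `W` which contains the points of that curve. -/
instance (p q : M) : TopologicalSpace (g.CurveSpace p q) :=
  TopologicalSpace.generateFrom
    {A | ∃ W : Set M, IsOpen W ∧ A = {c | CurveSpace.points g c ⊆ W}}

/-- `p` is a future endpoint of the curve `γ` on `F`. -/
def IsFutureEndpoint (F : Set ℝ) (γ : ℝ → M) (p : M) : Prop :=
  ∀ V ∈ 𝓝 p, ∃ t ∈ F, ∀ t₁ ∈ F, t ≤ t₁ → γ t₁ ∈ V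

/-- `p` is a past endpoint of the curve `γ` on `F`. -/
def IsPastEndpoint (F : Set ℝ) (γ : ℝ → M) (p : M) : Prop :=
  ∀ V ∈ 𝓝 p, ∃ t ∈ F, ∀ t₁ ∈ F, t₁ ≤ t → γ t₁ ∈ V

/-- An inextendible non-spacelike curve: one with neither a future nor a past endpoint. -/
def IsInextendible (F : Set ℝ) (γ : ℝ → M) : Prop :=
  g.IsCausalCurve F γ ∧ (∀ p, ¬ IsFutureEndpoint F γ p) ∧ ∀ p, ¬ IsPastEndpoint F γ p

/-- `S` is an embedded locally Lipschitz hypersurface: near each of its points there are smooth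
coordinates `(x⁰, …, xⁿ)` in which `S` is the graph `x⁰ = h (x¹, …, xⁿ)` of a Lipschitz function. -/
def IsLipschitzHypersurface (n : ℕ) {M : Type*} [TopologicalSpace M]
    [ChartedSpace (EuclideanSpace ℝ (Fin (n + 1))) M] [IsManifold (𝓡 (n + 1)) ∞ M]
    (S : Set M) : Prop :=
  ∀ p ∈ S, ∃ e ∈ IsManifold.maximalAtlas (𝓡 (n + 1)) ∞ M, p ∈ e.source ∧
    ∃ (K : NNReal) (h : (Fin n → ℝ) → ℝ), LipschitzWith K h ∧
      ∀ x ∈ e.source, x ∈ S ↔ e x 0 = h (fun i ↦ e x i.succ)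

/-- `S` is acausal: no two different points of `S` are joined by a non-spacelike curve. -/
def IsAcausal (S : Set M) : Prop :=
  ∀ p ∈ S, ∀ q ∈ S, q ∈ g.causalFuture {p} univ → q = p

/-- A Cauchy surface: a hypersurface which is spacelike (in the sense that applies to locally
Lipschitz hypersurfaces, namely closed and acausal) and which each inextendible non-spacelike
curve intersects exactly once. -/
def IsCauchySurface (S : Set M) : Prop :=
  IsClosed S ∧ IsLipschitzHypersurface n S ∧ g.IsAcausal S ∧
    ∀ (F : Set ℝ) (γ : ℝ → M), g.IsInextendible F γ → ∃! t, t ∈ F ∧ γ t ∈ S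

/-- `μ` is a measure on `M` with total volume `1` which has, in each smooth chart, the same null
sets as Lebesgue measure. -/
def IsNormalizedVolume (n : ℕ) {M : Type*} [TopologicalSpace M]
    [ChartedSpace (EuclideanSpace ℝ (Fin (n + 1))) M] [IsManifold (𝓡 (n + 1)) ∞ M]
    [MeasurableSpace M] (μ : Measure M) : Prop :=
  μ univ = 1 ∧ ∀ e ∈ IsManifold.maximalAtlas (𝓡 (n + 1)) ∞ M, ∀ A ⊆ e.source, MeasurableSet A →
    (μ A = 0 ↔ volume (e '' A) = 0)

/-- The volume `f⁺(p)` of `I⁺(p)`. -/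
def volFuture [MeasurableSpace M] (μ : Measure M) (p : M) : ℝ :=
  μ.real (g.chronFuture {p} univ)

/-- The volume `f⁻(p)` of `I⁻(p)`. -/
def volPast [MeasurableSpace M] (μ : Measure M) (p : M) : ℝ :=
  μ.real (g.chronPast {p} univ)

/-- The volume ratio `f = f⁻ / f⁺`. -/
def volRatio [MeasurableSpace M] (μ : Measure M) (p : M) : ℝ :=
  g.volPast μ p / g.volFuture μ p

end Spacetime

end Causality

end

/-! Two facts hold in every space-time. The sets $I^\pm(p)$ are open, because the last piece of a
timelike curve can be replaced by a timelike chord to any nearby point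
(`eventually_transGen_segment`). A causal curve followed by a timelike one can be replaced by a
timelike one (`chronFuture_of_causalSegment`); this rests on the deformation of short causal curves
in a chart (`exists_timelike_deformation`).

Under global hyperbolicity, $J^\pm(p)$ are closed (`isClosed_causalFuture`), the causal relation is
closed in $M\times M$ (`isClosed_causalRel`), and strong causality makes it antisymmetric.

The set $J^-(p)\setminus I^-(p)$ meets each short line in a suitable timelike direction at most
once, so it is null (`measure_causalPast_diff`). With the closedness of $J^\pm$ this makes $f^\pm$
continuous and strictly monotone. A curve without future endpoint leaves $J^-(y)$ for every $y$, so
the futures of its points shrink to the empty set, $f^+\to 0$ and $f\to\infty$; by time reversal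
$f\to 0$ in the past if there is no past endpoint. Hence an inextendible curve crosses each level
$c>0$ exactly once. Levels are Lipschitz graphs because, in suitable coordinates, a fixed cone
around the first axis is timelike and no two points of a level are timelike related
(`isLipschitzHypersurface`).

Volume measures require second countability, which comes from the Riemannian metric obtained by
changing the sign of $g$ along the orientation (`IsLorentz.secondCountableTopology`).

For the compactness of $C(p,q)$, curves are parametrized by the time function $f$. Along an
ultrafilter of curves, the points at each level converge in the compact set $J^+(p)\cap J^-(q)$;
closedness of the causal relation makes the limits a causal curve, to which the ultrafilter
converges (`compactSpace_curveSpace`). -/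

open Set Topology MeasureTheory
open scoped Manifold ContDiff

noncomputable section

namespace Causality

open Filter

variable {n : ℕ} {M : Type*} [TopologicalSpace M]
  [ChartedSpace (EuclideanSpace ℝ (Fin (n + 1))) M] [IsManifold (𝓡 (n + 1)) ∞ M]

namespace Spacetime

variable (g : Spacetime n M)

/-! ### Lorentzian linear algebra -/

/-- The metric in terms of the coordinates in an orthonormal basis. -/
lemma exists_basis_metric_eq (x : M) :
    ∃ b : Module.Basis (Fin (n + 1)) ℝ (TangentSpace (𝓡 (n + 1)) x), ∀ v w,
      g.metric x v w = -(b.repr v 0 * b.repr w 0) +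
        ∑ i : Fin n, b.repr v i.succ * b.repr w i.succ := by
  obtain ⟨b, hb⟩ := g.signature x
  refine ⟨b, fun v w ↦ ?_⟩
  have hv := b.sum_repr v
  have hw := b.sum_repr w
  conv_lhs => rw [← hv, ← hw]
  simp only [map_sum, map_smul, sum_apply, smul_apply, hb,
    smul_eq_mul, mul_ite, mul_zero]
  rw [Fin.sum_univ_succ]
  simp [Fin.succ_ne_zero, mul_comm]

/-- The orthogonal complement of a timelike vector contains no causal vector. -/
lemma eq_zero_of_metric_eq_zero {x : M} {o v : TangentSpace (𝓡 (n + 1)) x}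
    (ho : g.metric x o o < 0) (hv : g.metric x v v ≤ 0) (hov : g.metric x o v = 0) : v = 0 := by
  obtain ⟨b, hb⟩ := g.exists_basis_metric_eq x
  rw [hb] at ho hv hov
  have cs := Finset.sum_mul_sq_le_sq_mul_sq Finset.univ
    (fun i : Fin n ↦ b.repr o i.succ) (fun i : Fin n ↦ b.repr v i.succ)
  simp only [← sq] at ho hv
  set A := ∑ i : Fin n, b.repr o i.succ ^ 2
  set B := ∑ i : Fin n, b.repr v i.succ ^ 2 with hB
  have hA0 : 0 ≤ A := Finset.sum_nonneg fun i _ ↦ sq_nonneg _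
  have hB0 : 0 ≤ B := Finset.sum_nonneg fun i _ ↦ sq_nonneg _
  have h1 : ∑ i : Fin n, b.repr o i.succ * b.repr v i.succ = b.repr o 0 * b.repr v 0 := by linarith
  rw [h1, mul_pow] at cs
  -- Cauchy–Schwarz gives $o_0^2v_0^2\le AB$, while $A<o_0^2$ and $B\le v_0^2$; this forces $v_0=0$.
  have h2 : b.repr v 0 ^ 2 = 0 := by
    by_contra h
    have h3 : 0 < b.repr v 0 ^ 2 := lt_of_le_of_ne (sq_nonneg _) (Ne.symm h)
    nlinarith
  have h4 : B = 0 := by nlinarith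
  rw [Finset.sum_eq_zero_iff_of_nonneg fun i _ ↦ sq_nonneg _] at h4
  refine b.repr.map_eq_zero_iff.1 (Finsupp.ext fun i ↦ ?_)
  refine Fin.cases ?_ (fun i ↦ ?_) i
  · simpa using h2
  · simpa using h4 i (Finset.mem_univ i)

end Spacetime

end Causality

namespace Causality

open Filter Bundle

/-! ### Tangent vectors in coordinates -/

section Coordinates

variable {E : Type*} [NormedAddCommGroup E] [NormedSpace ℝ E]
  {M : Type*} [TopologicalSpace M] [ChartedSpace E M]

/-- The tangent vector with the coordinates `v` at the point with the coordinates `y`. -/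
def coordVec (e : OpenPartialHomeomorph M E) (y : E) : E →L[ℝ] TangentSpace 𝓘(ℝ, E) (e.symm y) :=
  mfderiv 𝓘(ℝ, E) 𝓘(ℝ, E) e.symm y

/-- A family of bilinear forms on the tangent spaces, in the coordinates `e`. -/
def coordBilin (m : ∀ x : M, TangentSpace 𝓘(ℝ, E) x →L[ℝ] TangentSpace 𝓘(ℝ, E) x →L[ℝ] ℝ)
    (e : OpenPartialHomeomorph M E) (y : E) : E →L[ℝ] E →L[ℝ] ℝ :=
  ContinuousLinearMap.bilinearComp (E := E) (F := E) (m (e.symm y) : E →L[ℝ] E →L[ℝ] ℝ)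
    (coordVec e y : E →L[ℝ] E) (coordVec e y : E →L[ℝ] E)

/-- A family of linear forms on the tangent spaces, in the coordinates `e`. -/
def coordLin (m : ∀ x : M, TangentSpace 𝓘(ℝ, E) x →L[ℝ] ℝ)
    (e : OpenPartialHomeomorph M E) (y : E) : E →L[ℝ] ℝ :=
  (m (e.symm y)).comp (coordVec e y)

lemma coordBilin_apply (m : ∀ x : M, TangentSpace 𝓘(ℝ, E) x →L[ℝ] TangentSpace 𝓘(ℝ, E) x →L[ℝ] ℝ)
    (e : OpenPartialHomeomorph M E) (y v w : E) :
    coordBilin m e y v w = m (e.symm y) (coordVec e y v) (coordVec e y w) := rfl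

lemma coordLin_apply (m : ∀ x : M, TangentSpace 𝓘(ℝ, E) x →L[ℝ] ℝ)
    (e : OpenPartialHomeomorph M E) (y v : E) :
    coordLin m e y v = m (e.symm y) (coordVec e y v) := rfl

variable {e : OpenPartialHomeomorph M E}

/-- A smooth chart has invertible derivatives. -/
lemma coordVec_bijective (he : e ∈ IsManifold.maximalAtlas 𝓘(ℝ, E) ∞ M) {y : E}
    (hy : y ∈ e.target) : Function.Bijective (coordVec e y) := by
  have he1 : e ∈ IsManifold.maximalAtlas 𝓘(ℝ, E) 1 M :=
    IsManifold.maximalAtlas_subset_of_le (by simp) he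
  have hm : e.MDifferentiable 𝓘(ℝ, E) 𝓘(ℝ, E) := 
    ⟨fun x hx ↦ (mdifferentiableAt_of_mem_maximalAtlas he1 hx).mdifferentiableWithinAt,
      fun x hx ↦ (mdifferentiableAt_symm_of_mem_maximalAtlas he1 hx).mdifferentiableWithinAt⟩
  exact hm.symm.mfderiv_bijective hy

/-- The velocity of a curve that is given in coordinates. -/
lemma mfderivWithin_symm_comp (he : e ∈ IsManifold.maximalAtlas 𝓘(ℝ, E) ∞ M) {c : ℝ → E}
    {s : Set ℝ} {t : ℝ} (hs : UniqueDiffWithinAt ℝ s t) (hc : DifferentiableWithinAt ℝ c s t)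
    (ht : c t ∈ e.target) :
    mfderivWithin 𝓘(ℝ, ℝ) 𝓘(ℝ, E) (e.symm ∘ c) s t (1 : ℝ) =
      coordVec e (c t) (derivWithin c s t) := by
  have he1 : e ∈ IsManifold.maximalAtlas 𝓘(ℝ, E) 1 M :=
    IsManifold.maximalAtlas_subset_of_le (by simp) he
  rw [mfderiv_comp_mfderivWithin t (mdifferentiableAt_symm_of_mem_maximalAtlas he1 ht)
    hc.mdifferentiableWithinAt hs.uniqueMDiffWithinAt]
  rw [mfderivWithin_eq_fderivWithin]
  rfl

variable [IsManifold 𝓘(ℝ, E) ∞ M]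

/-- The tangent map of `e.symm` carries constant fields to smooth ones. Evaluating the metric on two
such fields gives its components in the chart. -/
lemma contMDiffOn_coordVec (he : e ∈ IsManifold.maximalAtlas 𝓘(ℝ, E) ∞ M) (u : E) :
    ContMDiffOn 𝓘(ℝ, E) 𝓘(ℝ, E).tangent ∞
      (fun y ↦ (⟨e.symm y, coordVec e y u⟩ : TangentBundle 𝓘(ℝ, E) M)) e.target := by
  have h := (contMDiffOn_symm_of_mem_maximalAtlas he).contMDiffOn_tangentMapWithin
    (m := ∞) (n := ∞) (by simp) e.open_target.uniqueMDiffOn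
  have hu : ContMDiffOn 𝓘(ℝ, E) 𝓘(ℝ, E).tangent ∞
      (fun y ↦ (⟨y, u⟩ : TangentBundle 𝓘(ℝ, E) E)) e.target :=
    contMDiffOn_vectorSpace_iff_contDiffOn.2 contDiffOn_const
  refine (h.comp hu fun y hy ↦ hy).congr fun y hy ↦ ?_
  simp only [Function.comp, tangentMapWithin]
  rw [mfderivWithin_of_isOpen e.open_target hy]
  rfl

lemma contDiffOn_coordBilin [FiniteDimensional ℝ E]
    {m : ∀ x : M, TangentSpace 𝓘(ℝ, E) x →L[ℝ] TangentSpace 𝓘(ℝ, E) x →L[ℝ] ℝ}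
    (hm : ContMDiff 𝓘(ℝ, E) (𝓘(ℝ, E).prod 𝓘(ℝ, E →L[ℝ] E →L[ℝ] ℝ)) ∞
      (fun x ↦ Bundle.TotalSpace.mk' (E →L[ℝ] E →L[ℝ] ℝ) x (m x)))
    (he : e ∈ IsManifold.maximalAtlas 𝓘(ℝ, E) ∞ M) :
    ContDiffOn ℝ ∞ (coordBilin m e) e.target := by
  refine contDiffOn_clm_apply.2 fun u ↦ contDiffOn_clm_apply.2 fun w ↦ ?_
  have h := (hm.comp_contMDiffOn
    (contMDiffOn_symm_of_mem_maximalAtlas he)).clm_bundle_apply₂ (F₁ := E)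
    (F₂ := E) (E₃ := Bundle.Trivial M ℝ) (F₃ := ℝ)
    (contMDiffOn_coordVec he u) (contMDiffOn_coordVec he w)
  exact fun y hy ↦ contMDiffWithinAt_iff_contDiffWithinAt.1
    (Bundle.contMDiffWithinAt_totalSpace.1 (h y hy)).2

/-- Only continuity is available here, since the orientation is merely continuous. The estimates
below therefore use a Lipschitz bound for the metric but never for this form. -/
lemma continuousOn_coordLin [FiniteDimensional ℝ E]
    {m : ∀ x : M, TangentSpace 𝓘(ℝ, E) x →L[ℝ] TangentSpace 𝓘(ℝ, E) x →L[ℝ] ℝ}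
    (hm : ContMDiff 𝓘(ℝ, E) (𝓘(ℝ, E).prod 𝓘(ℝ, E →L[ℝ] E →L[ℝ] ℝ)) ∞
      (fun x ↦ Bundle.TotalSpace.mk' (E →L[ℝ] E →L[ℝ] ℝ) x (m x)))
    {o : ∀ x : M, TangentSpace 𝓘(ℝ, E) x}
    (ho : Continuous (fun x ↦ (⟨x, o x⟩ : TangentBundle 𝓘(ℝ, E) M)))
    (he : e ∈ IsManifold.maximalAtlas 𝓘(ℝ, E) ∞ M) :
    ContinuousOn (coordLin (fun x ↦ m x (o x)) e) e.target := by
  refine continuousOn_clm_apply.2 fun w ↦ ?_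
  have hs := (contMDiffOn_symm_of_mem_maximalAtlas he).continuousOn
  have h : ContMDiffOn 𝓘(ℝ, E) (𝓘(ℝ, E).prod 𝓘(ℝ, ℝ)) 0 _ e.target :=
    (((hm.of_le (zero_le : (0 : ℕ∞ω) ≤ ∞)).comp_contMDiffOn
    (contMDiffOn_symm_of_mem_maximalAtlas he |>.of_le (zero_le))).clm_bundle_apply₂ (F₁ := E)
    (F₂ := E) (E₃ := Bundle.Trivial M ℝ) (F₃ := ℝ)
    (contMDiffOn_zero_iff.2 (ho.comp_continuousOn hs))
    ((contMDiffOn_coordVec he w).of_le zero_le))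
  exact fun y hy ↦ (Bundle.contMDiffWithinAt_totalSpace.1 (h y hy)).2.continuousWithinAt

end Coordinates

end Causality

namespace Causality

open Filter Bundle

/-! ### Curve segments -/

section Segments

variable {E : Type*} [NormedAddCommGroup E] [NormedSpace ℝ E]
  {M : Type*} [TopologicalSpace M] [ChartedSpace E M]

/-- There is a `C¹` curve in `U` from `p` to `q` with velocities that satisfy `P`. -/
def Segment (P : ∀ x : M, TangentSpace 𝓘(ℝ, E) x → Prop) (U : Set M) (p q : M) : Prop :=
  ∃ γ : ℝ → M, ContMDiffOn 𝓘(ℝ, ℝ) 𝓘(ℝ, E) 1 γ (Icc 0 1) ∧ γ 0 = p ∧ γ 1 = q ∧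
    ∀ t ∈ Icc (0 : ℝ) 1, γ t ∈ U ∧
      P (γ t) (mfderivWithin 𝓘(ℝ, ℝ) 𝓘(ℝ, E) γ (Icc 0 1) t (1 : ℝ))

variable {P Q : ∀ x : M, TangentSpace 𝓘(ℝ, E) x → Prop} {U V : Set M} {p q : M}

lemma Segment.mono (h : Segment P U p q) (hP : ∀ x v, P x v → Q x v) (hU : U ⊆ V) :
    Segment Q V p q := by
  obtain ⟨γ, hγ, h0, h1, h⟩ := h
  exact ⟨γ, hγ, h0, h1, fun t ht ↦ ⟨hU (h t ht).1, hP _ _ (h t ht).2⟩⟩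

lemma mfderivWithin_comp_affine {γ : ℝ → M}
    (hγ : ContMDiffOn 𝓘(ℝ, ℝ) 𝓘(ℝ, E) 1 γ (Icc 0 1)) {a b t : ℝ}
    (hab : MapsTo (fun s ↦ a + b * s) (Icc 0 1) (Icc 0 1)) (ht : t ∈ Icc (0 : ℝ) 1) :
    mfderivWithin 𝓘(ℝ, ℝ) 𝓘(ℝ, E) (γ ∘ fun s ↦ a + b * s) (Icc 0 1) t (1 : ℝ) =
      b • mfderivWithin 𝓘(ℝ, ℝ) 𝓘(ℝ, E) γ (Icc 0 1) (a + b * t) (1 : ℝ) := by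
  have hd : HasDerivAt (fun s : ℝ ↦ a + b * s) b t := by
    simpa using ((hasDerivAt_id t).const_mul b).const_add a
  have hu : UniqueDiffWithinAt ℝ (Icc (0 : ℝ) 1) t := uniqueDiffOn_Icc zero_lt_one t ht
  rw [mfderivWithin_comp t ((hγ _ (hab ht)).mdifferentiableWithinAt one_ne_zero)
    hd.differentiableAt.differentiableWithinAt.mdifferentiableWithinAt hab hu.uniqueMDiffWithinAt]
  have : mfderivWithin 𝓘(ℝ, ℝ) 𝓘(ℝ, ℝ) (fun s : ℝ ↦ a + b * s) (Icc 0 1) t (1 : ℝ) = b := by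
    rw [mfderivWithin_eq_fderivWithin]
    exact (fderivWithin_derivWithin (𝕜 := ℝ)).trans (hd.hasDerivWithinAt.derivWithin hu)
  refine (congrArg (mfderivWithin 𝓘(ℝ, ℝ) 𝓘(ℝ, E) γ (Icc 0 1) (a + b * t)) this).trans ?_
  have := (mfderivWithin 𝓘(ℝ, ℝ) 𝓘(ℝ, E) γ (Icc 0 1) (a + b * t)).map_smul b (1 : ℝ)
  rw [← this]
  exact congrArg _ (mul_one b).symm

/-- The slope `b` may have either sign: `b = -1` yields time reversal, `b > 0` the restriction to a
subinterval. -/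
lemma segment_comp_affine {γ : ℝ → M}
    (hγ : ContMDiffOn 𝓘(ℝ, ℝ) 𝓘(ℝ, E) 1 γ (Icc 0 1)) {a b : ℝ}
    (hab : MapsTo (fun s ↦ a + b * s) (Icc 0 1) (Icc 0 1))
    (hP : ∀ t ∈ Icc (0 : ℝ) 1, γ (a + b * t) ∈ U ∧ P (γ (a + b * t))
      (b • mfderivWithin 𝓘(ℝ, ℝ) 𝓘(ℝ, E) γ (Icc 0 1) (a + b * t) (1 : ℝ))) :
    Segment P U (γ a) (γ (a + b)) := by
  refine ⟨γ ∘ fun s ↦ a + b * s, hγ.comp ?_ hab, by simp, by simp, fun t ht ↦ ⟨(hP t ht).1, ?_⟩⟩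
  · exact ContDiffOn.contMDiffOn (by fun_prop)
  · rw [mfderivWithin_comp_affine hγ hab ht]
    exact (hP t ht).2

lemma Segment.reverse (h : Segment P U p q) : Segment (fun x v ↦ P x (-v)) U q p := by
  obtain ⟨γ, hγ, rfl, rfl, h⟩ := h
  have hm : MapsTo (fun s : ℝ ↦ 1 + -1 * s) (Icc 0 1) (Icc 0 1) := fun s hs ↦
    ⟨by linarith [hs.2], by linarith [hs.1]⟩
  have := segment_comp_affine (P := fun x v ↦ P x (-v)) (U := U) hγ hm fun t ht ↦
    ⟨(h _ (hm ht)).1, by simpa using (h _ (hm ht)).2⟩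
  simpa using this

/-- A part of a segment. -/
lemma segment_of_subinterval (hP : ∀ (x : M) (v : TangentSpace 𝓘(ℝ, E) x) (r : ℝ), 0 < r →
      P x v → P x (r • v)) {γ : ℝ → M} (hγ : ContMDiffOn 𝓘(ℝ, ℝ) 𝓘(ℝ, E) 1 γ (Icc 0 1))
    (h : ∀ t ∈ Icc (0 : ℝ) 1, P (γ t) (mfderivWithin 𝓘(ℝ, ℝ) 𝓘(ℝ, E) γ (Icc 0 1) t (1 : ℝ)))
    {a b : ℝ} (ha : 0 ≤ a) (hab : a < b) (hb : b ≤ 1) (hU : MapsTo γ (Icc a b) U) :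
    Segment P U (γ a) (γ b) := by
  have hm : MapsTo (fun s : ℝ ↦ a + (b - a) * s) (Icc 0 1) (Icc a b) := fun s hs ↦
    ⟨by nlinarith [hs.1], by nlinarith [hs.2]⟩
  have hm' : MapsTo (fun s : ℝ ↦ a + (b - a) * s) (Icc 0 1) (Icc 0 1) :=
    hm.mono_right (Icc_subset_Icc ha hb)
  have := segment_comp_affine (P := P) (U := U) hγ hm' fun t ht ↦
    ⟨hU (hm ht), hP _ _ _ (sub_pos.2 hab) (h _ (hm' ht))⟩
  rwa [add_sub_cancel] at this

variable {e : OpenPartialHomeomorph M E}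

/-- A segment that is given in coordinates. -/
lemma segment_of_coord (he : e ∈ IsManifold.maximalAtlas 𝓘(ℝ, E) ∞ M) {c : ℝ → E}
    (hc : ContDiffOn ℝ 1 c (Icc 0 1))
    (h : ∀ t ∈ Icc (0 : ℝ) 1, c t ∈ e.target ∧ e.symm (c t) ∈ U ∧
      P (e.symm (c t)) (coordVec e (c t) (derivWithin c (Icc 0 1) t))) :
    Segment P U (e.symm (c 0)) (e.symm (c 1)) := by
  refine ⟨e.symm ∘ c, ?_, rfl, rfl, fun t ht ↦ ⟨(h t ht).2.1, ?_⟩⟩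
  · exact ((contMDiffOn_symm_of_mem_maximalAtlas he).of_le (by simp)).comp hc.contMDiffOn
      fun t ht ↦ (h t ht).1
  · rw [mfderivWithin_symm_comp he (uniqueDiffOn_Icc zero_lt_one t ht)
      ((hc t ht).differentiableWithinAt one_ne_zero) (h t ht).1]
    exact (h t ht).2.2

/-- The coordinates of a curve. -/
lemma contDiffOn_coord_curve {γ : ℝ → M} (hγ : ContMDiffOn 𝓘(ℝ, ℝ) 𝓘(ℝ, E) 1 γ (Icc 0 1))
    (h : ∀ t ∈ Icc (0 : ℝ) 1, γ t ∈ U ∧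
      P (γ t) (mfderivWithin 𝓘(ℝ, ℝ) 𝓘(ℝ, E) γ (Icc 0 1) t (1 : ℝ)))
    (he : e ∈ IsManifold.maximalAtlas 𝓘(ℝ, E) ∞ M) (hU : U ⊆ e.source) :
    ContDiffOn ℝ 1 (e ∘ γ) (Icc 0 1) ∧ ∀ t ∈ Icc (0 : ℝ) 1, e (γ t) ∈ e.target ∧
      e.symm (e (γ t)) ∈ U ∧
      P (e.symm (e (γ t))) (coordVec e (e (γ t)) (derivWithin (e ∘ γ) (Icc 0 1) t)) := by
  have hs : MapsTo γ (Icc 0 1) e.source := fun t ht ↦ hU (h t ht).1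
  have hc : ContDiffOn ℝ 1 (e ∘ γ) (Icc 0 1) := contMDiffOn_iff_contDiffOn.1
    (((contMDiffOn_of_mem_maximalAtlas he).of_le (by simp)).comp hγ hs)
  refine ⟨hc, fun t ht ↦ ⟨e.map_source (hs ht), ?_⟩⟩
  have h2 : e.symm (e (γ t)) = γ t := e.left_inv (hs ht)
  refine ⟨by rw [h2]; exact (h t ht).1, ?_⟩
  have h1 := mfderivWithin_symm_comp he (uniqueDiffOn_Icc zero_lt_one t ht)
      ((hc t ht).differentiableWithinAt one_ne_zero) (e.map_source (hs ht))
  have h3 : (mfderivWithin 𝓘(ℝ, ℝ) 𝓘(ℝ, E) (e.symm ∘ e ∘ γ) (Icc 0 1) t : ℝ →L[ℝ] E) =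
      mfderivWithin 𝓘(ℝ, ℝ) 𝓘(ℝ, E) γ (Icc 0 1) t :=
    mfderivWithin_congr (fun s hs' ↦ e.left_inv (hs hs')) h2
  -- The two velocities lie over base points that are equal only propositionally, so they are
  -- compared in the total space.
  have h4 : (⟨_, mfderivWithin 𝓘(ℝ, ℝ) 𝓘(ℝ, E) (e.symm ∘ e ∘ γ) (Icc 0 1) t (1 : ℝ)⟩ :
      TangentBundle 𝓘(ℝ, E) M) = ⟨_, mfderivWithin 𝓘(ℝ, ℝ) 𝓘(ℝ, E) γ (Icc 0 1) t (1 : ℝ)⟩ :=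
    TotalSpace.ext h2 (heq_of_eq (congrArg (fun f : ℝ →L[ℝ] E ↦ f 1) h3))
  refine (congrArg (P _) h1).mp ?_
  exact (congrArg (fun z : TangentBundle 𝓘(ℝ, E) M ↦ P z.1 z.2) h4).mpr (h t ht).2

/-- The coordinates of a segment. -/
lemma Segment.exists_coord (h : Segment P U p q)
    (he : e ∈ IsManifold.maximalAtlas 𝓘(ℝ, E) ∞ M) (hU : U ⊆ e.source) :
    ∃ c : ℝ → E, ContDiffOn ℝ 1 c (Icc 0 1) ∧ c 0 = e p ∧ c 1 = e q ∧
      ∀ t ∈ Icc (0 : ℝ) 1, c t ∈ e.target ∧ e.symm (c t) ∈ U ∧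
        P (e.symm (c t)) (coordVec e (c t) (derivWithin c (Icc 0 1) t)) := by
  obtain ⟨γ, hγ, rfl, rfl, h⟩ := h
  obtain ⟨h1, h2⟩ := contDiffOn_coord_curve hγ h he hU
  exact ⟨e ∘ γ, h1, rfl, rfl, h2⟩

end Segments

end Causality

namespace Causality

open Filter

/-! ### Light cones in a vector space -/

section Cones

variable {E : Type*} [NormedAddCommGroup E] [NormedSpace ℝ E]
  {G : E → E →L[ℝ] E →L[ℝ] ℝ} {N : E → E →L[ℝ] ℝ} {Ω : Set E} {y₀ u : E}

/-- Timelike vectors form an open set. -/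
lemma eventually_timelike (hG : ContinuousAt G y₀) (hN : ContinuousAt N y₀)
    (h1 : G y₀ u u < 0) (h2 : N y₀ u < 0) :
    ∀ᶠ z : E × E in 𝓝 (y₀, u), G z.1 z.2 z.2 < 0 ∧ N z.1 z.2 < 0 := by
  have hf : ContinuousAt (Prod.fst : E × E → E) (y₀, u) := continuousAt_fst
  have hs : ContinuousAt (Prod.snd : E × E → E) (y₀, u) := continuousAt_snd
  have c1 : ContinuousAt (fun z : E × E ↦ G z.1 z.2 z.2) (y₀, u) :=
    ((ContinuousAt.comp (f := Prod.fst) (x := (y₀, u)) hG hf).clm_apply hs).clm_apply hs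
  have c2 : ContinuousAt (fun z : E × E ↦ N z.1 z.2) (y₀, u) :=
    (ContinuousAt.comp (f := Prod.fst) (x := (y₀, u)) hN hf).clm_apply hs
  exact (c1.eventually_lt_const h1).and (c2.eventually_lt_const h2)

/-- The causal cones at the points near `y₀` lie in a fixed half-space. -/
lemma exists_causal_le [FiniteDimensional ℝ E] (hG : ContinuousAt G y₀) (hN : ContinuousAt N y₀)
    (h : ∀ v, G y₀ v v ≤ 0 → N y₀ v = 0 → v = 0) :
    ∃ k > 0, ∀ᶠ y in 𝓝 y₀, ∀ v, G y v v ≤ 0 → N y v ≤ 0 → k * ‖v‖ ≤ -N y₀ v := by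
  obtain ⟨k, hk, hk'⟩ : ∃ k > 0, ∀ v ∈ Metric.sphere (0 : E) 1, G y₀ v v ≤ 0 → N y₀ v ≤ 0 →
      k < -N y₀ v := by
    have hc : IsCompact (Metric.sphere (0 : E) 1 ∩ {v | G y₀ v v ≤ 0 ∧ N y₀ v ≤ 0}) := by
      refine (isCompact_sphere _ _).inter_right ?_
      have c1 : Continuous fun v ↦ G y₀ v v := by fun_prop
      exact (isClosed_le c1 continuous_const).inter
        (isClosed_le (N y₀).continuous continuous_const)
    rcases eq_empty_or_nonempty (Metric.sphere (0 : E) 1 ∩ {v | G y₀ v v ≤ 0 ∧ N y₀ v ≤ 0})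
      with he | hne
    · exact ⟨1, one_pos, fun v hv h1 h2 ↦ absurd (he ▸ ⟨hv, h1, h2⟩ : v ∈ (∅ : Set E)) id⟩
    · obtain ⟨w, ⟨hw, hw1, hw2⟩, hmin⟩ := hc.exists_isMinOn hne
        (f := fun v ↦ -N y₀ v) (by fun_prop)
      have hw0 : w ≠ 0 := fun h0 ↦ by simp [h0] at hw
      have hpos : 0 < -N y₀ w := by
        have := lt_of_le_of_ne hw2 fun h0 ↦ hw0 (h w hw1 h0)
        linarith
      refine ⟨-N y₀ w / 2, by linarith, fun v hv h1 h2 ↦ ?_⟩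
      have := hmin ⟨hv, h1, h2⟩
      simp only [mem_ofPred_eq] at this
      linarith
  -- Each of the three alternatives is an open condition on `(y, v)`, so compactness of the sphere
  -- gives one neighbourhood of `y₀` for all unit vectors. Homogeneity then covers all vectors.
  have key : ∀ᶠ y in 𝓝 y₀, ∀ v ∈ Metric.sphere (0 : E) 1, 0 < G y v v ∨ 0 < N y v ∨
      k < -N y₀ v := by
    refine (isCompact_sphere (0 : E) 1).eventually_forall_of_forall_eventually fun v hv ↦ ?_
    have hf : ContinuousAt (Prod.fst : E × E → E) (y₀, v) := continuousAt_fst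
    have hs : ContinuousAt (Prod.snd : E × E → E) (y₀, v) := continuousAt_snd
    have c1 : ContinuousAt (fun z : E × E ↦ G z.1 z.2 z.2) (y₀, v) :=
      ((ContinuousAt.comp (f := Prod.fst) (x := (y₀, v)) hG hf).clm_apply hs).clm_apply hs
    have c2 : ContinuousAt (fun z : E × E ↦ N z.1 z.2) (y₀, v) :=
      (ContinuousAt.comp (f := Prod.fst) (x := (y₀, v)) hN hf).clm_apply hs
    have c3 : ContinuousAt (fun z : E × E ↦ -N y₀ z.2) (y₀, v) := by fun_prop
    by_cases h1 : 0 < G y₀ v v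
    · exact (c1.eventually_const_lt h1).mono fun z hz ↦ Or.inl hz
    by_cases h2 : 0 < N y₀ v
    · exact (c2.eventually_const_lt h2).mono fun z hz ↦ Or.inr (Or.inl hz)
    · exact (c3.eventually_const_lt (hk' v hv (not_lt.1 h1) (not_lt.1 h2))).mono
        fun z hz ↦ Or.inr (Or.inr hz)
  refine ⟨k, hk, key.mono fun y hy v h1 h2 ↦ ?_⟩
  rcases eq_or_ne v 0 with rfl | hv
  · simp
  have hn : 0 < ‖v‖ := norm_pos_iff.2 hv
  have hv1 : ‖v‖⁻¹ • v ∈ Metric.sphere (0 : E) 1 := by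
    simp [norm_smul, hn.ne']
  have hinv : 0 < ‖v‖⁻¹ := inv_pos.2 hn
  rcases hy _ hv1 with h3 | h3 | h3
  · simp only [map_smul, smul_apply, smul_eq_mul] at h3
    nlinarith [mul_pos hinv hinv, mul_nonneg (mul_pos hinv hinv).le (neg_nonneg.2 h1)]
  · simp only [map_smul, smul_eq_mul] at h3
    nlinarith [mul_nonneg hinv.le (neg_nonneg.2 h2)]
  · simp only [map_smul, smul_eq_mul] at h3
    have := mul_lt_mul_of_pos_right h3 hn
    have e1 : -(‖v‖⁻¹ * N y₀ v) * ‖v‖ = -N y₀ v := by field_simp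
    linarith

/-- A linear function that is positive on the velocities of a curve increases along the curve. -/
lemma lt_of_forall_derivWithin_pos {c : ℝ → E} (hc : ContDiffOn ℝ 1 c (Icc 0 1)) (τ : E →L[ℝ] ℝ)
    (h : ∀ t ∈ Icc (0 : ℝ) 1, 0 < τ (derivWithin c (Icc 0 1) t)) : τ (c 0) < τ (c 1) := by
  refine strictMonoOn_of_deriv_pos (f := τ ∘ c) (convex_Icc (0 : ℝ) 1)
    (τ.continuous.comp_continuousOn hc.continuousOn) (fun t ht ↦ ?_) (by simp) (by simp) one_pos
  rw [interior_Icc] at ht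
  have hd : HasDerivAt c (derivWithin c (Icc 0 1) t) t :=
    (((hc t (Ioo_subset_Icc_self ht)).differentiableWithinAt
      one_ne_zero).hasDerivWithinAt).hasDerivAt (Icc_mem_nhds ht.1 ht.2)
  rw [(τ.hasFDerivAt.comp_hasDerivAt t hd).deriv]
  exact h t (Ioo_subset_Icc_self ht)

/-- In the expansion of `A` on `v + β • u`, the mixed term is at most $-\beta k\|v\|$ because `A u`
is close to `B₀`; it absorbs `A v v`, and $\beta^2A(u,u)$ makes the sum negative. If the sum $w$
were not future-directed, the cone condition for $-w$ would give $B_0w\ge k\|w\|$ and hence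
$A(u,w)\ge0$, whereas $A(u,w)=A(u,v)+\beta A(u,u)<0$. -/
lemma timelike_add_smul {A : E →L[ℝ] E →L[ℝ] ℝ} {B B₀ : E →L[ℝ] ℝ} {k β : ℝ} {v : E}
    (hk : 0 < k) (hβ : 0 < β) (hsymm : ∀ v w, A v w = A w v)
    (hcone : ∀ w, A w w ≤ 0 → B w ≤ 0 → k * ‖w‖ ≤ -B₀ w) (hu : ‖A u - B₀‖ ≤ k / 2)
    (huu : A u u < 0) (hv : k * ‖v‖ ≤ -B₀ v) (hvv : A v v ≤ β * (k * ‖v‖)) :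
    A (v + β • u) (v + β • u) < 0 ∧ B (v + β • u) < 0 := by
  have hdiff : ∀ w, |A u w - B₀ w| ≤ k / 2 * ‖w‖ := fun w ↦ by
    have := (A u - B₀).le_opNorm w
    rw [sub_apply, Real.norm_eq_abs] at this
    exact this.trans (by gcongr)
  have hAv : A u v ≤ -(k / 2 * ‖v‖) := by linarith [(abs_le.1 (hdiff v)).2]
  have hww : A (v + β • u) (v + β • u) = A v v + 2 * (β * A u v) + β * (β * A u u) := by
    simp only [map_add, map_smul, add_apply, smul_apply, smul_eq_mul, hsymm v u]
    ring
  have h4 : β * A u u < 0 := mul_neg_of_pos_of_neg hβ huu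
  have hneg : A (v + β • u) (v + β • u) < 0 := by
    rw [hww]
    linarith [mul_le_mul_of_nonneg_left hAv hβ.le, mul_neg_of_pos_of_neg hβ h4]
  refine ⟨hneg, ?_⟩
  by_contra! hcon
  clear hww
  generalize hw : v + β • u = w at *
  have h1 := hcone (-w) (by simpa using hneg.le) (by simpa using hcon)
  rw [norm_neg, map_neg, neg_neg] at h1
  have h2 := (abs_le.1 (hdiff w)).1
  have h3 : A u w = A u v + β * A u u := by
    rw [← hw, map_add, map_smul, smul_eq_mul]
  linarith [mul_nonneg hk.le (norm_nonneg w), mul_nonneg hk.le (norm_nonneg v)]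

/-- Near `y₀`, a causal curve can be deformed to a timelike curve, with the same initial point and
a final point slightly to the future of the old one. -/
lemma exists_timelike_deformation [FiniteDimensional ℝ E] (hΩ : IsOpen Ω) (hy₀ : y₀ ∈ Ω)
    (hG : ContDiffOn ℝ ∞ G Ω) (hN : ContinuousOn N Ω) (hsymm : ∀ y v w, G y v w = G y w v)
    (h : ∀ v, G y₀ v v ≤ 0 → N y₀ v = 0 → v = 0) (hu : N y₀ = G y₀ u) (huu : G y₀ u u < 0) :
    ∃ W ∈ 𝓝 y₀, W ⊆ Ω ∧ ∀ c : ℝ → E, ContDiffOn ℝ 1 c (Icc 0 1) → (∀ t ∈ Icc (0 : ℝ) 1, c t ∈ W ∧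
        G (c t) (derivWithin c (Icc 0 1) t) (derivWithin c (Icc 0 1) t) ≤ 0 ∧
        N (c t) (derivWithin c (Icc 0 1) t) < 0) →
      ∃ a : ℝ, ∀ᶠ ε in 𝓝[>] (0 : ℝ), ∃ d : ℝ → E, ContDiffOn ℝ 1 d (Icc 0 1) ∧ d 0 = c 0 ∧
        d 1 = c 1 + (ε * a) • u ∧ ∀ t ∈ Icc (0 : ℝ) 1, d t ∈ W ∧
          G (d t) (derivWithin d (Icc 0 1) t) (derivWithin d (Icc 0 1) t) < 0 ∧
          N (d t) (derivWithin d (Icc 0 1) t) < 0 := by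
  have hGc : ContinuousAt G y₀ := hG.continuousOn.continuousAt (hΩ.mem_nhds hy₀)
  have hNc : ContinuousAt N y₀ := hN.continuousAt (hΩ.mem_nhds hy₀)
  obtain ⟨k, hk, hcone⟩ := exists_causal_le hGc hNc h
  obtain ⟨C, T, hT, hLip⟩ := ((hG.contDiffAt (hΩ.mem_nhds hy₀)).of_le
    (m := 1) (by simp)).exists_lipschitzOnWith
  have e1 : ∀ᶠ y in 𝓝 y₀, ‖G y u - G y₀ u‖ < k / 2 := by
    have : ContinuousAt (fun y ↦ ‖G y u - G y₀ u‖) y₀ :=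
      ((hGc.clm_apply continuousAt_const).sub continuousAt_const).norm
    exact this.eventually_lt_const (by simpa using hk)
  have e2 : ∀ᶠ y in 𝓝 y₀, G y u u < 0 :=
    ((hGc.clm_apply continuousAt_const).clm_apply continuousAt_const).eventually_lt_const huu
  obtain ⟨r, hr, hball⟩ := Metric.mem_nhds_iff.1
    (inter_mem (inter_mem (inter_mem (inter_mem hcone hT) e1) e2) (hΩ.mem_nhds hy₀))
  refine ⟨Metric.ball y₀ r, Metric.ball_mem_nhds _ hr, fun y hy ↦ (hball hy).2,
    fun c hc hcW ↦ ?_⟩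
  have hcompact : IsCompact (c '' Icc 0 1) := isCompact_Icc.image_of_continuousOn hc.continuousOn
  obtain ⟨δ, hδ, hthick⟩ := hcompact.exists_thickening_subset_open Metric.isOpen_ball
    (image_subset_iff.2 fun t ht ↦ (hcW t ht).1)
  obtain ⟨m, hm⟩ : ∃ m, ∀ t ∈ Icc (0 : ℝ) 1, ‖derivWithin c (Icc 0 1) t‖ ≤ m :=
    isCompact_Icc.exists_bound_of_continuousOn
      (hc.continuousOn_derivWithin (uniqueDiffOn_Icc one_pos) le_rfl)
  have hm0 : 0 ≤ m := (norm_nonneg _).trans (hm 0 (by simp))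
  -- The curve will be displaced by $\varepsilon(e^{lt}-1)u$. The metric then changes by at most `C`
  -- times the displacement; `l` is so large that the derivative $\varepsilon le^{lt}$ dominates
  -- this error for velocities bounded by `m`. The `+ 1` keeps `l` positive.
  set l : ℝ := C * ‖u‖ * m / k + 1 with hl
  have hl1 : 0 < l := by positivity
  have hlk : C * ‖u‖ * m ≤ k * l := by
    rw [hl]; field_simp; linarith
  refine ⟨Real.exp l - 1, ?_⟩
  have hev : ∀ᶠ ε in 𝓝[>] (0 : ℝ), ε * (Real.exp l * ‖u‖) < δ := by
    have : ContinuousAt (fun ε : ℝ ↦ ε * (Real.exp l * ‖u‖)) 0 := by fun_prop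
    exact nhdsWithin_le_nhds (this.eventually_lt_const (by simpa using hδ))
  filter_upwards [hev, self_mem_nhdsWithin] with ε hε hε0
  rw [mem_Ioi] at hε0
  refine ⟨fun t ↦ c t + (ε * (Real.exp (l * t) - 1)) • u, ?_, by simp, by simp, fun t ht ↦ ?_⟩
  · exact hc.add (ContDiff.contDiffOn (by fun_prop))
  have hder : derivWithin (fun t ↦ c t + (ε * (Real.exp (l * t) - 1)) • u) (Icc 0 1) t =
      derivWithin c (Icc 0 1) t + (ε * (Real.exp (l * t) * l)) • u := by
    refine HasDerivWithinAt.derivWithin (HasDerivWithinAt.add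
      ((hc t ht).differentiableWithinAt one_ne_zero).hasDerivWithinAt
      (HasDerivAt.hasDerivWithinAt ?_)) (uniqueDiffOn_Icc one_pos t ht)
    have h1 : HasDerivAt (fun t : ℝ ↦ Real.exp (l * t)) (Real.exp (l * t) * l) t := by
      simpa using ((hasDerivAt_id t).const_mul l).exp
    exact ((h1.sub_const 1).const_mul ε).smul_const u
  rw [hder]
  obtain ⟨hcW1, hcW2, hcW3⟩ := hcW t ht
  set y := c t with hy
  set v := derivWithin c (Icc 0 1) t with hv
  set X := Real.exp (l * t) with hX
  have hX1 : 1 ≤ X := Real.one_le_exp (mul_nonneg hl1.le ht.1)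
  have hXl : X ≤ Real.exp l := Real.exp_le_exp.2 (by nlinarith [ht.2])
  set z := y + (ε * (X - 1)) • u with hz
  have hzy : dist z y = ε * (X - 1) * ‖u‖ := by
    rw [hz, dist_eq_norm, add_sub_cancel_left, norm_smul, Real.norm_of_nonneg]
    exact mul_nonneg hε0.le (by linarith)
  have hzW : z ∈ Metric.ball y₀ r := hthick (Metric.mem_thickening_iff.2
    ⟨y, mem_image_of_mem c ht, by
      rw [hzy]; nlinarith [norm_nonneg u, mul_nonneg hε0.le (norm_nonneg u)]⟩)
  obtain ⟨⟨⟨⟨hy1, hy2⟩, hy3⟩, hy4⟩, -⟩ := hball hcW1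
  obtain ⟨⟨⟨⟨hz1, hz2⟩, hz3⟩, hz4⟩, -⟩ := hball hzW
  simp only [mem_ofPred_eq] at hy1 hz1 hz3 hz4
  have hv1 : k * ‖v‖ ≤ -G y₀ u v := by rw [← hu]; exact hy1 v hcW2 hcW3.le
  have hGv : G z v v ≤ C * (ε * (X - 1) * ‖u‖) * ‖v‖ * ‖v‖ := by
    have h1 := hLip.dist_le_mul _ hz2 _ hy2
    rw [hzy, dist_eq_norm] at h1
    have h2 := (G z - G y).le_opNorm₂ v v
    simp only [sub_apply, Real.norm_eq_abs] at h2
    have h3 : ‖G z - G y‖ * ‖v‖ * ‖v‖ ≤ C * (ε * (X - 1) * ‖u‖) * ‖v‖ * ‖v‖ := by gcongr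
    linarith [le_abs_self (G z v v - G y v v)]
  refine ⟨hzW, timelike_add_smul (B₀ := N y₀) hk (by positivity) (hsymm z) hz1
    (hu ▸ hz3.le) hz4 (hu ▸ hv1) (hGv.trans ?_)⟩
  have h2 : C * ‖u‖ * ‖v‖ ≤ k * l := by
    refine le_trans ?_ hlk
    have := hm t ht
    gcongr
  calc C * (ε * (X - 1) * ‖u‖) * ‖v‖ * ‖v‖ = (C * ‖u‖ * ‖v‖) * (ε * (X - 1) * ‖v‖) := by ring
    _ ≤ (k * l) * (ε * (X - 1) * ‖v‖) := mul_le_mul_of_nonneg_right h2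
        (mul_nonneg (mul_nonneg hε0.le (by linarith)) (norm_nonneg _))
    _ ≤ (k * l) * (ε * X * ‖v‖) := by gcongr; linarith
    _ = ε * (X * l) * (k * ‖v‖) := by ring

end Cones

end Causality

namespace Causality

open Filter

/-! ### Local causality -/

section Local

variable {E : Type*} [NormedAddCommGroup E] [NormedSpace ℝ E]
  {M : Type*} [TopologicalSpace M] [ChartedSpace E M] [IsManifold 𝓘(ℝ, E) ∞ M]

/-- Timelike future-directed vectors. -/
def TimelikeVec (m : ∀ x : M, TangentSpace 𝓘(ℝ, E) x →L[ℝ] TangentSpace 𝓘(ℝ, E) x →L[ℝ] ℝ)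
    (o : ∀ x : M, TangentSpace 𝓘(ℝ, E) x) (x : M) (v : TangentSpace 𝓘(ℝ, E) x) : Prop :=
  m x v v < 0 ∧ m x (o x) v < 0

/-- Causal future-directed vectors. -/
def CausalVec (m : ∀ x : M, TangentSpace 𝓘(ℝ, E) x →L[ℝ] TangentSpace 𝓘(ℝ, E) x →L[ℝ] ℝ)
    (o : ∀ x : M, TangentSpace 𝓘(ℝ, E) x) (x : M) (v : TangentSpace 𝓘(ℝ, E) x) : Prop :=
  m x v v ≤ 0 ∧ m x (o x) v < 0

/-- The properties of a time-oriented Lorentz metric that matter for local causality. -/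
structure IsLorentz
    (m : ∀ x : M, TangentSpace 𝓘(ℝ, E) x →L[ℝ] TangentSpace 𝓘(ℝ, E) x →L[ℝ] ℝ)
    (o : ∀ x : M, TangentSpace 𝓘(ℝ, E) x) : Prop where
  symm (x : M) (v w : TangentSpace 𝓘(ℝ, E) x) : m x v w = m x w v
  contMDiff : ContMDiff 𝓘(ℝ, E) (𝓘(ℝ, E).prod 𝓘(ℝ, E →L[ℝ] E →L[ℝ] ℝ)) ∞
      (fun x ↦ Bundle.TotalSpace.mk' (E →L[ℝ] E →L[ℝ] ℝ) x (m x))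
  continuous_orient : Continuous (fun x ↦ (⟨x, o x⟩ : TangentBundle 𝓘(ℝ, E) M))
  timelike_orient (x : M) : m x (o x) (o x) < 0
  eq_zero (x : M) (v : TangentSpace 𝓘(ℝ, E) x) : m x v v ≤ 0 → m x (o x) v = 0 → v = 0

variable {m : ∀ x : M, TangentSpace 𝓘(ℝ, E) x →L[ℝ] TangentSpace 𝓘(ℝ, E) x →L[ℝ] ℝ}
  {o : ∀ x : M, TangentSpace 𝓘(ℝ, E) x} {e : OpenPartialHomeomorph M E}

omit [IsManifold 𝓘(ℝ, E) ∞ M] in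
lemma timelikeVec_smul {x : M} {v : TangentSpace 𝓘(ℝ, E) x} {r : ℝ} (hr : 0 < r)
    (h : TimelikeVec m o x v) : TimelikeVec m o x (r • v) := by
  obtain ⟨h1, h2⟩ := h
  constructor
  · simp only [map_smul, smul_apply, smul_eq_mul]
    exact mul_neg_of_pos_of_neg hr (mul_neg_of_pos_of_neg hr h1)
  · simp only [map_smul, smul_eq_mul]
    exact mul_neg_of_pos_of_neg hr h2

omit [IsManifold 𝓘(ℝ, E) ∞ M] in
lemma causalVec_smul {x : M} {v : TangentSpace 𝓘(ℝ, E) x} {r : ℝ} (hr : 0 < r)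
    (h : CausalVec m o x v) : CausalVec m o x (r • v) := by
  obtain ⟨h1, h2⟩ := h
  constructor
  · simp only [map_smul, smul_apply, smul_eq_mul]
    exact mul_nonpos_of_nonneg_of_nonpos hr.le (mul_nonpos_of_nonneg_of_nonpos hr.le h1)
  · simp only [map_smul, smul_eq_mul]
    exact mul_neg_of_pos_of_neg hr h2

/-- The vector `u` is the orientation read in the chart, so the form that decides
future-directedness is its metric dual. It serves as the reference timelike direction. -/
lemma exists_coordBilin_eq (h : IsLorentz m o) (he : e ∈ IsManifold.maximalAtlas 𝓘(ℝ, E) ∞ M)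
    {y : E} (hy : y ∈ e.target) :
    ∃ u, coordLin (fun x ↦ m x (o x)) e y = coordBilin m e y u ∧ coordBilin m e y u u < 0 := by
  obtain ⟨u, hu⟩ := (coordVec_bijective he hy).2 (o (e.symm y))
  refine ⟨u, ContinuousLinearMap.ext fun v ↦ ?_, ?_⟩
  · rw [coordLin_apply, coordBilin_apply, hu]
  · rw [coordBilin_apply, hu]
    exact h.timelike_orient _

lemma eq_zero_of_coordLin_eq_zero (h : IsLorentz m o)
    (he : e ∈ IsManifold.maximalAtlas 𝓘(ℝ, E) ∞ M) {y : E} (hy : y ∈ e.target) (v : E)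
    (hv : coordBilin m e y v v ≤ 0) (hv' : coordLin (fun x ↦ m x (o x)) e y v = 0) : v = 0 :=
  (map_eq_zero_iff (coordVec e y) (coordVec_bijective he hy).1).1 (h.eq_zero _ _ hv hv')

omit [IsManifold 𝓘(ℝ, E) ∞ M] in
/-- A straight line in a timelike direction. -/
lemma segment_line (he : e ∈ IsManifold.maximalAtlas 𝓘(ℝ, E) ∞ M)
    {B : Set E} {U : Set M} {x w : E}
    (hB : Convex ℝ B) (hBe : B ⊆ e.target) (hU : MapsTo e.symm B U) (hx : x ∈ B) (hxw : x + w ∈ B)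
    (hw : ∀ y ∈ B, coordBilin m e y w w < 0 ∧ coordLin (fun x ↦ m x (o x)) e y w < 0) :
    Segment (TimelikeVec m o) U (e.symm x) (e.symm (x + w)) := by
  have := segment_of_coord (P := TimelikeVec m o) (U := U)
    (c := fun t ↦ x + t • w) he (ContDiff.contDiffOn (by fun_prop)) fun t ht ↦ by
      have htB : x + t • w ∈ B := hB.add_smul_mem hx hxw ht
      have hd : derivWithin (fun t : ℝ ↦ x + t • w) (Icc 0 1) t = w := by
        have h1 : HasDerivAt (fun t : ℝ ↦ x + t • w) ((1 : ℝ) • w) t :=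
          ((hasDerivAt_id t).smul_const w).const_add x
        rw [h1.hasDerivWithinAt.derivWithin (uniqueDiffOn_Icc one_pos t ht), one_smul]
      rw [hd]
      exact ⟨hBe htB, hU htB, hw _ htB⟩
  simpa using this

omit [IsManifold 𝓘(ℝ, E) ∞ M] in
lemma segment_line_smul (he : e ∈ IsManifold.maximalAtlas 𝓘(ℝ, E) ∞ M)
    {B : Set E} {U : Set M} {x w : E} {s : ℝ} (hs : 0 < s)
    (hB : Convex ℝ B) (hBe : B ⊆ e.target) (hU : MapsTo e.symm B U) (hx : x ∈ B)
    (hxw : x + s • w ∈ B)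
    (hw : ∀ y ∈ B, coordBilin m e y w w < 0 ∧ coordLin (fun x ↦ m x (o x)) e y w < 0) :
    Segment (TimelikeVec m o) U (e.symm x) (e.symm (x + s • w)) := by
  refine segment_line he hB hBe hU hx hxw fun y hy ↦ ?_
  simp only [map_smul, smul_apply, smul_eq_mul]
  exact ⟨mul_neg_of_pos_of_neg hs (mul_neg_of_pos_of_neg hs (hw y hy).1),
    mul_neg_of_pos_of_neg hs (hw y hy).2⟩

omit [NormedSpace ℝ E] [ChartedSpace E M] [IsManifold 𝓘(ℝ, E) ∞ M] in
lemma coord_preimage_mem_nhds {p : M} (hp : p ∈ e.source) {U : Set M} (hU : U ∈ 𝓝 p) :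
    e.target ∩ e.symm ⁻¹' U ∈ 𝓝 (e p) := by
  refine inter_mem (e.open_target.mem_nhds (e.map_source hp))
    ((e.continuousAt_symm (e.map_source hp)).preimage_mem_nhds ?_)
  rwa [e.left_inv hp]

variable [FiniteDimensional ℝ E]

/-- Near `p`, the directions near a timelike vector are timelike. -/
lemma exists_ball_timelike (h : IsLorentz m o)
    (he : e ∈ IsManifold.maximalAtlas 𝓘(ℝ, E) ∞ M) {p : M}
    (hp : p ∈ e.source) {U : Set M} (hU : U ∈ 𝓝 p) {u : E}
    (h1 : coordBilin m e (e p) u u < 0) (h2 : coordLin (fun x ↦ m x (o x)) e (e p) u < 0) :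
    ∃ r > 0, Metric.ball (e p) r ⊆ e.target ∧ MapsTo e.symm (Metric.ball (e p) r) U ∧
      ∀ y ∈ Metric.ball (e p) r, ∀ w ∈ Metric.ball u r,
        coordBilin m e y w w < 0 ∧ coordLin (fun x ↦ m x (o x)) e y w < 0 := by
  have ht := e.open_target.mem_nhds (e.map_source hp)
  have hev := eventually_timelike
    ((contDiffOn_coordBilin h.contMDiff he).continuousOn.continuousAt ht)
    ((continuousOn_coordLin h.contMDiff h.continuous_orient he).continuousAt ht) h1 h2
  obtain ⟨r₁, hr₁, h⟩ := Metric.eventually_nhds_iff_ball.1 hev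
  obtain ⟨r₂, hr₂, h'⟩ := Metric.mem_nhds_iff.1 (coord_preimage_mem_nhds hp hU)
  refine ⟨min r₁ r₂, lt_min hr₁ hr₂,
    fun y hy ↦ (h' (Metric.ball_subset_ball (min_le_right _ _) hy)).1,
    fun y hy ↦ (h' (Metric.ball_subset_ball (min_le_right _ _) hy)).2, fun y hy w hw ↦ ?_⟩
  have hmem : (y, w) ∈ Metric.ball (e p, u) r₁ := by
    rw [← ball_prod_same]
    exact ⟨Metric.ball_subset_ball (min_le_left _ _) hy,
      Metric.ball_subset_ball (min_le_left _ _) hw⟩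
  exact h (y, w) hmem

/-- There are points in the chronological future of `p` near `p`. -/
lemma exists_segment_mem (h : IsLorentz m o) (p : M) {U : Set M} (hU : U ∈ 𝓝 p) :
    ∃ q ∈ U, Segment (TimelikeVec m o) univ p q := by
  have he := IsManifold.chart_mem_maximalAtlas (I := 𝓘(ℝ, E)) (n := ∞) p
  have hp := mem_chart_source E p
  set e := chartAt E p
  obtain ⟨u, hu, huu⟩ := exists_coordBilin_eq h he (e.map_source hp)
  obtain ⟨r, hr, hrt, hrU, hrc⟩ := exists_ball_timelike h he hp hU huu (by rwa [hu])
  obtain ⟨s, hs, hsu⟩ : ∃ s : ℝ, 0 < s ∧ e p + s • u ∈ Metric.ball (e p) r := by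
    have : Tendsto (fun s : ℝ ↦ e p + s • u) (𝓝[>] 0) (𝓝 (e p)) := by
      have : ContinuousAt (fun s : ℝ ↦ e p + s • u) 0 := by fun_prop
      simpa [ContinuousAt] using this.mono_left nhdsWithin_le_nhds
    obtain ⟨s, hs⟩ := ((this.eventually (Metric.ball_mem_nhds _ hr)).and self_mem_nhdsWithin).exists
    exact ⟨s, hs.2, hs.1⟩
  refine ⟨e.symm (e p + s • u), hrU hsu, ?_⟩
  have := segment_line_smul (m := m) (o := o) he hs (convex_ball (e p) r) hrt (mapsTo_univ _ _)
    (Metric.mem_ball_self hr) hsu fun y hy ↦ hrc y hy u (Metric.mem_ball_self hr)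
  rwa [e.left_inv hp] at this

/-- The endpoint of a timelike segment has a neighbourhood that is reached from the initial
point. -/
lemma eventually_transGen_segment (h : IsLorentz m o) {p q : M}
    (hpq : Segment (TimelikeVec m o) univ p q) :
    ∀ᶠ z in 𝓝 q, Relation.TransGen (Segment (TimelikeVec m o) univ) p z := by
  have he := IsManifold.chart_mem_maximalAtlas (I := 𝓘(ℝ, E)) (n := ∞) q
  have hq := mem_chart_source E q
  set e := chartAt E q
  obtain ⟨γ, hγ, rfl, rfl, hγ'⟩ := hpq
  obtain ⟨s, hs0, hs1, hs⟩ : ∃ s : ℝ, 0 < s ∧ s < 1 ∧ MapsTo γ (Icc s 1) e.source := by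
    have h1 : γ ⁻¹' e.source ∈ 𝓝[Icc 0 1] 1 :=
      (hγ.continuousOn 1 (by simp)) (e.open_source.mem_nhds hq)
    obtain ⟨δ, hδ, hsub⟩ := Metric.mem_nhdsWithin_iff.1 h1
    refine ⟨max (1 / 2) (1 - δ / 2), by positivity, max_lt (by norm_num) (by linarith),
      fun t ht ↦ hsub ⟨?_, (by positivity : (0 : ℝ) ≤ _).trans ht.1, ht.2⟩⟩
    rw [Metric.mem_ball, Real.dist_eq, abs_lt]
    have := (le_max_right _ _).trans ht.1
    constructor <;> linarith [ht.2]
  have hsmul := fun (x : M) (v : TangentSpace 𝓘(ℝ, E) x) (r : ℝ) (hr : 0 < r)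
    (h : TimelikeVec m o x v) ↦ timelikeVec_smul hr h
  have hfirst : Segment (TimelikeVec m o) univ (γ 0) (γ s) :=
    segment_of_subinterval hsmul hγ (fun t ht ↦ (hγ' t ht).2) le_rfl hs0 hs1.le (mapsTo_univ _ _)
  obtain ⟨η, hη, hη0, hη1, hη'⟩ := segment_of_subinterval hsmul hγ (fun t ht ↦ (hγ' t ht).2)
    hs0.le hs1 le_rfl hs
  rw [← hη0] at hfirst
  rw [← hη1] at hq ⊢
  obtain ⟨hc, hc'⟩ := contDiffOn_coord_curve hη hη' he subset_rfl
  have h1 : (1 : ℝ) ∈ Icc (0 : ℝ) 1 := by simp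
  set v := derivWithin (e ∘ η) (Icc 0 1) 1 with hv
  obtain ⟨r, hr, hrt, -, hrc⟩ := exists_ball_timelike h he hq univ_mem (hc' 1 h1).2.2.1
    (hc' 1 h1).2.2.2
  -- a chord that is nearly tangent to the curve at its endpoint
  obtain ⟨t, ht0, ht1, htr, htv⟩ : ∃ t : ℝ, 0 < t ∧ t < 1 ∧ e (η t) ∈ Metric.ball (e (η 1)) r ∧
      slope (e ∘ η) 1 t ∈ Metric.ball v r := by
    have hd : HasDerivWithinAt (e ∘ η) v (Ioo 0 1) 1 :=
      (((hc 1 h1).differentiableWithinAt one_ne_zero).hasDerivWithinAt).mono Ioo_subset_Icc_self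
    have hlim := (hasDerivWithinAt_iff_tendsto_slope' (by simp)).1 hd
    have hcont : Tendsto (e ∘ η) (𝓝[Ioo 0 1] 1) (𝓝 (e (η 1))) :=
      ((hc.continuousOn 1 h1).mono Ioo_subset_Icc_self)
    have : (𝓝[Ioo (0 : ℝ) 1] 1).NeBot := by
      rw [nhdsWithin_Ioo_eq_nhdsLT one_pos]
      infer_instance
    obtain ⟨t, ⟨h2, h3⟩, h4⟩ := (((hcont.eventually (Metric.ball_mem_nhds _ hr)).and
      (hlim.eventually (Metric.ball_mem_nhds _ hr))).and self_mem_nhdsWithin).exists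
    exact ⟨t, h4.1, h4.2, h2, h3⟩
  have hmid : Segment (TimelikeVec m o) univ (η 0) (η t) :=
    segment_of_subinterval hsmul hη (fun t ht ↦ (hη' t ht).2) le_rfl ht0 ht1.le (mapsTo_univ _ _)
  have ht : (0 : ℝ) < 1 - t := by linarith
  have hcont : ContinuousAt (fun z ↦ (1 - t)⁻¹ • (e z - e (η t))) (η 1) :=
    ((e.continuousAt hq).sub continuousAt_const).const_smul _
  have hslope : (1 - t)⁻¹ • (e (η 1) - e (η t)) = slope (e ∘ η) 1 t := by
    rw [slope_comm, slope_def_module]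
    rfl
  -- The direction of the chord from `η t` to `z` depends continuously on `z`, so it stays within
  -- `r` of `v` and the chord remains timelike.
  filter_upwards [e.open_source.mem_nhds hq,
    (e.continuousAt hq).preimage_mem_nhds (Metric.ball_mem_nhds _ hr),
    hcont.preimage_mem_nhds (Metric.isOpen_ball.mem_nhds (hslope ▸ htv))] with z hz hzr hzv
  have hz' : e (η t) + (1 - t) • ((1 - t)⁻¹ • (e z - e (η t))) = e z := by
    rw [smul_inv_smul₀ ht.ne', add_sub_cancel]
  have hlast := segment_line_smul (m := m) (o := o) (x := e (η t)) he ht (convex_ball (e (η 1)) r)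
    hrt (mapsTo_univ _ _) htr (hz' ▸ hzr) fun y hy ↦ hrc y hy _ hzv
  rw [hz', e.left_inv hz, e.left_inv (hη' t ⟨ht0.le, ht1.le⟩).1] at hlast
  exact ((Relation.TransGen.single hfirst).tail hmid).tail hlast

/-- A local time function. -/
lemma exists_localTime (h : IsLorentz m o) (p : M) :
    ∃ U : Set M, IsOpen U ∧ p ∈ U ∧ ∃ τ : M → ℝ, ∀ x y,
      Segment (CausalVec m o) U x y → τ x < τ y := by
  have he := IsManifold.chart_mem_maximalAtlas (I := 𝓘(ℝ, E)) (n := ∞) p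
  have hp := mem_chart_source E p
  set e := chartAt E p
  have ht := e.open_target.mem_nhds (e.map_source hp)
  obtain ⟨k, hk, hcone⟩ := exists_causal_le
    ((contDiffOn_coordBilin h.contMDiff he).continuousOn.continuousAt ht)
    ((continuousOn_coordLin h.contMDiff h.continuous_orient he).continuousAt ht)
    (eq_zero_of_coordLin_eq_zero h he (e.map_source hp))
  obtain ⟨W, hW, hWo, hpW⟩ := mem_nhds_iff.1 hcone
  -- The time function is linear in the coordinates: minus the orientation form frozen at `p`, which
  -- is positive on all future causal vectors at nearby points.
  refine ⟨e.source ∩ e ⁻¹' W, e.isOpen_inter_preimage hWo, ⟨hp, hpW⟩,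
    fun x ↦ -coordLin (fun x ↦ m x (o x)) e (e p) (e x), fun x y hxy ↦ ?_⟩
  obtain ⟨c, hc, hc0, hc1, hc'⟩ := hxy.exists_coord he inter_subset_left
  beta_reduce
  rw [← hc0, ← hc1]
  refine lt_of_forall_derivWithin_pos hc (-coordLin (fun x ↦ m x (o x)) e (e p)) fun t ht ↦ ?_
  obtain ⟨h1, h2, h3⟩ := hc' t ht
  have hW' : c t ∈ W := by
    have := h2.2
    rwa [mem_preimage, e.right_inv h1] at this
  have h4 := hW hW' (derivWithin c (Icc 0 1) t) h3.1 h3.2.le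
  have h5 : derivWithin c (Icc 0 1) t ≠ 0 := fun h0 ↦ by
    have := h3.2
    rw [h0, map_zero, map_zero] at this
    exact lt_irrefl _ this
  exact (mul_pos hk (norm_pos_iff.2 h5)).trans_le h4

/-- The endpoint of a short causal segment is a limit of points in the chronological future. -/
lemma exists_nhds_segment_causal (h : IsLorentz m o) (p : M) :
    ∃ U : Set M, IsOpen U ∧ p ∈ U ∧ ∀ x y, Segment (CausalVec m o) U x y →
      ∀ V ∈ 𝓝 y, ∃ z ∈ V, Segment (TimelikeVec m o) univ x z := by
  have he := IsManifold.chart_mem_maximalAtlas (I := 𝓘(ℝ, E)) (n := ∞) p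
  have hp := mem_chart_source E p
  set e := chartAt E p
  obtain ⟨u, hu, huu⟩ := exists_coordBilin_eq h he (e.map_source hp)
  obtain ⟨W, hW, hWt, hdef⟩ := exists_timelike_deformation e.open_target (e.map_source hp)
    (contDiffOn_coordBilin h.contMDiff he)
    (continuousOn_coordLin h.contMDiff h.continuous_orient he)
    (fun y v w ↦ h.symm _ _ _) (eq_zero_of_coordLin_eq_zero h he (e.map_source hp)) hu huu
  refine ⟨e.source ∩ e ⁻¹' interior W, e.isOpen_inter_preimage isOpen_interior,
    ⟨hp, mem_interior_iff_mem_nhds.2 hW⟩, fun x y hxy V hV ↦ ?_⟩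
  have hxs : x ∈ e.source ∧ y ∈ e.source := by
    obtain ⟨γ, -, rfl, rfl, hγ⟩ := hxy
    exact ⟨(hγ 0 (by simp)).1.1, (hγ 1 (by simp)).1.1⟩
  obtain ⟨c, hc, hc0, hc1, hc'⟩ := hxy.exists_coord he inter_subset_left
  obtain ⟨a, ha⟩ := hdef c hc fun t ht ↦ by
    obtain ⟨h1, h2, h3⟩ := hc' t ht
    refine ⟨?_, h3.1, h3.2⟩
    have := h2.2
    rw [mem_preimage, e.right_inv h1] at this
    exact interior_subset this
  have hlim : Tendsto (fun ε : ℝ ↦ c 1 + (ε * a) • u) (𝓝[>] 0) (𝓝 (e y)) := by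
    have : ContinuousAt (fun ε : ℝ ↦ c 1 + (ε * a) • u) 0 := by fun_prop
    simpa [ContinuousAt, hc1] using this.mono_left (nhdsWithin_le_nhds (s := Ioi 0))
  obtain ⟨ε, ⟨d, hd, hd0, hd1, hd'⟩, hε⟩ :=
    (ha.and (hlim.eventually (coord_preimage_mem_nhds hxs.2 hV))).exists
  refine ⟨e.symm (c 1 + (ε * a) • u), hε.2, ?_⟩
  have := segment_of_coord (P := TimelikeVec m o) (U := univ) he hd fun t ht ↦
    ⟨hWt (hd' t ht).1, mem_univ _, (hd' t ht).2⟩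
  rwa [hd0, hd1, hc0, e.left_inv hxs.1] at this

end Local

end Causality

namespace Causality

open Filter

/-- A transitive relation that holds locally on an interval holds on the whole interval. -/
lemma rel_of_locally_rel {F : Set ℝ} (hF : F.OrdConnected) {R : ℝ → ℝ → Prop}
    (htrans : ∀ a b c, R a b → R b c → R a c)
    (hloc : ∀ t ∈ F, ∃ G ∈ 𝓝 t, ∀ s₁ ∈ G ∩ F, ∀ s₂ ∈ G ∩ F, s₁ < s₂ → R s₁ s₂)
    {a b : ℝ} (ha : a ∈ F) (hb : b ∈ F) (hab : a < b) : R a b := by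
  have hsub : Icc a b ⊆ F := hF.out ha hb
  -- The alternative `t = a` makes `S` nonempty, as `R` need not be reflexive. The supremum of `S`
  -- belongs to `S` and cannot be smaller than `b`.
  set S : Set ℝ := {t | t ∈ Icc a b ∧ (t = a ∨ R a t)} with hS
  have haS : a ∈ S := ⟨⟨le_rfl, hab.le⟩, Or.inl rfl⟩
  have hbdd : BddAbove S := ⟨b, fun t ht ↦ ht.1.2⟩
  set s := sSup S with hs
  have has : a ≤ s := le_csSup hbdd haS
  have hsb : s ≤ b := csSup_le ⟨a, haS⟩ fun t ht ↦ ht.1.2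
  obtain ⟨G, hG, hR⟩ := hloc s (hsub ⟨has, hsb⟩)
  obtain ⟨δ, hδ, hball⟩ := Metric.mem_nhds_iff.1 hG
  have hmem : ∀ t, s - δ < t → t < s + δ → t ∈ G := fun t h1 h2 ↦ hball (by
    rw [Metric.mem_ball, Real.dist_eq, abs_lt]
    constructor <;> linarith)
  have hstep : ∀ t t', t ∈ S → s - δ < t → t < t' → t' < s + δ → t' ≤ b → t' ∈ S := by
    intro t t' ht h1 h2 h3 h4
    have ht' : t' ∈ Icc a b := ⟨ht.1.1.trans h2.le, h4⟩
    have := hR t ⟨hmem t h1 (h2.trans h3), hsub ht.1⟩ t' ⟨hmem t' (h1.trans h2) h3, hsub ht'⟩ h2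
    refine ⟨ht', Or.inr ?_⟩
    rcases ht.2 with rfl | h
    · exact this
    · exact htrans _ _ _ h this
  obtain ⟨t, ht, hts⟩ := exists_lt_of_lt_csSup ⟨a, haS⟩ (show s - δ < sSup S by linarith)
  have hsS : s ∈ S := by
    rcases (le_csSup hbdd ht).lt_or_eq with h | h
    · exact hstep t s ht hts h (by linarith) hsb
    · rw [hs, ← h]; exact ht
  have hsb' : s = b := by
    by_contra hne
    have hlt : s < b := lt_of_le_of_ne hsb hne
    have h1 : s < min b (s + δ / 2) := lt_min hlt (by linarith)
    have := hstep s (min b (s + δ / 2)) hsS (by linarith) h1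
      ((min_le_right _ _).trans_lt (by linarith)) (min_le_left _ _)
    exact absurd (le_csSup hbdd this) (not_le.2 h1)
  rw [hsb'] at hsS
  exact hsS.2.resolve_left hab.ne'

variable {n : ℕ} {M : Type*} [TopologicalSpace M]
  [ChartedSpace (EuclideanSpace ℝ (Fin (n + 1))) M] [IsManifold (𝓡 (n + 1)) ∞ M]

namespace Spacetime

variable {g : Spacetime n M}

-- `FutureTimelike` and `FutureCausal` unfold to `TimelikeVec` and `CausalVec` for this metric and
-- orientation, so the local results on segments apply to `g` as they stand.
variable (g) in
lemma isLorentz : IsLorentz (E := EuclideanSpace ℝ (Fin (n + 1))) g.metric g.orient where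
  symm := g.symm
  contMDiff := g.contMDiff_metric
  continuous_orient := g.continuous_orient
  timelike_orient := g.timelike_orient
  eq_zero x _ h h' := g.eq_zero_of_metric_eq_zero (g.timelike_orient x) h h'

/-! ### Time reversal -/

variable (g) in
/-- The spacetime with the opposite time orientation. -/
def reverse : Spacetime n M where
  metric := g.metric
  symm := g.symm
  signature := g.signature
  contMDiff_metric := g.contMDiff_metric
  orient x := -g.orient x
  continuous_orient := by
    have h : ContMDiff (𝓡 (n + 1)) (𝓡 (n + 1)).tangent 0
        (fun x ↦ (⟨x, g.orient x⟩ : TangentBundle (𝓡 (n + 1)) M)) :=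
      contMDiff_zero_iff.2 g.continuous_orient
    exact (ContMDiff.neg_section h).continuous
  timelike_orient x := by simpa using g.timelike_orient x

lemma futureTimelike_reverse {x : M} {v : TangentSpace (𝓡 (n + 1)) x} :
    g.reverse.FutureTimelike x v ↔ g.FutureTimelike x (-v) := by
  simp [FutureTimelike, reverse]

lemma futureCausal_reverse {x : M} {v : TangentSpace (𝓡 (n + 1)) x} :
    g.reverse.FutureCausal x v ↔ g.FutureCausal x (-v) := by
  simp [FutureCausal, reverse]

lemma reverse_reverse : g.reverse.reverse = g := by
  simp [reverse]

lemma TimelikeSegment.reverse {U : Set M} {p q : M} (h : g.TimelikeSegment U p q) :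
    g.reverse.TimelikeSegment U q p :=
  Segment.mono (Segment.reverse (P := fun x v ↦ g.FutureTimelike x v) h)
    (fun _ _ h ↦ futureTimelike_reverse.2 h) subset_rfl

lemma CausalSegment.reverse {U : Set M} {p q : M} (h : g.CausalSegment U p q) :
    g.reverse.CausalSegment U q p :=
  Segment.mono (Segment.reverse (P := fun x v ↦ g.FutureCausal x v) h)
    (fun _ _ h ↦ futureCausal_reverse.2 h) subset_rfl

lemma timelikeSegment_reverse {U : Set M} :
    g.reverse.TimelikeSegment U = Function.swap (g.TimelikeSegment U) := by
  ext p q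
  exact ⟨fun h ↦ by simpa [reverse_reverse] using h.reverse, fun h ↦ TimelikeSegment.reverse h⟩

lemma causalSegment_reverse {U : Set M} :
    g.reverse.CausalSegment U = Function.swap (g.CausalSegment U) := by
  ext p q
  exact ⟨fun h ↦ by simpa [reverse_reverse] using h.reverse, fun h ↦ CausalSegment.reverse h⟩

@[simp] lemma chronFuture_reverse (L U : Set M) : g.reverse.chronFuture L U = g.chronPast L U := by
  simp [chronFuture, chronPast, timelikeSegment_reverse, Relation.transGen_swap]

@[simp] lemma chronPast_reverse (L U : Set M) : g.reverse.chronPast L U = g.chronFuture L U := by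
  simp [chronFuture, chronPast, timelikeSegment_reverse, Relation.transGen_swap]

@[simp] lemma causalFuture_reverse (L U : Set M) :
    g.reverse.causalFuture L U = g.causalPast L U := by
  simp [causalFuture, causalPast, causalSegment_reverse, Relation.transGen_swap]

@[simp] lemma causalPast_reverse (L U : Set M) :
    g.reverse.causalPast L U = g.causalFuture L U := by
  simp [causalFuture, causalPast, causalSegment_reverse, Relation.transGen_swap]

/-! ### Elementary properties of the causal relations -/

lemma mem_chronFuture {p q : M} {U : Set M} :
    q ∈ g.chronFuture {p} U ↔ Relation.TransGen (g.TimelikeSegment U) p q := by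
  simp [chronFuture]

lemma mem_chronPast {p q : M} {U : Set M} : p ∈ g.chronPast {q} U ↔ q ∈ g.chronFuture {p} U := by
  simp [chronFuture, chronPast]

lemma mem_causalFuture {p q : M} {U : Set M} :
    q ∈ g.causalFuture {p} U ↔ (q = p ∧ p ∈ U) ∨ Relation.TransGen (g.CausalSegment U) p q := by
  simp only [causalFuture, mem_union, mem_inter_iff, mem_singleton_iff, mem_ofPred_eq,
    exists_eq_left]
  exact or_congr ⟨fun h ↦ ⟨h.1, h.1 ▸ h.2⟩, fun h ↦ ⟨h.1, h.1 ▸ h.2⟩⟩ Iff.rfl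

lemma mem_causalPast {p q : M} {U : Set M} :
    p ∈ g.causalPast {q} U ↔ q ∈ g.causalFuture {p} U := by
  rw [mem_causalFuture]
  simp only [causalPast, mem_union, mem_inter_iff, mem_singleton_iff, mem_ofPred_eq,
    exists_eq_left]
  exact or_congr ⟨fun h ↦ ⟨h.1.symm, h.2⟩, fun h ↦ ⟨h.1.symm, h.2⟩⟩ Iff.rfl

lemma transGen_of_mem_causalFuture {p q : M} {U : Set M} (h : q ∈ g.causalFuture {p} U)
    (hne : p ≠ q) : Relation.TransGen (g.CausalSegment U) p q :=
  (mem_causalFuture.1 h).resolve_left fun h ↦ hne h.1.symm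

lemma causalFuture_of_transGen {p q : M} {U : Set M}
    (h : Relation.TransGen (g.CausalSegment U) p q) : q ∈ g.causalFuture {p} U :=
  mem_causalFuture.2 (Or.inr h)

lemma causalFuture_refl (p : M) : p ∈ g.causalFuture {p} univ :=
  mem_causalFuture.2 (Or.inl ⟨rfl, mem_univ _⟩)

lemma causalFuture_trans {p q r : M} {U : Set M} (h : q ∈ g.causalFuture {p} U)
    (h' : r ∈ g.causalFuture {q} U) : r ∈ g.causalFuture {p} U := by
  rw [mem_causalFuture] at *
  rcases h with ⟨rfl, h⟩ | h
  · exact h'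
  rcases h' with ⟨rfl, h'⟩ | h'
  · exact Or.inr h
  · exact Or.inr (h.trans h')

lemma chronFuture_trans {p q r : M} {U : Set M} (h : q ∈ g.chronFuture {p} U)
    (h' : r ∈ g.chronFuture {q} U) : r ∈ g.chronFuture {p} U := by
  rw [mem_chronFuture] at *
  exact h.trans h'

lemma TimelikeSegment.causal {p q : M} {U : Set M} (h : g.TimelikeSegment U p q) :
    g.CausalSegment U p q :=
  Segment.mono (P := fun x v ↦ g.FutureTimelike x v) (Q := fun x v ↦ g.FutureCausal x v) h
    (fun _ _ h ↦ ⟨h.1.le, h.2⟩) subset_rfl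

lemma CausalSegment.mono {p q : M} {U V : Set M} (h : g.CausalSegment U p q) (hUV : U ⊆ V) :
    g.CausalSegment V p q :=
  Segment.mono (P := fun x v ↦ g.FutureCausal x v) (Q := fun x v ↦ g.FutureCausal x v) h
    (fun _ _ h ↦ h) hUV

lemma transGen_causalSegment_mono {p q : M} {U V : Set M} (hUV : U ⊆ V)
    (h : Relation.TransGen (g.CausalSegment U) p q) :
    Relation.TransGen (g.CausalSegment V) p q :=
  Relation.TransGen.mono (fun _ _ (h : g.CausalSegment U _ _) ↦ h.mono hUV) _ _ h

lemma causalFuture_of_chronFuture {p q : M} (h : q ∈ g.chronFuture {p} univ) :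
    q ∈ g.causalFuture {p} univ :=
  causalFuture_of_transGen (Relation.TransGen.mono
    (fun _ _ (h : g.TimelikeSegment univ _ _) ↦ h.causal) _ _ (mem_chronFuture.1 h))

lemma exists_mem_chronFuture (p : M) {U : Set M} (hU : U ∈ 𝓝 p) :
    ∃ q ∈ U, q ∈ g.chronFuture {p} univ := by
  obtain ⟨q, hq, h⟩ := exists_segment_mem g.isLorentz p hU
  exact ⟨q, hq, mem_chronFuture.2 (.single h)⟩

lemma exists_mem_chronPast (p : M) {U : Set M} (hU : U ∈ 𝓝 p) :
    ∃ q ∈ U, q ∈ g.chronPast {p} univ := by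
  simpa using exists_mem_chronFuture (g := g.reverse) p hU

lemma isOpen_chronFuture (p : M) : IsOpen (g.chronFuture {p} univ) := by
  refine isOpen_iff_mem_nhds.2 fun q hq ↦ ?_
  rw [mem_chronFuture] at hq
  obtain ⟨r, hr, hrq⟩ := (Relation.TransGen.tail'_iff).1 hq
  filter_upwards [eventually_transGen_segment g.isLorentz hrq] with z hz
  exact mem_chronFuture.2 (Relation.TransGen.trans_right hr hz)

lemma isOpen_chronPast (p : M) : IsOpen (g.chronPast {p} univ) := by
  simpa using isOpen_chronFuture (g := g.reverse) p

lemma segment_of_causalSegment_subinterval {γ : ℝ → M}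
    (hγ : ContMDiffOn 𝓘(ℝ, ℝ) (𝓡 (n + 1)) 1 γ (Icc 0 1)) (h : ∀ t ∈ Icc (0 : ℝ) 1,
      g.FutureCausal (γ t) (mfderivWithin 𝓘(ℝ, ℝ) (𝓡 (n + 1)) γ (Icc 0 1) t (1 : ℝ)))
    {a b : ℝ} {U : Set M} (ha : 0 ≤ a) (hab : a < b) (hb : b ≤ 1) (hU : MapsTo γ (Icc a b) U) :
    g.CausalSegment U (γ a) (γ b) :=
  segment_of_subinterval (P := fun x v ↦ g.FutureCausal x v)
    (fun _ _ _ hr h ↦ causalVec_smul hr h) hγ h ha hab hb hU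

/-- A continuous curve on `[0, 1]` stays near each of its points for a while. -/
lemma exists_nhds_mapsTo_Icc {γ : ℝ → M} {F : Set ℝ} (hF : F.OrdConnected)
    (hγ : ContinuousOn γ F) {t : ℝ} (ht : t ∈ F) {U : Set M} (hU : U ∈ 𝓝 (γ t)) :
    ∃ G ∈ 𝓝 t, ∀ s₁ ∈ G ∩ F, ∀ s₂ ∈ G ∩ F, MapsTo γ (Icc s₁ s₂) U := by
  obtain ⟨δ, hδ, h⟩ := Metric.mem_nhdsWithin_iff.1 (hγ t ht hU)
  refine ⟨Metric.ball t δ, Metric.ball_mem_nhds _ hδ, fun s₁ h1 s₂ h2 s hs ↦ h ⟨?_, ?_⟩⟩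
  · rw [Real.ball_eq_Ioo] at *
    exact ⟨h1.1.1.trans_le hs.1, hs.2.trans_lt h2.1.2⟩
  · exact hF.out h1.2 h2.2 hs

/-- On a short piece of the curve, the endpoint is a limit of points in the chronological future of
the initial point. One of these lies in the open set $I^-(r)$, so membership in $I^-(r)$ passes back
along the piece, and by `rel_of_locally_rel` along the whole curve. -/
lemma chronFuture_of_causalSegment {p q r : M} (h : g.CausalSegment univ p q)
    (h' : r ∈ g.chronFuture {q} univ) : r ∈ g.chronFuture {p} univ := by
  obtain ⟨γ, hγ, rfl, rfl, hγ'⟩ := h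
  refine rel_of_locally_rel (F := Icc (0 : ℝ) 1)
    (R := fun s t ↦ r ∈ g.chronFuture {γ t} univ → r ∈ g.chronFuture {γ s} univ) ordConnected_Icc
    (fun a b c h1 h2 h3 ↦ h1 (h2 h3)) (fun t ht ↦ ?_) (by simp) (by simp) one_pos h'
  obtain ⟨U, hUo, hU, h⟩ := exists_nhds_segment_causal g.isLorentz (γ t)
  obtain ⟨G, hG, hGU⟩ := exists_nhds_mapsTo_Icc ordConnected_Icc hγ.continuousOn ht
    (hUo.mem_nhds hU)
  refine ⟨G, hG, fun s₁ h1 s₂ h2 h12 hr ↦ ?_⟩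
  have hseg := segment_of_causalSegment_subinterval hγ (fun t ht ↦ (hγ' t ht).2) h1.2.1 h12 h2.2.2
    (hGU _ h1 _ h2)
  obtain ⟨z, hz, hz'⟩ := h _ _ hseg _ ((isOpen_chronPast r).mem_nhds (mem_chronPast.2 hr))
  exact chronFuture_trans (mem_chronFuture.2 (.single hz')) (mem_chronPast.1 hz)

lemma chronFuture_of_causalFuture_of_chronFuture {p q r : M} (h : q ∈ g.causalFuture {p} univ)
    (h' : r ∈ g.chronFuture {q} univ) : r ∈ g.chronFuture {p} univ := by
  rcases mem_causalFuture.1 h with ⟨rfl, -⟩ | hc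
  · exact h'
  clear h
  induction hc using Relation.TransGen.head_induction_on with
  | single h => exact chronFuture_of_causalSegment h h'
  | head h _ ih => exact chronFuture_of_causalSegment h ih

lemma chronFuture_of_chronFuture_of_causalFuture {p q r : M} (h : q ∈ g.chronFuture {p} univ)
    (h' : r ∈ g.causalFuture {q} univ) : r ∈ g.chronFuture {p} univ := by
  have := chronFuture_of_causalFuture_of_chronFuture (g := g.reverse) (p := r) (q := q) (r := p)
  simp only [causalFuture_reverse, chronFuture_reverse, mem_causalPast, mem_chronPast] at this
  exact this h' h

end Spacetime

end Causality

namespace Causality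

open Filter

variable {n : ℕ} {M : Type*} [TopologicalSpace M]
  [ChartedSpace (EuclideanSpace ℝ (Fin (n + 1))) M] [IsManifold (𝓡 (n + 1)) ∞ M]

namespace Spacetime

variable {g : Spacetime n M}

/-! ### Causal curves -/

lemma nontrivial_Icc_of_lt {a b : ℝ} (h : a < b) : (Icc a b).Nontrivial :=
  ⟨a, left_mem_Icc.2 h.le, b, right_mem_Icc.2 h.le, h.ne⟩

/-- This excludes closed causal chains in `U`, and so supplies the condition `γ s₁ ≠ γ s₂` wherever
a curve is shown to be causal without strong causality. -/
lemma exists_localTime_transGen (p : M) :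
    ∃ U : Set M, IsOpen U ∧ p ∈ U ∧ ∃ τ : M → ℝ, ∀ x y,
      Relation.TransGen (g.CausalSegment U) x y → τ x < τ y := by
  obtain ⟨U, hU, hp, τ, h⟩ := exists_localTime g.isLorentz p
  refine ⟨U, hU, hp, τ, fun x y hxy ↦ ?_⟩
  induction hxy with
  | single h' => exact h _ _ h'
  | tail _ h' ih => exact ih.trans (h _ _ h')

lemma IsCausalCurve.congr {F : Set ℝ} {γ γ' : ℝ → M} (h : g.IsCausalCurve F γ)
    (hγ : EqOn γ' γ F) : g.IsCausalCurve F γ' := by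
  obtain ⟨h1, h2, h3, h4⟩ := h
  refine ⟨h1, h2, h3.congr hγ, fun t ht U hU htU ↦ ?_⟩
  obtain ⟨G, hG, h⟩ := h4 t ht U hU (hγ ht ▸ htU)
  refine ⟨G, hG, fun s₁ hs1 s₂ hs2 h12 ↦ ?_⟩
  rw [hγ hs1.2, hγ hs2.2]
  exact h s₁ hs1 s₂ hs2 h12

lemma IsCausalCurve.comp {F : Set ℝ} {γ : ℝ → M} (h : g.IsCausalCurve F γ) {f : ℝ → ℝ}
    (hf : Continuous f) (hmono : StrictMono f) (hne : (f ⁻¹' F).Nontrivial) :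
    g.IsCausalCurve (f ⁻¹' F) (γ ∘ f) := by
  obtain ⟨h1, h2, h3, h4⟩ := h
  refine ⟨h1.preimage_mono hmono.monotone, hne, h3.comp hf.continuousOn (mapsTo_preimage f F),
    fun t ht U hU htU ↦ ?_⟩
  obtain ⟨G, hG, h⟩ := h4 (f t) ht U hU htU
  exact ⟨f ⁻¹' G, hf.continuousAt.preimage_mem_nhds hG, fun s₁ hs1 s₂ hs2 h12 ↦
    h _ ⟨hs1.1, hs1.2⟩ _ ⟨hs2.1, hs2.2⟩ (hmono h12)⟩

/-- Time reversal of causal curves. -/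
lemma IsCausalCurve.reverse {F : Set ℝ} {γ : ℝ → M} (h : g.IsCausalCurve F γ) :
    g.reverse.IsCausalCurve (Neg.neg ⁻¹' F) (fun t ↦ γ (-t)) := by
  obtain ⟨h1, h2, h3, h4⟩ := h
  refine ⟨h1.preimage_anti fun _ _ h ↦ neg_le_neg h,
    h2.preimage neg_surjective, h3.comp continuousOn_neg (mapsTo_preimage _ F),
    fun t ht U hU htU ↦ ?_⟩
  obtain ⟨G, hG, h⟩ := h4 (-t) ht U hU htU
  refine ⟨Neg.neg ⁻¹' G, continuousAt_neg.preimage_mem_nhds hG, fun s₁ hs1 s₂ hs2 h12 ↦ ?_⟩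
  have := h (-s₂) ⟨hs2.1, hs2.2⟩ (-s₁) ⟨hs1.1, hs1.2⟩ (neg_lt_neg h12)
  rw [causalFuture_reverse, mem_causalPast]
  exact ⟨this.1.symm, this.2⟩

/-- Two causal curves can be joined. -/
lemma IsCausalCurve.union {a b c : ℝ} (hab : a < b) (hbc : b < c) {γ : ℝ → M}
    (h : g.IsCausalCurve (Icc a b) γ) (h' : g.IsCausalCurve (Icc b c) γ) :
    g.IsCausalCurve (Icc a c) γ := by
  obtain ⟨h1, h2, h3, h4⟩ := h
  obtain ⟨h1', h2', h3', h4'⟩ := h'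
  have hu : Icc a b ∪ Icc b c = Icc a c := Icc_union_Icc_eq_Icc hab.le hbc.le
  refine ⟨ordConnected_Icc, nontrivial_Icc_of_lt (hab.trans hbc),
    hu ▸ h3.union_of_isClosed h3' isClosed_Icc isClosed_Icc, fun t ht U hU htU ↦ ?_⟩
  rcases lt_trichotomy t b with htb | rfl | htb
  · obtain ⟨G, hG, h⟩ := h4 t ⟨ht.1, htb.le⟩ U hU htU
    exact ⟨G ∩ Iio b, inter_mem hG (Iio_mem_nhds htb), fun s₁ hs1 s₂ hs2 h12 ↦
      h s₁ ⟨hs1.1.1, hs1.2.1, hs1.1.2.le⟩ s₂ ⟨hs2.1.1, hs2.2.1, hs2.1.2.le⟩ h12⟩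
  -- At the junction, points before and after `t` are related through `γ t`; the local time function
  -- shows that they are distinct.
  · obtain ⟨V, hV, htV, τ, hτ⟩ := exists_localTime_transGen (g := g) (γ t)
    obtain ⟨G, hG, h⟩ := h4 t ⟨ht.1, le_rfl⟩ (U ∩ V) (hU.inter hV) ⟨htU, htV⟩
    obtain ⟨G', hG', h'⟩ := h4' t ⟨le_rfl, ht.2⟩ (U ∩ V) (hU.inter hV) ⟨htU, htV⟩
    have key : ∀ s₁ ∈ G ∩ G' ∩ Icc a c, ∀ s₂ ∈ G ∩ G' ∩ Icc a c, s₁ < s₂ →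
        Relation.TransGen (g.CausalSegment (U ∩ V)) (γ s₁) (γ s₂) := by
      intro s₁ hs1 s₂ hs2 h12
      rcases le_or_gt s₂ t with h2t | h2t
      · have := h s₁ ⟨hs1.1.1, hs1.2.1, h12.le.trans h2t⟩ s₂ ⟨hs2.1.1, hs2.2.1, h2t⟩ h12
        exact transGen_of_mem_causalFuture this.2 this.1
      rcases le_or_gt t s₁ with h1t | h1t
      · have := h' s₁ ⟨hs1.1.2, h1t, hs1.2.2⟩ s₂ ⟨hs2.1.2, h2t.le, hs2.2.2⟩ h12
        exact transGen_of_mem_causalFuture this.2 this.1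
      · have ha := h s₁ ⟨hs1.1.1, hs1.2.1, h1t.le⟩ t ⟨mem_of_mem_nhds hG, hab.le, le_rfl⟩ h1t
        have hb := h' t ⟨mem_of_mem_nhds hG', le_rfl, hbc.le⟩ s₂ ⟨hs2.1.2, h2t.le, hs2.2.2⟩ h2t
        exact (transGen_of_mem_causalFuture ha.2 ha.1).trans
          (transGen_of_mem_causalFuture hb.2 hb.1)
    refine ⟨G ∩ G', inter_mem hG hG', fun s₁ hs1 s₂ hs2 h12 ↦ ?_⟩
    have := key s₁ hs1 s₂ hs2 h12
    exact ⟨fun he ↦ (hτ _ _ (transGen_causalSegment_mono inter_subset_right this)).ne (by rw [he]),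
      causalFuture_of_transGen (transGen_causalSegment_mono inter_subset_left this)⟩
  · obtain ⟨G, hG, h⟩ := h4' t ⟨htb.le, ht.2⟩ U hU htU
    exact ⟨G ∩ Ioi b, inter_mem hG (Ioi_mem_nhds htb), fun s₁ hs1 s₂ hs2 h12 ↦
      h s₁ ⟨hs1.1.1, hs1.1.2.le, hs1.2.2⟩ s₂ ⟨hs2.1.1, hs2.1.2.le, hs2.2.2⟩ h12⟩

lemma IsCausalCurve.exists_append {b c : ℝ} (hb : 0 < b) (hc : 0 < c) {γ η : ℝ → M}
    (hγ : g.IsCausalCurve (Icc 0 b) γ) (hη : g.IsCausalCurve (Icc 0 c) η) (h : γ b = η 0) :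
    ∃ ζ : ℝ → M, g.IsCausalCurve (Icc 0 (b + c)) ζ ∧ ζ 0 = γ 0 ∧ ζ b = γ b ∧
      ζ (b + c) = η c := by
  have hpre : (fun t ↦ t - b) ⁻¹' Icc 0 c = Icc b (b + c) := by
    ext t
    simp only [mem_preimage, mem_Icc]
    constructor <;> rintro ⟨h1, h2⟩ <;> constructor <;> linarith
  have hη' := hη.comp (f := fun t ↦ t - b) (by fun_prop)
    (fun s t h ↦ sub_lt_sub_right h b) (by
      rw [hpre]; exact nontrivial_Icc_of_lt (by linarith))
  rw [hpre] at hη'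
  refine ⟨fun t ↦ if t ≤ b then γ t else η (t - b),
    IsCausalCurve.union hb (by linarith) (hγ.congr fun t ht ↦ by simp [ht.2])
      (hη'.congr fun t ht ↦ ?_), by simp [hb.le], by simp, by simp [hc]⟩
  rcases ht.1.eq_or_lt with rfl | hlt
  · simp [h]
  · simp [not_le.2 hlt]

lemma CausalSegment.exists_isCausalCurve {p q : M} {U : Set M} (h : g.CausalSegment U p q) :
    ∃ γ : ℝ → M, g.IsCausalCurve (Icc 0 1) γ ∧ γ 0 = p ∧ γ 1 = q := by
  obtain ⟨γ, hγ, rfl, rfl, hγ'⟩ := h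
  refine ⟨γ, ⟨ordConnected_Icc, nontrivial_Icc_of_lt one_pos, hγ.continuousOn,
    fun t ht U hU htU ↦ ?_⟩, rfl, rfl⟩
  obtain ⟨V, hV, htV, τ, hτ⟩ := exists_localTime_transGen (g := g) (γ t)
  obtain ⟨G, hG, hGU⟩ := exists_nhds_mapsTo_Icc ordConnected_Icc hγ.continuousOn ht
    ((hU.inter hV).mem_nhds ⟨htU, htV⟩)
  refine ⟨G, hG, fun s₁ h1 s₂ h2 h12 ↦ ?_⟩
  have hseg := segment_of_causalSegment_subinterval hγ (fun t ht ↦ (hγ' t ht).2) h1.2.1 h12 h2.2.2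
    (hGU _ h1 _ h2)
  exact ⟨fun he ↦ (hτ _ _ (.single (hseg.mono inter_subset_right))).ne (by rw [he]),
    causalFuture_of_transGen (.single (hseg.mono inter_subset_left))⟩

/-- Points that are causally related are joined by a causal curve. -/
lemma exists_isCausalCurve {p q : M} {U : Set M}
    (h : Relation.TransGen (g.CausalSegment U) p q) :
    ∃ b > 0, ∃ γ : ℝ → M, g.IsCausalCurve (Icc 0 b) γ ∧ γ 0 = p ∧ γ b = q := by
  induction h with
  | single h => exact ⟨1, one_pos, h.exists_isCausalCurve⟩
  | @tail q r _ h ih =>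
    obtain ⟨b, hb, γ, hγ, h0, h1⟩ := ih
    obtain ⟨η, hη, h0', h1'⟩ := h.exists_isCausalCurve
    obtain ⟨ζ, hζ, e0, -, e1⟩ := hγ.exists_append hb one_pos hη (h1.trans h0'.symm)
    exact ⟨b + 1, by linarith, ζ, hζ, e0.trans h0, e1.trans h1'⟩

/-- The points of a causal curve in an open set are causally related in that set. -/
lemma IsCausalCurve.transGen {F : Set ℝ} {γ : ℝ → M} (h : g.IsCausalCurve F γ) {U : Set M}
    (hU : IsOpen U) {a b : ℝ} (ha : a ∈ F) (hb : b ∈ F) (hab : a < b)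
    (hγ : MapsTo γ (Icc a b) U) : Relation.TransGen (g.CausalSegment U) (γ a) (γ b) := by
  obtain ⟨h1, h2, h3, h4⟩ := h
  refine rel_of_locally_rel (F := Icc a b)
    (R := fun s t ↦ Relation.TransGen (g.CausalSegment U) (γ s) (γ t)) ordConnected_Icc
    (fun _ _ _ h h' ↦ h.trans h') (fun t ht ↦ ?_) ⟨le_rfl, hab.le⟩ ⟨hab.le, le_rfl⟩ hab
  have hsub : Icc a b ⊆ F := h1.out ha hb
  obtain ⟨G, hG, h⟩ := h4 t (hsub ht) U hU (hγ ht)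
  refine ⟨G, hG, fun s₁ hs1 s₂ hs2 h12 ↦ ?_⟩
  have := h s₁ ⟨hs1.1, hsub hs1.2⟩ s₂ ⟨hs2.1, hsub hs2.2⟩ h12
  exact transGen_of_mem_causalFuture this.2 this.1

lemma IsCausalCurve.mem_causalFuture {F : Set ℝ} {γ : ℝ → M} (h : g.IsCausalCurve F γ)
    {a b : ℝ} (ha : a ∈ F) (hb : b ∈ F) (hab : a ≤ b) : γ b ∈ g.causalFuture {γ a} univ := by
  rcases hab.eq_or_lt with rfl | hab
  · exact causalFuture_refl _
  · exact causalFuture_of_transGen (h.transGen isOpen_univ ha hb hab (mapsTo_univ _ _))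

/-! ### Strong causality -/

lemma stronglyCausalAt_reverse {p : M} (h : g.StronglyCausalAt p) :
    g.reverse.StronglyCausalAt p := by
  intro U hU
  obtain ⟨V, hV, hVU, h⟩ := h U hU
  refine ⟨V, hV, hVU, fun F γ hγ ↦ ?_⟩
  have h1 := hγ.reverse
  rw [reverse_reverse] at h1
  have h2 := (h _ _ h1).preimage_anti (f := fun t : ℝ ↦ -t) fun _ _ h ↦ neg_le_neg h
  convert! h2 using 1
  ext t
  simp

lemma IsGloballyHyperbolic.reverse (h : g.IsGloballyHyperbolic) :
    g.reverse.IsGloballyHyperbolic := by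
  refine ⟨fun p ↦ stronglyCausalAt_reverse (h.1 p), fun p q ↦ ?_⟩
  rw [causalFuture_reverse, causalPast_reverse, inter_comm]
  exact h.2 q p

/-- Otherwise a causal curve from `p` through `q` back to `p` would begin and end in a neighbourhood
of `p` that omits `q`, against strong causality. -/
lemma StronglyCausalAt.eq_of_mem_causalFuture [T2Space M] {p q : M} (h : g.StronglyCausalAt p)
    (h1 : q ∈ g.causalFuture {p} univ) (h2 : p ∈ g.causalFuture {q} univ) : p = q := by
  by_contra hne
  obtain ⟨V, hV, hVU, h⟩ := h {q}ᶜ (isOpen_compl_singleton.mem_nhds hne)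
  obtain ⟨b, hb, γ, hγ, h0, hγb⟩ := exists_isCausalCurve (transGen_of_mem_causalFuture h1 hne)
  obtain ⟨c, hc, η, hη, h0', hηc⟩ :=
    exists_isCausalCurve (transGen_of_mem_causalFuture h2 (Ne.symm hne))
  obtain ⟨ζ, hζ, e0, eb, e1⟩ := hγ.exists_append hb hc hη (hγb.trans h0'.symm)
  have hpV := mem_of_mem_nhds hV
  have := (h _ _ hζ).out (x := 0) ⟨⟨le_rfl, by linarith⟩, by rwa [e0, h0]⟩ (y := b + c)
    ⟨⟨by linarith, le_rfl⟩, by rwa [e1, hηc]⟩ ⟨hb.le, by linarith⟩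
  exact hVU this.2 (eb.trans hγb)

/-- Under strong causality, nearby causally related points are locally causally related. -/
lemma StronglyCausalAt.exists_nhds_causalFuture {p : M} (h : g.StronglyCausalAt p) {U : Set M}
    (hU : IsOpen U) (hp : p ∈ U) :
    ∃ V ∈ 𝓝 p, ∀ x ∈ V, ∀ y ∈ V, y ∈ g.causalFuture {x} univ → y ∈ g.causalFuture {x} U := by
  obtain ⟨V, hV, hVU, h⟩ := h U (hU.mem_nhds hp)
  refine ⟨V, hV, fun x hx y hy hxy ↦ ?_⟩
  rcases eq_or_ne x y with rfl | hne
  · exact mem_causalFuture.2 (Or.inl ⟨rfl, hVU hx⟩)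
  obtain ⟨b, hb, γ, hγ, h0, hγb⟩ := exists_isCausalCurve (transGen_of_mem_causalFuture hxy hne)
  -- Both ends of the curve are in `V`, and the parameters in `V` form an interval; hence the whole
  -- curve stays in `V ⊆ U`.
  have hγV : MapsTo γ (Icc 0 b) V := fun t ht ↦ ((h _ _ hγ).out (x := 0)
    ⟨⟨le_rfl, hb.le⟩, by rwa [h0]⟩ (y := b) ⟨⟨hb.le, le_rfl⟩, by rwa [hγb]⟩ ht).2
  have := hγ.transGen hU ⟨le_rfl, hb.le⟩ ⟨hb.le, le_rfl⟩ hb (hγV.mono_right hVU)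
  rw [h0, hγb] at this
  exact causalFuture_of_transGen this

/-- In a strongly causal spacetime, the causal curves are the continuous curves that increase
strictly with respect to the causal order. -/
lemma isCausalCurve_of_forall_causalFuture (h : ∀ p, g.StronglyCausalAt p) {F : Set ℝ}
    {γ : ℝ → M} (hF : F.OrdConnected) (hF' : F.Nontrivial) (hγ : ContinuousOn γ F)
    (hlt : ∀ s ∈ F, ∀ t ∈ F, s < t → γ s ≠ γ t ∧ γ t ∈ g.causalFuture {γ s} univ) :
    g.IsCausalCurve F γ := by
  refine ⟨hF, hF', hγ, fun t ht U hU htU ↦ ?_⟩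
  obtain ⟨V, hV, hVU⟩ := (h (γ t)).exists_nhds_causalFuture hU htU
  obtain ⟨G, hG, hGV⟩ := mem_nhdsWithin_iff_exists_mem_nhds_inter.1 (hγ t ht hV)
  exact ⟨G, hG, fun s₁ h1 s₂ h2 h12 ↦ ⟨(hlt _ h1.2 _ h2.2 h12).1,
    hVU _ (hGV h1) _ (hGV h2) (hlt _ h1.2 _ h2.2 h12).2⟩⟩

/-! ### Global hyperbolicity -/

namespace IsGloballyHyperbolic

variable (hg : g.IsGloballyHyperbolic)
include hg

lemma eq_of_mem_causalFuture [T2Space M] {p q : M} (h1 : q ∈ g.causalFuture {p} univ)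
    (h2 : p ∈ g.causalFuture {q} univ) : p = q := (hg.1 p).eq_of_mem_causalFuture h1 h2

/-- For a limit point `r`, choose `q` in its chronological future. Points of $J^+(p)$ near `r` lie
in the compact, hence closed, set $J^+(p)\cap J^-(q)$, so `r` does too. -/
lemma isClosed_causalFuture [T2Space M] (p : M) : IsClosed (g.causalFuture {p} univ) := by
  refine isClosed_of_closure_subset fun r hr ↦ ?_
  obtain ⟨q, -, hq⟩ := exists_mem_chronFuture (g := g) r univ_mem
  have hcl := (hg.2 p q).isClosed
  by_contra hrp
  have hopen : g.chronPast {q} univ ∩ (g.causalFuture {p} univ ∩ g.causalPast {q} univ)ᶜ ∈ 𝓝 r :=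
    inter_mem ((isOpen_chronPast q).mem_nhds (mem_chronPast.2 hq))
      (hcl.isOpen_compl.mem_nhds fun h ↦ hrp h.1)
  obtain ⟨z, ⟨hz1, hz2⟩, hz3⟩ := mem_closure_iff_nhds.1 hr _ hopen
  exact hz2 ⟨hz3, mem_causalPast.2 (causalFuture_of_chronFuture (mem_chronPast.1 hz1))⟩

lemma isClosed_causalPast [T2Space M] (p : M) : IsClosed (g.causalPast {p} univ) := by
  simpa using hg.reverse.isClosed_causalFuture p

/-- The causal relation is closed. -/
lemma isClosed_causalRel [T2Space M] :
    IsClosed {x : M × M | x.2 ∈ g.causalFuture {x.1} univ} := by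
  refine isClosed_of_closure_subset fun ⟨p, q⟩ hpq ↦ ?_
  -- Moving `p` slightly to the past makes $I^+(p')$ a neighbourhood of `p`, so nearby initial
  -- points can be replaced by the fixed point `p'`. Closedness of $J^+(p')$, and afterwards of
  -- $J^-(q)$ as $p'\to p$, gives the claim.
  have key : ∀ p' ∈ g.chronPast {p} univ, q ∈ g.causalFuture {p'} univ := by
    intro p' hp'
    rw [← (hg.isClosed_causalFuture p').closure_eq, mem_closure_iff_nhds]
    intro U hU
    obtain ⟨⟨x, y⟩, ⟨hx, hy⟩, hxy⟩ := mem_closure_iff_nhds.1 hpq _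
      (prod_mem_nhds ((isOpen_chronFuture p').mem_nhds (mem_chronPast.1 hp')) hU)
    exact ⟨y, hy, causalFuture_trans (causalFuture_of_chronFuture hx) hxy⟩
  change q ∈ g.causalFuture {p} univ
  rw [← mem_causalPast, ← (hg.isClosed_causalPast q).closure_eq, mem_closure_iff_nhds]
  intro U hU
  obtain ⟨p', hp'U, hp'⟩ := exists_mem_chronPast (g := g) p hU
  exact ⟨p', hp'U, mem_causalPast.2 (key p' hp')⟩

end IsGloballyHyperbolic

end Spacetime

end Causality

namespace Causality

open Filter Bundle

/-! ### The underlying manifold is second countable -/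

/-- A connected locally compact paracompact space is a countable union of compact sets. -/
lemma sigmaCompactSpace_of_paracompactSpace (X : Type*) [TopologicalSpace X] [T2Space X]
    [LocallyCompactSpace X] [ParacompactSpace X] [ConnectedSpace X] : SigmaCompactSpace X := by
  choose K hK hKn using fun x : X ↦ exists_compact_mem_nhds x
  obtain ⟨V, hVo, hVu, hVf, hVK⟩ := precise_refinement (fun x ↦ interior (K x))
    (fun x ↦ isOpen_interior) (eq_univ_of_forall fun x ↦
      mem_iUnion.2 ⟨x, mem_interior_iff_mem_nhds.2 (hKn x)⟩)
  -- the compact set that is covered by the sets which meet a given compact set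
  have hstep : ∀ C : Set X, IsCompact C → ∃ D : Set X, IsCompact D ∧
      ∀ i, (V i ∩ C).Nonempty → V i ⊆ D := by
    intro C hC
    have hfin := hVf.finite_nonempty_inter_compact hC
    refine ⟨⋃ i ∈ {i | (V i ∩ C).Nonempty}, K i, hfin.isCompact_biUnion fun i _ ↦ hK i,
      fun i hi ↦ ?_⟩
    exact ((hVK i).trans interior_subset).trans (subset_biUnion_of_mem (u := fun i ↦ K i) hi)
  choose! D hD hVD using hstep
  obtain ⟨x₀⟩ := (inferInstance : Nonempty X)
  let C : ℕ → Set X := fun k ↦ D^[k] {x₀}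
  have hC : ∀ k, IsCompact (C k) := by
    intro k
    induction k with
    | zero => exact isCompact_singleton
    | succ k ih => simpa only [C, Function.iterate_succ_apply'] using hD _ ih
  have hCV : ∀ k i, (V i ∩ C k).Nonempty → V i ⊆ C (k + 1) := fun k i h ↦ by
    simpa only [C, Function.iterate_succ_apply'] using hVD _ (hC k) i h
  have hmem : ∀ x, ∃ i, x ∈ V i := fun x ↦ mem_iUnion.1 (hVu ▸ mem_univ x)
  have hopen : IsOpen (⋃ k, C k) := by
    refine isOpen_iff_mem_nhds.2 fun x hx ↦ ?_
    obtain ⟨k, hk⟩ := mem_iUnion.1 hx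
    obtain ⟨i, hi⟩ := hmem x
    exact mem_of_superset ((hVo i).mem_nhds hi)
      ((hCV k i ⟨x, hi, hk⟩).trans (subset_iUnion C (k + 1)))
  have hclosed : IsClosed (⋃ k, C k) := by
    refine isOpen_compl_iff.1 (isOpen_iff_mem_nhds.2 fun x hx ↦ ?_)
    obtain ⟨i, hi⟩ := hmem x
    refine mem_of_superset ((hVo i).mem_nhds hi) fun y hy hy' ↦ hx ?_
    obtain ⟨k, hk⟩ := mem_iUnion.1 hy'
    exact mem_iUnion.2 ⟨k + 1, hCV k i ⟨y, hy, hk⟩ hi⟩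
  exact ⟨⟨C, hC, IsClopen.eq_univ ⟨hclosed, hopen⟩ ⟨x₀, mem_iUnion.2 ⟨0, rfl⟩⟩⟩⟩

section Riemannian

variable {E : Type*} [NormedAddCommGroup E] [NormedSpace ℝ E]

lemma isBounded_of_pos_def [FiniteDimensional ℝ E] (h : E →L[ℝ] E →L[ℝ] ℝ)
    (hpos : ∀ v, v ≠ 0 → 0 < h v v) : Bornology.IsBounded {v | h v v < 1} := by
  obtain ⟨k, hk, hk'⟩ : ∃ k > 0, ∀ v ∈ Metric.sphere (0 : E) 1, k ≤ h v v := by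
    rcases (Metric.sphere (0 : E) 1).eq_empty_or_nonempty with he | hne
    · exact ⟨1, one_pos, by simp [he]⟩
    · have hc : Continuous fun v ↦ h v v := by fun_prop
      obtain ⟨w, hw, hmin⟩ := (isCompact_sphere (0 : E) 1).exists_isMinOn hne hc.continuousOn
      exact ⟨h w w, hpos w fun h0 ↦ by simp [h0] at hw, fun v hv ↦ hmin hv⟩
  refine (Metric.isBounded_iff_subset_closedBall 0).2 ⟨k⁻¹ + 1, fun v hv ↦ ?_⟩
  rw [mem_closedBall_zero_iff]
  rcases eq_or_ne v 0 with rfl | hv0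
  · rw [norm_zero]; positivity
  have hn : 0 < ‖v‖ := norm_pos_iff.2 hv0
  have h1 := hk' (‖v‖⁻¹ • v) (by simp [norm_smul, hn.ne'])
  simp only [map_smul, smul_apply, smul_eq_mul] at h1
  have h2 : k * ‖v‖ ^ 2 < 1 := by
    have : k * ‖v‖ ^ 2 ≤ h v v := by
      calc k * ‖v‖ ^ 2 ≤ (‖v‖⁻¹ * (‖v‖⁻¹ * h v v)) * ‖v‖ ^ 2 := by gcongr
        _ = h v v := by field_simp
    exact this.trans_lt hv
  have h3 : ‖v‖ ^ 2 < k⁻¹ := by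
    rw [lt_inv_comm₀ (by positivity) hk, inv_eq_one_div, lt_div_iff₀ (by positivity)]
    exact h2
  nlinarith [sq_nonneg (‖v‖ - 1)]

variable {M : Type*} [TopologicalSpace M] [ChartedSpace E M]

/-- The Riemannian metric that is obtained from a Lorentz metric by reversing the sign in the
direction of a timelike vector field. -/
def riemannianOfLorentz
    (m : ∀ x : M, TangentSpace 𝓘(ℝ, E) x →L[ℝ] TangentSpace 𝓘(ℝ, E) x →L[ℝ] ℝ)
    (o : ∀ x : M, TangentSpace 𝓘(ℝ, E) x) (x : M) :
    TangentSpace 𝓘(ℝ, E) x →L[ℝ] TangentSpace 𝓘(ℝ, E) x →L[ℝ] ℝ :=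
  m x - (2 / m x (o x) (o x)) • (m x (o x)).smulRight (m x (o x))

variable {m : ∀ x : M, TangentSpace 𝓘(ℝ, E) x →L[ℝ] TangentSpace 𝓘(ℝ, E) x →L[ℝ] ℝ}
    {o : ∀ x : M, TangentSpace 𝓘(ℝ, E) x}

lemma riemannianOfLorentz_apply (x : M) (v w : TangentSpace 𝓘(ℝ, E) x) :
    riemannianOfLorentz m o x v w =
      m x v w - 2 / m x (o x) (o x) * (m x (o x) v * m x (o x) w) := by
  simp [riemannianOfLorentz]

variable [IsManifold 𝓘(ℝ, E) ∞ M]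

/-- Write $v=l\,o+w$ with $w$ orthogonal to $o$. The new form takes the value $g(w,w)-l^2g(o,o)$ on
$v$, where $g(o,o)<0$ and $w$ is spacelike or zero. -/
lemma IsLorentz.riemannian_pos (h : IsLorentz m o) (x : M) (v : TangentSpace 𝓘(ℝ, E) x)
    (hv : v ≠ 0) : 0 < riemannianOfLorentz m o x v v := by
  rw [riemannianOfLorentz_apply]
  set a := m x (o x) (o x) with ha
  have ha0 : a < 0 := h.timelike_orient x
  set l := m x (o x) v / a with hl
  have hlv : m x (o x) v = l * a := (div_mul_cancel₀ _ ha0.ne).symm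
  set w := v - l • o x with hw
  have hw0 : m x (o x) w = 0 := by rw [hw, map_sub, map_smul, smul_eq_mul, hlv, ← ha, sub_self]
  have hww : m x w w = m x v v - l ^ 2 * a := by
    have : m x w w = m x v w - l * m x (o x) w := by
      have : m x w w = m x (v - l • o x) w := by rw [← hw]
      rw [this, show m x (v - l • o x) = m x v - l • m x (o x) by rw [map_sub, map_smul],
        sub_apply, smul_apply, smul_eq_mul]
    rw [this, hw0, hw, map_sub, map_smul, smul_eq_mul, h.symm x v (o x), hlv]
    ring
  have e1 : m x v v - 2 / a * (m x (o x) v * m x (o x) v) = m x w w - l ^ 2 * a := by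
    rw [hww, hlv]; field_simp; ring
  rw [e1]
  rcases lt_or_ge 0 (m x w w) with hpos | hneg
  · nlinarith [sq_nonneg l]
  · have hw' := h.eq_zero x w hneg hw0
    have hl0 : l ≠ 0 := fun h0 ↦ hv (by rw [hw, h0, zero_smul, sub_zero] at hw'; exact hw')
    rw [hw']
    have := mul_pos_of_neg_of_neg ha0 ha0
    simp only [map_zero]
    nlinarith [sq_pos_of_ne_zero hl0 |>.le, mul_neg_of_pos_of_neg (sq_pos_of_ne_zero hl0) ha0]

variable [FiniteDimensional ℝ E]

lemma IsLorentz.continuous_riemannian (h : IsLorentz m o) :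
    Continuous (fun x ↦ TotalSpace.mk' (E →L[ℝ] E →L[ℝ] ℝ) x (riemannianOfLorentz m o x)) := by
  refine continuous_iff_continuousAt.2 fun x₀ ↦
    (continuousAt_hom_bundle (RingHom.id ℝ) _).2 ⟨continuousAt_id, ?_⟩
  set t := trivializationAt E (TangentSpace 𝓘(ℝ, E) : M → Type _) x₀ with ht
  have hx₀ : x₀ ∈ t.baseSet := FiberBundle.mem_baseSet_trivializationAt' x₀
  refine ContinuousOn.continuousAt (s := t.baseSet) ?_ (t.open_baseSet.mem_nhds hx₀)
  refine continuousOn_clm_apply.2 fun u ↦ continuousOn_clm_apply.2 fun w ↦ ?_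
  have hsec : ∀ u : E, ContinuousOn (fun x ↦ TotalSpace.mk' E x (t.symm x u)) t.baseSet := fun u ↦
    t.continuousOn_symm.comp (f := fun x ↦ (x, u)) (by fun_prop) fun x hx ↦ ⟨hx, mem_univ _⟩
  have happ : ∀ v v' : ∀ x : M, TangentSpace 𝓘(ℝ, E) x,
      ContinuousOn (fun x ↦ TotalSpace.mk' E x (v x)) t.baseSet →
      ContinuousOn (fun x ↦ TotalSpace.mk' E x (v' x)) t.baseSet →
      ContinuousOn (fun x ↦ m x (v x) (v' x)) t.baseSet := by
    intro v v' hv hv' x hx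
    have h2 := ((h.contMDiff.continuous.continuousOn).clm_bundle_apply₂ (F₁ := E)
      (F₂ := E) (E₃ := Bundle.Trivial M ℝ) (F₃ := ℝ) hv hv') x hx
    exact ((FiberBundle.continuousWithinAt_totalSpace ℝ _).1 h2).2
  have ho : ContinuousOn (fun x ↦ TotalSpace.mk' E x (o x)) t.baseSet :=
    h.continuous_orient.continuousOn
  refine ContinuousOn.congr (f := fun x ↦ riemannianOfLorentz m o x (t.symm x u) (t.symm x w)) ?_
    fun x hx ↦ ?_
  · simp only [riemannianOfLorentz_apply]
    exact (happ _ _ (hsec u) (hsec w)).sub ((continuousOn_const.div (happ _ _ ho ho)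
      fun x _ ↦ (h.timelike_orient x).ne).mul
        ((happ _ _ ho (hsec u)).mul (happ _ _ ho (hsec w))))
  · rw [inCoordinates_apply_eq₂ hx hx (mem_univ _)]
    simp only [Trivial.fiberBundle_trivializationAt', Trivial.linearMapAt_trivialization]
    rfl

/-- A connected Lorentz manifold is second countable. -/
lemma IsLorentz.secondCountableTopology [T2Space M] [ConnectedSpace M] (h : IsLorentz m o) :
    SecondCountableTopology M := by
  let R : ContinuousRiemannianMetric E (TangentSpace 𝓘(ℝ, E) : M → Type _) :=
    { inner := riemannianOfLorentz m o
      symm := fun x v w ↦ by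
        rw [riemannianOfLorentz_apply, riemannianOfLorentz_apply, h.symm x v w]; ring
      pos := h.riemannian_pos
      isVonNBounded := fun x ↦ by
        have := isBounded_of_pos_def (E := E) (riemannianOfLorentz m o x) (h.riemannian_pos x)
        exact NormedSpace.isVonNBounded_of_isBounded (E := E) ℝ this
      continuous := h.continuous_riemannian }
  let _ : RiemannianBundle (TangentSpace 𝓘(ℝ, E) : M → Type _) := ⟨R.toRiemannianMetric⟩
  have : LocallyCompactSpace M := ChartedSpace.locallyCompactSpace E M
  have : IsManifold 𝓘(ℝ, E) 1 M := .of_le (n := ∞) (by simp)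
  -- The Riemannian distance induces the manifold topology, which is therefore paracompact;
  -- connectedness then yields σ-compactness.
  let _ : EMetricSpace M := EMetricSpace.ofRiemannianMetric 𝓘(ℝ, E) M
  have := sigmaCompactSpace_of_paracompactSpace M
  exact ChartedSpace.secondCountable_of_sigmaCompact E M

end Riemannian

variable {n : ℕ} {M : Type*} [TopologicalSpace M]
  [ChartedSpace (EuclideanSpace ℝ (Fin (n + 1))) M] [IsManifold (𝓡 (n + 1)) ∞ M]

namespace Spacetime

lemma secondCountableTopology [T2Space M] [ConnectedSpace M] (g : Spacetime n M) :
    SecondCountableTopology M :=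
  g.isLorentz.secondCountableTopology

end Spacetime

end Causality

namespace Causality

open Filter

/-! ### Null sets on a manifold -/

section NullSets

variable {E : Type*} [NormedAddCommGroup E] [NormedSpace ℝ E]
  {M : Type*} [TopologicalSpace M] [ChartedSpace E M] {e e' : OpenPartialHomeomorph M E}

lemma differentiableOn_transition (he : e ∈ IsManifold.maximalAtlas 𝓘(ℝ, E) ∞ M)
    (he' : e' ∈ IsManifold.maximalAtlas 𝓘(ℝ, E) ∞ M) :
    DifferentiableOn ℝ (e' ∘ e.symm) (e.target ∩ e.symm ⁻¹' e'.source) := by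
  have h := (contMDiffOn_of_mem_maximalAtlas he').comp
    ((contMDiffOn_symm_of_mem_maximalAtlas he).mono
      (inter_subset_left (t := e.symm ⁻¹' e'.source))) fun y hy ↦ hy.2
  exact (contMDiffOn_iff_contDiffOn.1 h).differentiableOn (by simp)

variable [FiniteDimensional ℝ E] [MeasurableSpace E] [BorelSpace E] (ν : Measure E)
  [ν.IsAddHaarMeasure]

lemma measure_image_chart_eq_zero (he : e ∈ IsManifold.maximalAtlas 𝓘(ℝ, E) ∞ M)
    (he' : e' ∈ IsManifold.maximalAtlas 𝓘(ℝ, E) ∞ M) {A : Set M} (hA : A ⊆ e.source)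
    (hA' : A ⊆ e'.source) (h : ν (e '' A) = 0) : ν (e' '' A) = 0 := by
  have hsub : e '' A ⊆ e.target ∩ e.symm ⁻¹' e'.source := by
    rintro _ ⟨x, hx, rfl⟩
    refine ⟨e.map_source (hA hx), ?_⟩
    rw [mem_preimage, e.left_inv (hA hx)]
    exact hA' hx
  have h1 := addHaar_image_eq_zero_of_differentiableOn_of_addHaar_eq_zero ν
    ((differentiableOn_transition he he').mono hsub) h
  rwa [image_image, image_congr (g := e') fun x hx ↦ by
    rw [Function.comp, e.left_inv (hA hx)]] at h1

/-- Sum the Haar measures transported from countably many charts. Smooth transition maps preserve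
null sets, so the null sets are the right ones in every chart; `toFinite` then normalizes the total
mass without changing them. -/
lemma exists_measure_null_iff [IsManifold 𝓘(ℝ, E) ∞ M] [SecondCountableTopology M]
    [Nonempty M] [MeasurableSpace M] [BorelSpace M] :
    ∃ μ : Measure M, IsProbabilityMeasure μ ∧
      ∀ e ∈ IsManifold.maximalAtlas 𝓘(ℝ, E) ∞ M, ∀ A ⊆ e.source, MeasurableSet A →
        (μ A = 0 ↔ ν (e '' A) = 0) := by
  obtain ⟨s, hs, hsu⟩ := TopologicalSpace.countable_cover_nhds
    (fun x : M ↦ chart_source_mem_nhds E x)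
  have : Countable s := hs.to_subtype
  let κ : Measure M := Measure.sum fun x : s ↦
    (ν.restrict (chartAt E (x : M)).target).map (chartAt E (x : M)).symm
  have hκ : ∀ A, MeasurableSet A → (κ A = 0 ↔ ∀ x : s,
      ν (chartAt E (x : M) '' ((chartAt E (x : M)).source ∩ A)) = 0) := by
    intro A hA
    rw [Measure.sum_apply _ hA, ENNReal.tsum_eq_zero]
    refine forall_congr' fun x ↦ ?_
    have hm : MeasurableSet (chartAt E (x : M)).target :=
      (chartAt E (x : M)).open_target.measurableSet
    have hc := (chartAt E (x : M)).continuousOn_symm.aemeasurable (μ := ν) hm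
    rw [Measure.map_apply_of_aemeasurable hc hA, Measure.restrict_apply₀' hm.nullMeasurableSet,
      OpenPartialHomeomorph.image_source_inter_eq', inter_comm]
  have hiff : ∀ e ∈ IsManifold.maximalAtlas 𝓘(ℝ, E) ∞ M, ∀ A ⊆ e.source, MeasurableSet A →
      (κ A = 0 ↔ ν (e '' A) = 0) := by
    intro e he A hAe hA
    rw [hκ A hA]
    constructor
    · intro h
      have hcov : e '' A ⊆ ⋃ x : s, e '' ((chartAt E (x : M)).source ∩ A) := by
        rintro _ ⟨y, hy, rfl⟩
        have : y ∈ ⋃ x ∈ s, (chartAt E x).source := hsu ▸ mem_univ y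
        simp only [mem_iUnion] at this ⊢
        obtain ⟨x, hx, hyx⟩ := this
        exact ⟨⟨x, hx⟩, mem_image_of_mem e ⟨hyx, hy⟩⟩
      refine measure_mono_null hcov (measure_iUnion_null fun x ↦ ?_)
      exact measure_image_chart_eq_zero ν (IsManifold.chart_mem_maximalAtlas _) he
        inter_subset_left (inter_subset_right.trans hAe) (h x)
    · intro h x
      exact measure_image_chart_eq_zero ν he (IsManifold.chart_mem_maximalAtlas _)
        (inter_subset_right.trans hAe) inter_subset_left
          (measure_mono_null (image_mono inter_subset_right) h)
  have : NeZero κ := ⟨fun h0 ↦ by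
    obtain ⟨x⟩ := (inferInstance : Nonempty M)
    have h1 := (hiff _ (IsManifold.chart_mem_maximalAtlas x) _ subset_rfl
      (chartAt E x).open_source.measurableSet).1 (by rw [h0]; rfl)
    rw [(chartAt E x).image_source_eq_target] at h1
    exact (chartAt E x).open_target.measure_ne_zero ν
      ⟨_, (chartAt E x).map_source (mem_chart_source E x)⟩ h1⟩
  refine ⟨κ.toFinite, inferInstance, fun e he A hAe hA ↦ ?_⟩
  rw [toFinite_apply_eq_zero_iff, hiff e he A hAe hA]

end NullSets

/-! ### Volumes of chronological pasts and futures -/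

variable {n : ℕ} {M : Type*} [TopologicalSpace M]
  [ChartedSpace (EuclideanSpace ℝ (Fin (n + 1))) M] [IsManifold (𝓡 (n + 1)) ∞ M]
  [MeasurableSpace M] [BorelSpace M] {μ : Measure M}

namespace Spacetime

lemma exists_isNormalizedVolume [SecondCountableTopology M] [Nonempty M] :
    ∃ μ : Measure M, IsNormalizedVolume n μ := by
  obtain ⟨μ, hμ, h⟩ := exists_measure_null_iff (M := M)
    (volume : Measure (EuclideanSpace ℝ (Fin (n + 1))))
  exact ⟨μ, measure_univ, h⟩

omit [BorelSpace M] in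
lemma IsNormalizedVolume.isProbabilityMeasure (hμ : IsNormalizedVolume n μ) :
    IsProbabilityMeasure μ := ⟨hμ.1⟩

lemma IsNormalizedVolume.measure_pos (hμ : IsNormalizedVolume n μ) {U : Set M} (hU : IsOpen U)
    (hne : U.Nonempty) : 0 < μ U := by
  obtain ⟨x, hx⟩ := hne
  set e := chartAt (EuclideanSpace ℝ (Fin (n + 1))) x
  have hxe : x ∈ e.source := mem_chart_source _ x
  refine pos_iff_ne_zero.2 fun h0 ↦ ?_
  have h1 := (hμ.2 e (IsManifold.chart_mem_maximalAtlas x) (e.source ∩ U) inter_subset_left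
    (e.open_source.inter hU).measurableSet).1 (measure_mono_null inter_subset_right h0)
  exact (e.isOpen_image_of_subset_source (e.open_source.inter hU) inter_subset_left).measure_ne_zero
    volume ⟨_, mem_image_of_mem e ⟨hxe, hx⟩⟩ h1

variable {g : Spacetime n M}

/-- The boundary of the past of a point is a null set. -/
lemma IsNormalizedVolume.measure_causalPast_diff [T2Space M] [SecondCountableTopology M]
    (hμ : IsNormalizedVolume n μ) (hg : g.IsGloballyHyperbolic) (p : M) :
    μ (g.causalPast {p} univ \ g.chronPast {p} univ) = 0 := by
  set A := g.causalPast {p} univ \ g.chronPast {p} univ with hA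
  have hAm : MeasurableSet A := (hg.isClosed_causalPast p).measurableSet.diff
    (isOpen_chronPast p).measurableSet
  refine measure_null_of_locally_null _ fun x hx ↦ ?_
  have he := IsManifold.chart_mem_maximalAtlas (I := 𝓡 (n + 1)) (n := ∞) x
  have hxe := mem_chart_source (EuclideanSpace ℝ (Fin (n + 1))) x
  set e := chartAt (EuclideanSpace ℝ (Fin (n + 1))) x
  obtain ⟨u, hu, huu⟩ := exists_coordBilin_eq g.isLorentz he (e.map_source hxe)
  obtain ⟨r, hr, hrt, -, hrc⟩ := exists_ball_timelike g.isLorentz he hxe univ_mem huu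
    (by rwa [hu])
  set B := Metric.ball (e x) r with hB
  set V := e.source ∩ e ⁻¹' B with hV
  have hVo : IsOpen V := e.isOpen_inter_preimage Metric.isOpen_ball
  have hVx : x ∈ V := ⟨hxe, Metric.mem_ball_self hr⟩
  refine ⟨V ∩ A, inter_mem (mem_nhdsWithin_of_mem_nhds (hVo.mem_nhds hVx)) self_mem_nhdsWithin, ?_⟩
  rw [hμ.2 e he _ (inter_subset_left.trans inter_subset_left) (hVo.measurableSet.inter hAm)]
  -- along timelike lines, the set is met at most once
  have hline : ∀ y ∈ e '' (V ∩ A), ∀ s : ℝ, 0 < s → y + s • u ∉ e '' (V ∩ A) := by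
    rintro _ ⟨y, ⟨hyV, hyA⟩, rfl⟩ s hs ⟨z, ⟨hzV, hzA⟩, hz⟩
    have h1 := segment_line_smul (m := g.metric) (o := g.orient) he hs (convex_ball (e x) r) hrt
      (mapsTo_univ _ _) hyV.2 (hz ▸ hzV.2) fun y hy ↦ hrc y hy u (Metric.mem_ball_self hr)
    rw [← hz, e.left_inv hyV.1, e.left_inv hzV.1] at h1
    exact hyA.2 (mem_chronPast.2 (chronFuture_of_chronFuture_of_causalFuture
      (mem_chronFuture.2 (.single h1)) (mem_causalPast.1 hzA.1)))
  have hsub : e '' (V ∩ A) ⊆ B := by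
    rintro _ ⟨y, hy, rfl⟩
    exact hy.1.2
  have himage : e '' (V ∩ A) = e.target ∩ e.symm ⁻¹' (V ∩ A) := by
    rw [← OpenPartialHomeomorph.image_source_inter_eq',
      inter_eq_right.2 (inter_subset_left.trans inter_subset_left)]
  have hmeas : MeasurableSet (e '' (V ∩ A)) := by
    have ho : ∀ W : Set M, IsOpen W → MeasurableSet (e.target ∩ e.symm ⁻¹' W) := fun W hW ↦
      (e.continuousOn_symm.isOpen_inter_preimage e.open_target hW).measurableSet
    have : e '' (V ∩ A) = ((e.target ∩ e.symm ⁻¹' V) \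
        (e.target ∩ e.symm ⁻¹' (g.causalPast {p} univ)ᶜ)) \
          (e.target ∩ e.symm ⁻¹' g.chronPast {p} univ) := by
      rw [himage, hA]
      ext y
      simp only [mem_inter_iff, mem_preimage, Set.mem_sdiff, mem_compl_iff]
      by_cases h1 : y ∈ e.target <;> by_cases h2 : e.symm y ∈ g.causalPast {p} univ <;>
        simp [h1, h2]
    rw [this]
    exact ((ho _ hVo).diff (ho _ (hg.isClosed_causalPast p).isOpen_compl)).diff
      (ho _ (isOpen_chronPast p))
  -- By `hline`, the translates along the distinct vectors $u/(k+1)$ are pairwise disjoint. These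
  -- vectors form a bounded sequence, which forces measure zero.
  refine Measure.addHaar_eq_zero_of_disjoint_translates volume
    (u := fun k : ℕ ↦ (1 / ((k : ℝ) + 1)) • u) ?_ ?_ hmeas
  · exact Metric.isBounded_range_of_tendsto _ (tendsto_one_div_add_atTop_nhds_zero_nat.smul_const u)
  · refine (pairwise_disjoint_on _).2 fun k l hkl ↦ ?_
    rw [Set.disjoint_left]
    intro z hzk hzl
    rw [singleton_add, image_add_left, mem_preimage] at hzk hzl
    have hlt : 1 / ((l : ℝ) + 1) < 1 / ((k : ℝ) + 1) :=
      one_div_lt_one_div_of_lt (by positivity) (by exact_mod_cast Nat.succ_lt_succ hkl)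
    refine hline _ hzk _ (sub_pos.2 hlt) ?_
    convert hzl using 1
    module

section

omit [MeasurableSpace M] [BorelSpace M]

lemma nonempty_chronPast (g : Spacetime n M) (p : M) : (g.chronPast {p} univ).Nonempty :=
  let ⟨q, hq⟩ := exists_mem_chronPast (g := g) p univ_mem
  ⟨q, hq.2⟩

end

omit [BorelSpace M] in
lemma volFuture_eq_reverse (g : Spacetime n M) (μ : Measure M) :
    g.volFuture μ = g.reverse.volPast μ := by
  ext p
  rw [volFuture, volPast, chronPast_reverse]

lemma volPast_pos (hμ : IsNormalizedVolume n μ) (g : Spacetime n M) (p : M) :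
    0 < g.volPast μ p := by
  have := hμ.isProbabilityMeasure
  exact ENNReal.toReal_pos (hμ.measure_pos (isOpen_chronPast p) (g.nonempty_chronPast p)).ne'
    (measure_ne_top _ _)

lemma volFuture_pos (hμ : IsNormalizedVolume n μ) (g : Spacetime n M) (p : M) :
    0 < g.volFuture μ p := by
  rw [volFuture_eq_reverse]
  exact volPast_pos hμ _ p

variable [T2Space M]

/-- Outside the null set $J^-(p)\setminus I^-(p)$, the condition $x\in I^-(q)$ is constant for `q`
near `p`: if $x\in I^-(p)$ because $I^+(x)$ is open, and if $x\notin J^-(p)$ because $J^+(x)$ is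
closed. Convergence of indicators gives convergence of finite measures. -/
lemma continuous_volPast [SecondCountableTopology M] (hμ : IsNormalizedVolume n μ)
    (hg : g.IsGloballyHyperbolic) : Continuous (g.volPast μ) := by
  have := hμ.isProbabilityMeasure
  refine continuous_iff_continuousAt.2 fun p ↦ ?_
  refine (ENNReal.tendsto_toReal (measure_ne_top _ _)).comp ?_
  refine tendsto_measure_of_ae_tendsto_indicator_of_isFiniteMeasure (𝓝 p)
    (isOpen_chronPast p).measurableSet (fun q ↦ (isOpen_chronPast q).measurableSet) ?_
  filter_upwards [measure_eq_zero_iff_ae_notMem.1 (hμ.measure_causalPast_diff hg p)] with x hx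
  by_cases hxp : x ∈ g.chronPast {p} univ
  · filter_upwards [(isOpen_chronFuture (g := g) x).mem_nhds (mem_chronPast.1 hxp)] with q hq
    exact iff_of_true (mem_chronPast.2 hq) hxp
  · have h1 : p ∈ (g.causalFuture {x} univ)ᶜ := fun h ↦ hx ⟨mem_causalPast.2 h, hxp⟩
    filter_upwards [(hg.isClosed_causalFuture x).isOpen_compl.mem_nhds h1] with q hq
    exact iff_of_false (fun h ↦ hq (causalFuture_of_chronFuture (mem_chronPast.1 h))) hxp

lemma continuous_volFuture [SecondCountableTopology M] (hμ : IsNormalizedVolume n μ)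
    (hg : g.IsGloballyHyperbolic) : Continuous (g.volFuture μ) := by
  rw [volFuture_eq_reverse]
  exact continuous_volPast hμ hg.reverse

/-- By antisymmetry `q` lies outside the closed set $J^-(p)$. Hence $I^-(q)\setminus J^-(p)$ is open
and nonempty, and its positive volume is gained. -/
lemma volPast_lt_volPast (hμ : IsNormalizedVolume n μ) (hg : g.IsGloballyHyperbolic) {p q : M}
    (h : q ∈ g.causalFuture {p} univ) (hne : p ≠ q) : g.volPast μ p < g.volPast μ q := by
  have := hμ.isProbabilityMeasure
  have hsub : g.chronPast {p} univ ⊆ g.chronPast {q} univ := fun x hx ↦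
    mem_chronPast.2 (chronFuture_of_chronFuture_of_causalFuture (mem_chronPast.1 hx) h)
  set D := g.chronPast {q} univ ∩ (g.causalPast {p} univ)ᶜ with hD
  have hDo : IsOpen D := (isOpen_chronPast q).inter (hg.isClosed_causalPast p).isOpen_compl
  have hqp : q ∈ (g.causalPast {p} univ)ᶜ := fun h' ↦
    hne (hg.eq_of_mem_causalFuture h (mem_causalPast.1 h'))
  obtain ⟨x, hx⟩ := exists_mem_chronPast (g := g) q
    ((hg.isClosed_causalPast p).isOpen_compl.mem_nhds hqp)
  have hDne : D.Nonempty := ⟨x, hx.2, hx.1⟩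
  have hdisj : Disjoint (g.chronPast {p} univ) D := by
    rw [Set.disjoint_left]
    exact fun x hx hxD ↦
      hxD.2 (mem_causalPast.2 (causalFuture_of_chronFuture (mem_chronPast.1 hx)))
  have h1 : μ.real (g.chronPast {p} univ) + μ.real D ≤ μ.real (g.chronPast {q} univ) := by
    rw [← measureReal_union hdisj hDo.measurableSet]
    exact measureReal_mono (union_subset hsub inter_subset_left)
  have h2 : 0 < μ.real D := ENNReal.toReal_pos (hμ.measure_pos hDo hDne).ne' (measure_ne_top _ _)
  rw [volPast, volPast]
  linarith

lemma volFuture_lt_volFuture (hμ : IsNormalizedVolume n μ) (hg : g.IsGloballyHyperbolic) {p q : M}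
    (h : q ∈ g.causalFuture {p} univ) (hne : p ≠ q) : g.volFuture μ q < g.volFuture μ p := by
  rw [volFuture_eq_reverse]
  refine volPast_lt_volPast hμ hg.reverse ?_ hne.symm
  rw [causalFuture_reverse]
  exact mem_causalPast.2 h

lemma continuous_volRatio [SecondCountableTopology M] (hμ : IsNormalizedVolume n μ)
    (hg : g.IsGloballyHyperbolic) : Continuous (g.volRatio μ) :=
  (continuous_volPast hμ hg).div (continuous_volFuture hμ hg) fun p ↦ (volFuture_pos hμ g p).ne'

lemma volRatio_lt_volRatio (hμ : IsNormalizedVolume n μ) (hg : g.IsGloballyHyperbolic) {p q : M}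
    (h : q ∈ g.causalFuture {p} univ) (hne : p ≠ q) : g.volRatio μ p < g.volRatio μ q :=
  div_lt_div₀ (volPast_lt_volPast hμ hg h hne) (volFuture_lt_volFuture hμ hg h hne).le
    (volPast_pos hμ g q).le (volFuture_pos hμ g q)

end Spacetime

end Causality

/-! ### Time functions and compactness of the spaces of curves -/

namespace Causality

open Filter

variable {n : ℕ} {M : Type*} [TopologicalSpace M]
  [ChartedSpace (EuclideanSpace ℝ (Fin (n + 1))) M] [IsManifold (𝓡 (n + 1)) ∞ M]

namespace Spacetime

variable {g : Spacetime n M}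

/-- A continuous function which is strictly increasing along the causal relation. -/
structure IsTimeFunction (g : Spacetime n M) (f : M → ℝ) : Prop where
  continuous : Continuous f
  lt : ∀ {x y : M}, y ∈ g.causalFuture {x} univ → x ≠ y → f x < f y

lemma IsNormalizedVolume.isTimeFunction [T2Space M] [SecondCountableTopology M]
    [MeasurableSpace M] [BorelSpace M] {μ : Measure M} (hμ : IsNormalizedVolume n μ)
    (hg : g.IsGloballyHyperbolic) : g.IsTimeFunction (g.volRatio μ) :=
  ⟨continuous_volRatio hμ hg, volRatio_lt_volRatio hμ hg⟩

namespace IsTimeFunction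

variable {f : M → ℝ} (hf : g.IsTimeFunction f)

include hf

lemma le {x y : M} (h : y ∈ g.causalFuture {x} univ) : f x ≤ f y := by
  rcases eq_or_ne x y with rfl | hne
  · rfl
  · exact (hf.lt h hne).le

lemma eq_of_eq {x y : M} (h : y ∈ g.causalFuture {x} univ) (hxy : f x = f y) : x = y := by
  by_contra hne
  exact (hf.lt h hne).ne hxy

lemma strictMonoOn {F : Set ℝ} {γ : ℝ → M} (h : g.IsCausalCurve F γ) :
    StrictMonoOn (f ∘ γ) F := by
  obtain ⟨h1, h2, h3, h4⟩ := h
  intro a ha b hb hab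
  refine rel_of_locally_rel (R := fun s t ↦ f (γ s) < f (γ t)) h1
    (fun _ _ _ ↦ lt_trans) (fun t ht ↦ ?_) ha hb hab
  obtain ⟨G, hG, h⟩ := h4 t ht univ isOpen_univ (mem_univ _)
  exact ⟨G, hG, fun s₁ hs₁ s₂ hs₂ h12 ↦ hf.lt (h s₁ hs₁ s₂ hs₂ h12).2 (h s₁ hs₁ s₂ hs₂ h12).1⟩

lemma lt_of_mem_chronFuture {x y : M} (h : y ∈ g.chronFuture {x} univ) : f x < f y := by
  obtain ⟨b, hb, γ, hγ, rfl, rfl⟩ := exists_isCausalCurve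
    (Relation.TransGen.mono
    (fun _ _ (h : g.TimelikeSegment univ _ _) ↦ h.causal) _ _ (mem_chronFuture.1 h))
  exact hf.strictMonoOn hγ (left_mem_Icc.2 hb.le) (right_mem_Icc.2 hb.le) hb

variable {p q : M}

omit hf in
lemma points_eq_image (c : g.CurveSpace p q) : ∃ γ : ℝ → M, g.IsCausalCurve (Icc 0 1) γ ∧
    γ 0 = p ∧ γ 1 = q ∧ CurveSpace.points g c = γ '' Icc 0 1 := by
  obtain ⟨γ, rfl⟩ := Quotient.exists_rep c
  refine ⟨γ.1.extend, γ.2, γ.1.extend_zero, γ.1.extend_one, ?_⟩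
  change range γ.1 = _
  ext x
  constructor
  · rintro ⟨u, rfl⟩
    exact ⟨u, u.2, γ.1.extend_apply u.2⟩
  · rintro ⟨u, hu, rfl⟩
    exact ⟨⟨u, hu⟩, (γ.1.extend_apply hu).symm⟩

omit hf in
lemma points_subset (c : g.CurveSpace p q) :
    CurveSpace.points g c ⊆ g.causalFuture {p} univ ∩ g.causalPast {q} univ := by
  obtain ⟨γ, hγ, rfl, rfl, h⟩ := points_eq_image c
  rw [h]
  rintro _ ⟨t, ht, rfl⟩
  exact ⟨hγ.mem_causalFuture (left_mem_Icc.2 zero_le_one) ht ht.1,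
    mem_causalPast.2 (hγ.mem_causalFuture ht (right_mem_Icc.2 zero_le_one) ht.2)⟩

lemma lt_of_curve (c : g.CurveSpace p q) : f p < f q := by
  obtain ⟨γ, hγ, rfl, rfl, h⟩ := points_eq_image c
  exact hf.strictMonoOn hγ (left_mem_Icc.2 zero_le_one) (right_mem_Icc.2 zero_le_one) zero_lt_one

lemma exists_mem_points (c : g.CurveSpace p q) {t : ℝ} (ht : t ∈ Icc (f p) (f q)) :
    ∃ x ∈ CurveSpace.points g c, f x = t := by
  obtain ⟨γ, hγ, rfl, rfl, h⟩ := points_eq_image c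
  obtain ⟨s, hs, hst⟩ := intermediate_value_Icc zero_le_one
    (hf.continuous.comp_continuousOn hγ.2.2.1) ht
  exact ⟨γ s, h ▸ mem_image_of_mem γ hs, hst⟩

lemma points_le (c : g.CurveSpace p q) {x y : M} (hx : x ∈ CurveSpace.points g c)
    (hy : y ∈ CurveSpace.points g c) (hxy : f x ≤ f y) : y ∈ g.causalFuture {x} univ := by
  obtain ⟨γ, hγ, rfl, rfl, h⟩ := points_eq_image c
  rw [h] at hx hy
  obtain ⟨s, hs, rfl⟩ := hx
  obtain ⟨t, ht, rfl⟩ := hy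
  exact hγ.mem_causalFuture hs ht ((hf.strictMonoOn hγ).le_iff_le hs ht |>.1 hxy)

variable [T2Space M] (hg : g.IsGloballyHyperbolic)

include hg

/-- One of the two orders holds frequently, so by closedness of the causal relation the limits are
comparable. Comparable points with the same time coincide. -/
lemma eq_of_tendsto {ι : Type*} {l : Filter ι} [l.NeBot] {a b : ι → M} {x y : M}
    (ha : Tendsto a l (𝓝 x)) (hb : Tendsto b l (𝓝 y))
    (hab : ∀ᶠ i in l, b i ∈ g.causalFuture {a i} univ ∨ a i ∈ g.causalFuture {b i} univ)
    (hxy : f x = f y) : x = y := by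
  rcases frequently_or_distrib.1 hab.frequently with h | h
  · exact hf.eq_of_eq (hg.isClosed_causalRel.mem_of_frequently_of_tendsto h (ha.prodMk_nhds hb)) hxy
  · exact (hf.eq_of_eq (hg.isClosed_causalRel.mem_of_frequently_of_tendsto h (hb.prodMk_nhds ha))
      hxy.symm).symm

/-- Along an ultrafilter tending to `t`, the values converge in `K` to a point with time `t` that is
comparable with `Γ t`, hence equal to it. -/
lemma continuousOn_of_comparable {K : Set M} (hK : IsCompact K) {I : Set ℝ} {Γ : ℝ → M}
    (hΓ : MapsTo Γ I K) (hfΓ : ∀ t ∈ I, f (Γ t) = t)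
    (hle : ∀ s ∈ I, ∀ t ∈ I, s ≤ t → Γ t ∈ g.causalFuture {Γ s} univ) : ContinuousOn Γ I := by
  intro t ht
  rw [ContinuousWithinAt, tendsto_iff_ultrafilter]
  intro 𝓖 h𝓖
  have hI : ∀ᶠ s in (𝓖 : Filter ℝ), s ∈ I := h𝓖 self_mem_nhdsWithin
  obtain ⟨y, hy, hy'⟩ := hK.ultrafilter_le_nhds (𝓖.map Γ)
    (le_principal_iff.2 (show K ∈ map Γ 𝓖 from hI.mono fun s hs ↦ hΓ hs))
  have hy'' : Tendsto Γ 𝓖 (𝓝 y) := hy'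
  have h1 : f y = f (Γ t) := by
    rw [hfΓ t ht]
    refine tendsto_nhds_unique ((hf.continuous.tendsto y).comp hy'') ?_
    refine Tendsto.congr' (f₁ := id) ?_ (h𝓖.trans nhdsWithin_le_nhds)
    filter_upwards [hI] with s hs using (hfΓ s hs).symm
  have h2 := hf.eq_of_tendsto hg hy'' (tendsto_const_nhds (x := Γ t)) (by
    filter_upwards [hI] with s hs
    exact (le_total s t).imp (hle s hs t ht) (hle t ht s hs)) h1
  rwa [← h2]

/-- In a globally hyperbolic space-time, the space of the non-spacelike curves between two points
is compact. -/
lemma compactSpace_curveSpace (p q : M) : CompactSpace (g.CurveSpace p q) := by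
  refine ⟨isCompact_iff_ultrafilter_le_nhds.2 fun 𝓕 _ ↦ ?_⟩
  set K := g.causalFuture {p} univ ∩ g.causalPast {q} univ with hKdef
  have hK : IsCompact K := hg.2 p q
  -- An ultrafilter exists only if there is some curve, and this gives the strict inequality that
  -- the later rescaling to `[0, 1]` requires.
  obtain ⟨c₁, -⟩ := 𝓕.nonempty_of_mem univ_mem
  have hpq : f p < f q := hf.lt_of_curve c₁
  set I := Icc (f p) (f q) with hI
  have key : ∀ σ : g.CurveSpace p q → M, (∀ᶠ c in (𝓕 : Filter _), σ c ∈ CurveSpace.points g c) →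
      ∃ x ∈ K, Tendsto σ 𝓕 (𝓝 x) := fun σ hσ ↦
    hK.ultrafilter_le_nhds (𝓕.map σ)
      (le_principal_iff.2 (show K ∈ map σ 𝓕 from hσ.mono fun c hc ↦ points_subset c hc))
  -- `σ t c` is the point of the curve `c` at time `t`, and the limit `Γ t` along the ultrafilter
  -- will be the point of the limit curve at that time. Values for `t ∉ I` are irrelevant.
  have hex : ∀ t : ℝ, ∃ σ : g.CurveSpace p q → M, ∃ x, t ∈ I →
      (∀ c, σ c ∈ CurveSpace.points g c ∧ f (σ c) = t) ∧ x ∈ K ∧ Tendsto σ 𝓕 (𝓝 x) := by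
    intro t
    by_cases ht : t ∈ I
    · choose σ hσ hσ' using fun c : g.CurveSpace p q ↦ hf.exists_mem_points c ht
      obtain ⟨x, hx, hx'⟩ := key σ (.of_forall hσ)
      exact ⟨σ, x, fun _ ↦ ⟨fun c ↦ ⟨hσ c, hσ' c⟩, hx, hx'⟩⟩
    · exact ⟨fun _ ↦ p, p, fun h ↦ (ht h).elim⟩
  choose σ Γ hσΓ using hex
  have hfΓ : ∀ t ∈ I, f (Γ t) = t := fun t ht ↦
    tendsto_nhds_unique ((hf.continuous.tendsto _).comp (hσΓ t ht).2.2)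
      (tendsto_const_nhds.congr fun c ↦ ((hσΓ t ht).1 c).2.symm)
  have hle : ∀ s ∈ I, ∀ t ∈ I, s ≤ t → Γ t ∈ g.causalFuture {Γ s} univ := fun s hs t ht hst ↦
    hg.isClosed_causalRel.mem_of_tendsto ((hσΓ s hs).2.2.prodMk_nhds (hσΓ t ht).2.2)
      (.of_forall fun c ↦ hf.points_le c ((hσΓ s hs).1 c).1 ((hσΓ t ht).1 c).1
        (by rwa [((hσΓ s hs).1 c).2, ((hσΓ t ht).1 c).2]))
  have hcont : ContinuousOn Γ I :=
    hf.continuousOn_of_comparable hg hK (fun t ht ↦ (hσΓ t ht).2.1) hfΓ hle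
  have hpI : f p ∈ I := left_mem_Icc.2 hpq.le
  have hqI : f q ∈ I := right_mem_Icc.2 hpq.le
  have hΓp : Γ (f p) = p := (hf.eq_of_eq (hσΓ _ hpI).2.1.1 (hfΓ _ hpI).symm).symm
  have hΓq : Γ (f q) = q :=
    hf.eq_of_eq (mem_causalPast.1 (hσΓ _ hqI).2.1.2) (hfΓ _ hqI)
  have hlI : ∀ u ∈ Icc (0 : ℝ) 1, f p + u * (f q - f p) ∈ I := fun u hu ↦
    ⟨by nlinarith [hu.1], by nlinarith [hu.2]⟩
  let γ : Path p q :=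
    { toFun := fun u ↦ Γ (f p + u * (f q - f p))
      continuous_toFun := hcont.comp_continuous (by fun_prop) fun u ↦ hlI u u.2
      source' := by simpa using hΓp
      target' := by simpa using hΓq }
  have hγe : ∀ u (hu : u ∈ Icc (0 : ℝ) 1), γ.extend u = Γ (f p + u * (f q - f p)) := fun u hu ↦
    γ.extend_apply hu
  have hγ : g.IsCausalCurve (Icc 0 1) γ.extend := by
    refine isCausalCurve_of_forall_causalFuture hg.1 ordConnected_Icc
      (nontrivial_Icc_of_lt one_pos) γ.continuous_extend.continuousOn fun s hs t ht hst ↦ ?_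
    rw [hγe s hs, hγe t ht]
    have hlt : f p + s * (f q - f p) < f p + t * (f q - f p) := by nlinarith
    refine ⟨fun h ↦ hlt.ne ?_, hle _ (hlI s hs) _ (hlI t ht) hlt.le⟩
    rw [← hfΓ _ (hlI s hs), h, hfΓ _ (hlI t ht)]
  let c₀ : g.CurveSpace p q := Quotient.mk (g.reparam p q) ⟨γ, hγ⟩
  have hc₀ : ∀ t ∈ I, Γ t ∈ CurveSpace.points g c₀ := by
    intro t ht
    change Γ t ∈ range γ
    have h0 : 0 < f q - f p := sub_pos.2 hpq
    refine ⟨⟨(t - f p) / (f q - f p), div_nonneg (sub_nonneg.2 ht.1) h0.le,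
      (div_le_one h0).2 (sub_le_sub_right ht.2 _)⟩, ?_⟩
    change Γ (f p + (t - f p) / (f q - f p) * (f q - f p)) = Γ t
    rw [div_mul_cancel₀ _ h0.ne', add_sub_cancel]
  refine ⟨c₀, mem_univ _, ?_⟩
  rw [TopologicalSpace.nhds_generateFrom]
  refine le_iInf₂ fun s hs ↦ ?_
  obtain ⟨hcs, W, hW, rfl⟩ := hs
  refine le_principal_iff.2 ?_
  -- If almost every curve left `W`, choose a point outside `W` on each. Their limit `z` is outside
  -- `W`, but comparison with the points at time `f z` shows that `z = Γ (f z)`, which lies on the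
  -- limit curve.
  by_contra hnot
  have hnot' := Ultrafilter.eventually_not.2 hnot
  have hy : ∀ c : g.CurveSpace p q, ∃ y, ¬ CurveSpace.points g c ⊆ W →
      y ∈ CurveSpace.points g c ∧ y ∉ W := fun c ↦ by
    by_cases hc : CurveSpace.points g c ⊆ W
    · exact ⟨p, fun h ↦ (h hc).elim⟩
    · obtain ⟨y, hy⟩ := not_subset.1 hc
      exact ⟨y, fun _ ↦ hy⟩
  choose y hy using hy
  obtain ⟨z, hz, hyz⟩ := key y (by filter_upwards [hnot'] with c hc using (hy c hc).1)
  have hzW : z ∈ Wᶜ := hW.isClosed_compl.mem_of_tendsto hyz (by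
    filter_upwards [hnot'] with c hc using (hy c hc).2)
  have hzI : f z ∈ I := ⟨hf.le hz.1, hf.le (mem_causalPast.1 hz.2)⟩
  have := hf.eq_of_tendsto hg hyz (hσΓ _ hzI).2.2 (by
    filter_upwards [hnot'] with c hc
    exact (le_total (f (y c)) (f (σ (f z) c))).imp
      (hf.points_le c (hy c hc).1 ((hσΓ _ hzI).1 c).1)
      (hf.points_le c ((hσΓ _ hzI).1 c).1 (hy c hc).1)) (hfΓ _ hzI).symm
  exact hzW (hcs (this ▸ hc₀ _ hzI))

end IsTimeFunction

end Spacetime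

end Causality

/-! ### Level sets as Lipschitz graphs -/

namespace Causality

open Filter

section Cone

variable {E : Type*} [NormedAddCommGroup E] [NormedSpace ℝ E]
  {M : Type*} [TopologicalSpace M] [ChartedSpace E M] [IsManifold 𝓘(ℝ, E) ∞ M]
  {e : OpenPartialHomeomorph M E}

lemma transHomeomorph_mem_maximalAtlas (he : e ∈ IsManifold.maximalAtlas 𝓘(ℝ, E) ∞ M)
    (A : E ≃L[ℝ] E) :
    e.transHomeomorph A.toHomeomorph ∈ IsManifold.maximalAtlas 𝓘(ℝ, E) ∞ M := by
  refine OpenPartialHomeomorph.mem_maximalAtlas_of_contMDiffOn _ ?_ ?_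
  · exact A.contDiff.contMDiff.comp_contMDiffOn (contMDiffOn_of_mem_maximalAtlas he)
  · exact (contMDiffOn_symm_of_mem_maximalAtlas he).comp A.symm.contDiff.contMDiff.contMDiffOn
      fun y hy ↦ hy

variable {m : ∀ x : M, TangentSpace 𝓘(ℝ, E) x →L[ℝ] TangentSpace 𝓘(ℝ, E) x →L[ℝ] ℝ}
  {o : ∀ x : M, TangentSpace 𝓘(ℝ, E) x} [FiniteDimensional ℝ E]

/-- There are coordinates in which all the directions close to a given one are timelike. -/
lemma IsLorentz.exists_chart_timelike (h : IsLorentz m o) (p : M) {b : E} (hb : b ≠ 0) :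
    ∃ e ∈ IsManifold.maximalAtlas 𝓘(ℝ, E) ∞ M, p ∈ e.source ∧ ∃ W ∈ 𝓝 (e p), W ⊆ e.target ∧
      ∃ C ∈ 𝓝 b, ∀ x ∈ W, ∀ w ∈ C, ∀ s : ℝ, 0 < s → x + s • w ∈ W →
        Segment (TimelikeVec m o) univ (e.symm x) (e.symm (x + s • w)) := by
  have he := IsManifold.chart_mem_maximalAtlas (I := 𝓘(ℝ, E)) (n := ∞) p
  have hp := mem_chart_source E p
  set e := chartAt E p
  obtain ⟨u, hu, huu⟩ := exists_coordBilin_eq h he (e.map_source hp)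
  obtain ⟨r, hr, hrt, -, hrc⟩ := exists_ball_timelike h he hp univ_mem huu (by rwa [hu])
  have hu0 : u ≠ 0 := by
    rintro rfl
    simp at huu
  -- A linear change of coordinates turns the timelike direction `u` into the prescribed direction
  -- `b`.
  obtain ⟨A, hA⟩ := SeparatingDual.exists_continuousLinearEquiv_apply_eq (R := ℝ) hu0 hb
  have hW : A.symm ⁻¹' Metric.ball (e p) r ∈ 𝓝 (A (e p)) :=
    A.symm.continuous.continuousAt.preimage_mem_nhds
      (by rw [A.symm_apply_apply]; exact Metric.ball_mem_nhds _ hr)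
  have hC : A.symm ⁻¹' Metric.ball u r ∈ 𝓝 b :=
    A.symm.continuous.continuousAt.preimage_mem_nhds
      (by rw [← hA, A.symm_apply_apply]; exact Metric.ball_mem_nhds _ hr)
  refine ⟨_, transHomeomorph_mem_maximalAtlas he A, hp, _, hW, fun x hx ↦ hrt hx, _, hC,
    fun x hx w hw s hs hxw ↦ ?_⟩
  have hmap : A.symm (x + s • w) = A.symm x + s • A.symm w := by rw [map_add, map_smul]
  have := segment_line_smul he hs (convex_ball (e p) r) hrt (mapsTo_univ _ _) hx
    (hmap ▸ hxw) fun y hy ↦ hrc y hy _ hw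
  rwa [← hmap] at this

end Cone

lemma exists_box_subset {ι : Type*} [Fintype ι] {z : EuclideanSpace ℝ ι}
    {W : Set (EuclideanSpace ℝ ι)} (hW : W ∈ 𝓝 z) :
    ∃ ε > 0, ∀ y : EuclideanSpace ℝ ι, (∀ j, |y j - z j| < ε) → y ∈ W := by
  have hc : ContinuousAt (WithLp.toLp 2 : (ι → ℝ) → EuclideanSpace ℝ ι) (WithLp.ofLp z) :=
    (PiLp.continuous_toLp 2 _).continuousAt
  obtain ⟨ε, hε, h⟩ := Metric.mem_nhds_iff.1 (hc.preimage_mem_nhds (t := W) hW)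
  refine ⟨ε, hε, fun y hy ↦ h (a := WithLp.ofLp y) ?_⟩
  rw [Metric.mem_ball, dist_pi_lt_iff hε]
  exact fun j ↦ by rw [Real.dist_eq]; exact hy j

variable {n : ℕ} {M : Type*} [TopologicalSpace M]
  [ChartedSpace (EuclideanSpace ℝ (Fin (n + 1))) M] [IsManifold (𝓡 (n + 1)) ∞ M]

namespace Spacetime

variable {g : Spacetime n M}

/-- Dividing `y - x` by its time component puts it near the first basis vector, where all directions
are timelike. Taking half of `δ` as the slope turns the weak cone inequality into the strict one
that is needed. -/
lemma exists_chart_cone (g : Spacetime n M) (p : M) :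
    ∃ e ∈ IsManifold.maximalAtlas (𝓡 (n + 1)) ∞ M, p ∈ e.source ∧ ∃ ε > 0, ∃ κ > 0,
      (∀ x, (∀ j, |x j - e p j| < ε) → x ∈ e.target) ∧
      ∀ x y, (∀ j, |x j - e p j| < ε) → (∀ j, |y j - e p j| < ε) → x 0 < y 0 →
        (∀ i : Fin n, |y i.succ - x i.succ| ≤ κ * (y 0 - x 0)) →
          e.symm y ∈ g.chronFuture {e.symm x} univ := by
  obtain ⟨e, he, hp, W, hW, hWt, C, hC, h⟩ := g.isLorentz.exists_chart_timelike p
    (b := EuclideanSpace.single (0 : Fin (n + 1)) (1 : ℝ)) (by simp)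
  obtain ⟨ε, hε, hεW⟩ := exists_box_subset hW
  obtain ⟨δ, hδ, hδC⟩ := exists_box_subset hC
  refine ⟨e, he, hp, ε, hε, δ / 2, half_pos hδ, fun x hx ↦ hWt (hεW x hx),
    fun x y hx hy hxy hc ↦ ?_⟩
  have hs : 0 < y 0 - x 0 := sub_pos.2 hxy
  have hy' : x + (y 0 - x 0) • (y 0 - x 0)⁻¹ • (y - x) = y := by
    rw [smul_inv_smul₀ hs.ne', add_sub_cancel]
  have := h x (hεW x hx) ((y 0 - x 0)⁻¹ • (y - x)) (hδC _ fun j ↦ ?_) (y 0 - x 0) hs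
    (by rw [hy']; exact hεW y hy)
  · rw [hy'] at this
    exact mem_chronFuture.2 (.single this)
  · refine Fin.cases ?_ (fun i ↦ ?_) j
    · simpa [inv_mul_cancel₀ hs.ne'] using hδ
    · have h1 : |(y 0 - x 0)⁻¹ * (y i.succ - x i.succ)| ≤ δ / 2 := by
        rw [abs_mul, abs_of_pos (inv_pos.2 hs), inv_mul_le_iff₀ hs, mul_comm]
        exact hc i
      simpa using h1.trans_lt (half_lt_self hδ)

/-- The level sets of a time function are locally Lipschitz hypersurfaces. -/
lemma IsTimeFunction.isLipschitzHypersurface {f : M → ℝ} (hf : g.IsTimeFunction f)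
    (hlt : ∀ x y, y ∈ g.chronFuture {x} univ → f x < f y) (c : ℝ) :
    IsLipschitzHypersurface n {x : M | f x = c} := by
  intro p hpc
  obtain ⟨e, he, hp, ε, hε, κ, hκ, ht, hcone⟩ := g.exists_chart_cone p
  set z := e p with hz
  -- With this width, for each `v` in `D` the points at heights `± ε / 2` relative to `z` lie in the
  -- future and past cones of `z`, so the function passes through `c` between them.
  set η := min ε (κ * (ε / 2)) with hη
  have hη0 : 0 < η := lt_min hε (by positivity)
  set B : Set (EuclideanSpace ℝ (Fin (n + 1))) :=
    {x | |x 0 - z 0| < ε ∧ ∀ i : Fin n, |x i.succ - z i.succ| < η} with hB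
  have hBo : IsOpen B := by
    have hc : ∀ j, Continuous fun x : EuclideanSpace ℝ (Fin (n + 1)) ↦ |x j - z j| := fun j ↦ by
      fun_prop
    have : B = {x | |x 0 - z 0| < ε} ∩ ⋂ i : Fin n, {x | |x i.succ - z i.succ| < η} := by
      ext x
      simp [hB]
    rw [this]
    exact (isOpen_lt (hc 0) continuous_const).inter
      (isOpen_iInter_of_finite fun i ↦ isOpen_lt (hc i.succ) continuous_const)
  have hBε : ∀ x ∈ B, ∀ j, |x j - z j| < ε := fun x hx ↦
    Fin.cases hx.1 fun i ↦ (hx.2 i).trans_le (min_le_left _ _)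
  have hmono : ∀ x ∈ B, ∀ y ∈ B, x 0 < y 0 →
      (∀ i : Fin n, |y i.succ - x i.succ| ≤ κ * (y 0 - x 0)) →
        f (e.symm x) < f (e.symm y) := fun x hx y hy hxy h ↦
    hlt _ _ (hcone x y (hBε x hx) (hBε y hy) hxy h)
  let pt : ℝ → (Fin n → ℝ) → EuclideanSpace ℝ (Fin (n + 1)) := fun t v ↦
    WithLp.toLp 2 (Fin.cons t v)
  have hpt : ∀ x : EuclideanSpace ℝ (Fin (n + 1)), pt (x 0) (fun i ↦ x i.succ) = x := fun x ↦ by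
    ext j
    refine Fin.cases rfl (fun i ↦ rfl) j
  have hptc : ∀ v, Continuous fun t ↦ pt t v := fun v ↦ by
    refine (PiLp.continuous_toLp 2 _).comp (continuous_pi fun j ↦ ?_)
    refine Fin.cases continuous_id (fun i ↦ continuous_const) j
  have hpz : f (e.symm z) = c := by rw [hz, e.left_inv hp]; exact hpc
  have hzB : z ∈ B := ⟨by simpa using hε, fun i ↦ by simpa using hη0⟩
  set D : Set (Fin n → ℝ) := {v | ∀ i, |v i - z i.succ| < η} with hD
  have hsol : ∀ v ∈ D, ∃ t, |t - z 0| < ε ∧ f (e.symm (pt t v)) = c := by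
    intro v hv
    have hmem : ∀ t ∈ Icc (z 0 - ε / 2) (z 0 + ε / 2), pt t v ∈ B := fun t ht ↦
      ⟨abs_lt.2 ⟨by change -ε < t - z 0; linarith [ht.1], by
        change t - z 0 < ε; linarith [ht.2]⟩, hv⟩
    have hab : z 0 - ε / 2 ≤ z 0 + ε / 2 := by linarith
    have hcont : ContinuousOn (fun t ↦ f (e.symm (pt t v))) (Icc (z 0 - ε / 2) (z 0 + ε / 2)) :=
      hf.continuous.comp_continuousOn (e.continuousOn_symm.comp (hptc v).continuousOn
        fun t h ↦ ht _ (hBε _ (hmem t h)))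
    have hvκ : ∀ i, |v i - z i.succ| ≤ κ * (ε / 2) := fun i ↦
      (hv i).le.trans (min_le_right _ _)
    have h1 : f (e.symm (pt (z 0 - ε / 2) v)) < c := by
      rw [← hpz]
      refine hmono _ (hmem _ (left_mem_Icc.2 hab)) _ hzB ?_ fun i ↦ ?_
      · change z 0 - ε / 2 < z 0
        linarith
      · change |z i.succ - v i| ≤ κ * (z 0 - (z 0 - ε / 2))
        rw [abs_sub_comm, sub_sub_cancel]
        exact hvκ i
    have h2 : c < f (e.symm (pt (z 0 + ε / 2) v)) := by
      rw [← hpz]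
      refine hmono _ hzB _ (hmem _ (right_mem_Icc.2 hab)) ?_ fun i ↦ ?_
      · change z 0 < z 0 + ε / 2
        linarith
      · change |v i - z i.succ| ≤ κ * (z 0 + ε / 2 - z 0)
        rw [add_sub_cancel_left]
        exact hvκ i
    obtain ⟨t, htI, hft⟩ := intermediate_value_Icc hab hcont ⟨h1.le, h2.le⟩
    exact ⟨t, (hmem t htI).1, hft⟩
  -- If the height difference exceeded this bound, `y` would lie in the timelike cone of `x`, and
  -- two points of one level would have different times.
  have hLip : ∀ x ∈ B, ∀ y ∈ B, f (e.symm x) = c → f (e.symm y) = c →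
      y 0 - x 0 ≤ κ⁻¹ * dist (fun i : Fin n ↦ x i.succ) (fun i ↦ y i.succ) := by
    intro x hx y hy hxc hyc
    by_contra! hcon
    refine (hmono x hx y hy (sub_pos.1 (lt_of_le_of_lt (by positivity) hcon)) fun i ↦ ?_).ne
      (hxc.trans hyc.symm)
    rw [inv_mul_lt_iff₀ hκ] at hcon
    refine le_trans ?_ hcon.le
    have := dist_le_pi_dist (fun i : Fin n ↦ x i.succ) (fun i ↦ y i.succ) i
    rwa [Real.dist_eq, abs_sub_comm] at this
  choose! h₀ hh₀ hh₀' using hsol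
  have hptB : ∀ v ∈ D, pt (h₀ v) v ∈ B := fun v hv ↦ ⟨hh₀ v hv, hv⟩
  have hK : LipschitzOnWith ⟨κ⁻¹, (inv_pos.2 hκ).le⟩ h₀ D := by
    refine LipschitzOnWith.of_le_add_mul _ fun v hv w hw ↦ ?_
    have := hLip _ (hptB w hw) _ (hptB v hv) (hh₀' w hw) (hh₀' v hv)
    change h₀ v - h₀ w ≤ κ⁻¹ * dist w v at this
    rw [dist_comm] at this
    change h₀ v ≤ h₀ w + κ⁻¹ * dist v w
    linarith
  -- The height is defined only over `D`, while the definition of a hypersurface asks for a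
  -- Lipschitz function on all of `Fin n → ℝ`.
  obtain ⟨h, hh, heq⟩ := hK.extend_real
  refine ⟨e.restr (e.source ∩ e ⁻¹' B), restr_mem_maximalAtlas _ he (e.isOpen_inter_preimage hBo),
    ?_, _, h, hh, fun x hx ↦ ?_⟩
  · rw [e.restr_source' _ (e.isOpen_inter_preimage hBo)]
    exact ⟨hp, hp, hzB⟩
  · rw [e.restr_source' _ (e.isOpen_inter_preimage hBo)] at hx
    obtain ⟨hxe, -, hxB⟩ := hx
    change f x = c ↔ e x 0 = h fun i ↦ e x i.succ
    have hv : (fun i ↦ e x i.succ) ∈ D := hxB.2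
    rw [← heq hv]
    set v : Fin n → ℝ := fun i ↦ e x i.succ with hvdef
    constructor
    · intro hxc
      rw [← e.left_inv hxe] at hxc
      have h1 := hLip _ hxB _ (hptB v hv) hxc (hh₀' v hv)
      have h2 := hLip _ (hptB v hv) _ hxB (hh₀' v hv) hxc
      have h3 : dist v v = 0 := dist_self v
      change h₀ v - e x 0 ≤ κ⁻¹ * dist v v at h1
      change e x 0 - h₀ v ≤ κ⁻¹ * dist v v at h2
      rw [h3, mul_zero] at h1 h2
      linarith
    · intro hx0
      rw [← e.left_inv hxe, ← hpt (e x), hx0]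
      exact hh₀' v hv

end Spacetime

end Causality

/-! ### Inextendible curves and Cauchy surfaces -/

namespace Causality

open Filter

variable {n : ℕ} {M : Type*} [TopologicalSpace M]
  [ChartedSpace (EuclideanSpace ℝ (Fin (n + 1))) M] [IsManifold (𝓡 (n + 1)) ∞ M]

namespace Spacetime

variable {g : Spacetime n M}

section

variable [T2Space M]

/-- A non-spacelike curve without a future endpoint leaves the past of every point. -/
lemma IsGloballyHyperbolic.exists_notMem_causalPast (hg : g.IsGloballyHyperbolic) {F : Set ℝ}
    {γ : ℝ → M} (hγ : g.IsCausalCurve F γ) (hend : ∀ p, ¬ IsFutureEndpoint F γ p) (y : M) :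
    ∃ t ∈ F, γ t ∉ g.causalPast {y} univ := by
  by_contra! hy
  obtain ⟨t₀, ht₀⟩ := hγ.2.1.nonempty
  have : Nonempty F := ⟨⟨t₀, ht₀⟩⟩
  set u : F → M := fun t ↦ γ t with hu
  have hmono : ∀ s t : F, s ≤ t → u t ∈ g.causalFuture {u s} univ := fun s t hst ↦
    hγ.mem_causalFuture s.2 t.2 hst
  set K := g.causalFuture {γ t₀} univ ∩ g.causalPast {y} univ with hKdef
  have hK : IsCompact K := hg.2 _ _
  have hmem : ∀ᶠ t in atTop, u t ∈ K := by
    filter_upwards [eventually_ge_atTop (⟨t₀, ht₀⟩ : F)] with t ht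
    exact ⟨hmono _ t ht, hy t t.2⟩
  obtain ⟨x, hx, hxu⟩ := hK.exists_mapClusterPt_of_frequently hmem.frequently
  have hfut : ∀ z, MapClusterPt z atTop u → ∀ t, z ∈ g.causalFuture {u t} univ := fun z hz t ↦
    (hg.isClosed_causalFuture (u t)).mem_of_mapClusterPt hz
      ((eventually_ge_atTop t).mono fun s hs ↦ hmono t s hs)
  -- Any two cluster points lie in each other's causal future, so antisymmetry leaves only one. In
  -- the compact set `K` the curve then converges to it, which gives a future endpoint.
  have hpast : ∀ z, MapClusterPt z atTop u → ∀ w, MapClusterPt w atTop u →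
      w ∈ g.causalFuture {z} univ := fun z hz w hw ↦
    mem_causalPast.1 ((hg.isClosed_causalPast w).mem_of_mapClusterPt hz
      (.of_forall fun t ↦ mem_causalPast.2 (hfut w hw t)))
  have htend : Tendsto u atTop (𝓝 x) := hK.tendsto_nhds_of_unique_mapClusterPt hmem
    fun z _ hz ↦ hg.eq_of_mem_causalFuture (hpast z hz x hxu) (hpast x hxu z hz)
  refine hend x fun V hV ↦ ?_
  obtain ⟨t, ht⟩ := eventually_atTop.1 (htend.eventually hV)
  exact ⟨t, t.2, fun s hs hts ↦ ht ⟨s, hs⟩ hts⟩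

variable [MeasurableSpace M] [BorelSpace M] {μ : Measure M}

/-- The volume ratio is unbounded along non-spacelike curves without future endpoint. -/
lemma IsNormalizedVolume.exists_lt_volRatio (hμ : IsNormalizedVolume n μ)
    (hg : g.IsGloballyHyperbolic) {F : Set ℝ} {γ : ℝ → M} (hγ : g.IsCausalCurve F γ)
    (hend : ∀ p, ¬ IsFutureEndpoint F γ p) {c : ℝ} (hc : 0 < c) :
    ∃ t ∈ F, c < g.volRatio μ (γ t) := by
  have := hμ.isProbabilityMeasure
  have := hγ.1
  obtain ⟨t₀, ht₀⟩ := hγ.2.1.nonempty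
  have : Nonempty F := ⟨⟨t₀, ht₀⟩⟩
  -- The chronological futures decrease along the curve. A point common to all of them would have
  -- the entire curve in its past, so the intersection is empty and $f^+\to0$, while $f^-$ stays at
  -- least its value at `t₀`.
  have hlim := tendsto_measure_iInter_atTop (μ := μ) (s := fun t : F ↦ g.chronFuture {γ t} univ)
    (fun t ↦ (isOpen_chronFuture _).measurableSet.nullMeasurableSet)
    (fun s t hst x hx ↦ chronFuture_of_causalFuture_of_chronFuture
      (hγ.mem_causalFuture s.2 t.2 hst) hx) ⟨⟨t₀, ht₀⟩, measure_ne_top _ _⟩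
  have hempty : ⋂ t : F, g.chronFuture {γ t} univ = ∅ := by
    refine eq_empty_of_forall_notMem fun y hy ↦ ?_
    obtain ⟨t, ht, h⟩ := hg.exists_notMem_causalPast hγ hend y
    exact h (mem_causalPast.2 (causalFuture_of_chronFuture (mem_iInter.1 hy ⟨t, ht⟩)))
  rw [hempty, measure_empty] at hlim
  have hlim' : Tendsto (fun t : F ↦ g.volFuture μ (γ t)) atTop (𝓝 0) :=
    (ENNReal.tendsto_toReal ENNReal.zero_ne_top).comp hlim
  have hpos := volPast_pos hμ g (γ t₀)
  obtain ⟨t, ht, htt⟩ := ((hlim'.eventually_lt_const (div_pos hpos hc)).and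
    (eventually_ge_atTop (⟨t₀, ht₀⟩ : F))).exists
  refine ⟨t, t.2, ?_⟩
  have h1 : g.volPast μ (γ t₀) ≤ g.volPast μ (γ t) := by
    rcases eq_or_ne (γ t₀) (γ t) with h | h
    · rw [h]
    · exact (volPast_lt_volPast hμ hg (hγ.mem_causalFuture ht₀ t.2 htt) h).le
  rw [volRatio, lt_div_iff₀ (volFuture_pos hμ g _)]
  rw [lt_div_iff₀ hc, mul_comm] at ht
  exact ht.trans_le h1

omit [T2Space M] [BorelSpace M] in
lemma volRatio_reverse (g : Spacetime n M) (μ : Measure M) (p : M) :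
    g.reverse.volRatio μ p = (g.volRatio μ p)⁻¹ := by
  rw [volRatio, volRatio, inv_div, ← volFuture_eq_reverse, volFuture_eq_reverse g.reverse,
    reverse_reverse]

/-- Time reversal exchanges the endpoints and inverts the ratio, so this is unboundedness above,
applied to `c⁻¹`. -/
lemma IsNormalizedVolume.exists_volRatio_lt (hμ : IsNormalizedVolume n μ)
    (hg : g.IsGloballyHyperbolic) {F : Set ℝ} {γ : ℝ → M} (hγ : g.IsCausalCurve F γ)
    (hend : ∀ p, ¬ IsPastEndpoint F γ p) {c : ℝ} (hc : 0 < c) :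
    ∃ t ∈ F, g.volRatio μ (γ t) < c := by
  obtain ⟨t, ht, h⟩ := hμ.exists_lt_volRatio hg.reverse hγ.reverse (fun p hp ↦ hend p fun V hV ↦ by
    obtain ⟨t, ht, h⟩ := hp V hV
    refine ⟨-t, ht, fun s hs hst ↦ ?_⟩
    have := h (-s) (by simpa using hs) (le_neg_of_le_neg hst)
    rwa [← neg_neg s]) (inv_pos.2 hc)
  refine ⟨-t, ht, ?_⟩
  rw [volRatio_reverse] at h
  exact (inv_lt_inv₀ hc (div_pos (volPast_pos hμ g _) (volFuture_pos hμ g _))).1 h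

variable [SecondCountableTopology M]

/-- The level sets of the volume ratio are Cauchy surfaces. -/
lemma IsNormalizedVolume.isCauchySurface (hμ : IsNormalizedVolume n μ)
    (hg : g.IsGloballyHyperbolic) {c : ℝ} (hc : 0 < c) :
    g.IsCauchySurface {p | g.volRatio μ p = c} := by
  have hf := hμ.isTimeFunction hg
  refine ⟨isClosed_eq hf.continuous continuous_const, hf.isLipschitzHypersurface
    (fun x y ↦ hf.lt_of_mem_chronFuture) c,
    fun p hp q hq hpq ↦ (hf.eq_of_eq hpq (Eq.trans hp (Eq.symm hq))).symm, fun F γ hγ ↦ ?_⟩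
  obtain ⟨hγ, hfut, hpast⟩ := hγ
  obtain ⟨a, ha, hac⟩ := hμ.exists_volRatio_lt hg hγ hpast hc
  obtain ⟨b, hb, hbc⟩ := hμ.exists_lt_volRatio hg hγ hfut hc
  have hmono := hf.strictMonoOn hγ
  have hab : a < b := (hmono.lt_iff_lt ha hb).1 (hac.trans hbc)
  obtain ⟨t, ht, htc⟩ := intermediate_value_Icc hab.le
      (hf.continuous.comp_continuousOn (hγ.2.2.1.mono (hγ.1.out ha hb))) ⟨hac.le, hbc.le⟩
  exact ⟨t, ⟨hγ.1.out ha hb ht, htc⟩, fun s hs ↦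
    hmono.injOn hs.1 (hγ.1.out ha hb ht) (Eq.trans hs.2 htc.symm)⟩

end

end Spacetime

end Causality

end

theorem mainTheorem11 (n : ℕ) (hn : 1 ≤ n) (M : Type*) [TopologicalSpace M] [T2Space M]
    [ConnectedSpace M] [ChartedSpace (EuclideanSpace ℝ (Fin (n + 1))) M]
    [IsManifold (𝓡 (n + 1)) ∞ M] [MeasurableSpace M] [BorelSpace M]
    (g : Causality.Spacetime n M) (hg : g.IsGloballyHyperbolic) :
    -- causal futures and pasts of points are closed
    (∀ p : M, IsClosed (g.causalFuture {p} univ) ∧ IsClosed (g.causalPast {p} univ)) ∧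
    -- strong causality, and compactness of the spaces of non-spacelike curves
    ((∀ p : M, g.StronglyCausalAt p) ∧
      (univ : Set M) = g.causalPast univ univ ∩ g.causalFuture univ univ ∧
      ∀ p q : M, CompactSpace (g.CurveSpace p q)) ∧
    -- there are Cauchy surfaces
    (∃ S : Set M, g.IsCauchySurface S) ∧
    -- they are obtained as the level sets of the volume ratio, which is a time function
    (∃ μ : Measure M, Causality.Spacetime.IsNormalizedVolume n μ) ∧
    ∀ μ : Measure M, Causality.Spacetime.IsNormalizedVolume n μ →
      (∀ p : M, 0 < g.volPast μ p ∧ 0 < g.volFuture μ p) ∧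
      Continuous (g.volPast μ) ∧ Continuous (g.volFuture μ) ∧ Continuous (g.volRatio μ) ∧
      (∀ (F : Set ℝ) (γ : ℝ → M), g.IsCausalCurve F γ → StrictMonoOn (g.volRatio μ ∘ γ) F) ∧
      ∀ c : ℝ, 0 < c → g.IsCauchySurface {p | g.volRatio μ p = c} := by
  -- Needed for the countable atlas behind the measure and for passing from locally null to null.
  have := g.secondCountableTopology
  obtain ⟨μ, hμ⟩ := Causality.Spacetime.exists_isNormalizedVolume (n := n) (M := M)
  refine ⟨fun p ↦ ⟨hg.isClosed_causalFuture p, hg.isClosed_causalPast p⟩,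
    ⟨hg.1, ?_, (hμ.isTimeFunction hg).compactSpace_curveSpace hg⟩,
    ⟨_, hμ.isCauchySurface hg one_pos⟩, ⟨μ, hμ⟩, fun μ hμ ↦ ?_⟩
  · ext x
    exact iff_of_true (mem_univ x) ⟨Or.inl ⟨mem_univ x, mem_univ x⟩,
      Or.inl ⟨mem_univ x, mem_univ x⟩⟩
  · have hf := hμ.isTimeFunction hg
    exact ⟨fun p ↦ ⟨Causality.Spacetime.volPast_pos hμ g p,
      Causality.Spacetime.volFuture_pos hμ g p⟩, Causality.Spacetime.continuous_volPast hμ hg,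
      Causality.Spacetime.continuous_volFuture hμ hg, hf.continuous,
      fun F γ hγ ↦ hf.strictMonoOn hγ, fun c hc ↦ hμ.isCauchySurface hg hc⟩
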